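/- \textbf{Setting.} An operator algebra is a norm closed subalgebra of $\mathbb B(H_1)$ for a Hilbert space $H_1$. A $\Delta$-pair $(\mathcal A,\mathcal C)$ consists of an operator algebra $\mathcal A$ and a $C^*$-algebra $\mathcal C\subseteq\mathcal A$ with $\mathcal A=\overline{[\mathcal A\,\mathcal C]}=\overline{[\mathcal C\,\mathcal A]}$, where $\overline{[\,\cdot\,]}$ denotes the norm closed linear span of the products. Let $(\mathcal A,\mathcal C)$, $(\mathcal B,\mathcal D)$ be $\Delta$-pairs which are $\Delta$-equivalent through one ternary ring of operators: there are Hilbert spaces $H,K$, completely isometric homomorphisms $\alpha:\mathcal A\to\mathbb B(H)$, $\beta:\mathcal B\to\mathbb B(K)$ and a linear subspace $M\subseteq\mathbb B(H,K)$ with $MM^*M\subseteq M$ such that $$\alpha(\mathcal A)=\overline{[M^*\beta(\mathcal B)M]},\quad \beta(\mathcal B)=\overline{[M\alpha(\mathcal A)M^*]},\quad \alpha(\mathcal C)=\overline{[M^*\beta(\mathcal D)M]},\quad \beta(\mathcal D)=\overline{[M\alpha(\mathcal C)M^*]}.$$ Identify $\mathcal A,\mathcal B$ with their images under $\alpha,\beta$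 and put $E=\overline{[M^*M]}$. Let ${}_{\mathcal A}OMOD$ be the category of essential left $\mathcal A$-operator modules: operator spaces $U$ (complete, with matrix norms satisfying Ruan's axioms) with an associative bilinear action of $\mathcal A$ that is completely contractive ($\|ax\|\le\|a\|\,\|x\|$ for matrices $a$ over $\mathcal A$ and $x$ over $U$ of matching sizes) and with $U=\overline{[\mathcal A U]}$; the morphisms are the completely bounded $\mathcal A$-module maps. Let ${}_{\mathcal A}HMOD$ be the category of Hilbert space representations of $\mathcal A$: Hilbert spaces $H'$ with a completely contractive homomorphism $\pi:\mathcal A\to\mathbb B(H')$ such that $\overline{[\pi(\mathcal A)H']}=H'$; the morphisms are the bounded intertwining operators. It is a full subcategory of ${}_{\mathcal A}OMOD$, with $H'$ regarded as the column operator space $\mathbb B(\mathbb C,H')$. Similarly for $\mathcal B$. For $U\in{}_{\mathcal A}OMOD$ let $\mathcal F(U)=M\otimes^h_E U$ be the balanced Haagerup tensor product, that is, the separated completion of $M\otimes U$ in the matrix norms $$\|t\|=\inf\{\|x\|\,\|y\| : t=x\odot y \text{ modulo the span of the elements } me\otimes u-m\otimes eu\ (e\in E,\ m, me\in M,\ u\in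 \mathcal A U)\},$$ where $x,y$ are matrices over $M$ and $U$ and $E$ acts on $\mathcal AU$ by $e(au)=(ea)u$. It carries the action of $\mathcal B$ determined by $(man^*)(\ell\otimes u)=m\otimes(an^*\ell)u$ for $m,n,\ell\in M$, $a\in\mathcal A$, and $\mathcal F(f)(\ell\otimes u)=\ell\otimes f(u)$ on morphisms. \textbf{Claim.} The functor $\mathcal F:{}_{\mathcal A}OMOD\to{}_{\mathcal B}OMOD$ exists, and it (more precisely, any functor meeting these requirements) restricts to an equivalence ${}_{\mathcal A}HMOD\to{}_{\mathcal B}HMOD$: there is an equivalence of categories $\Phi:{}_{\mathcal A}HMOD\to{}_{\mathcal B}HMOD$ with $\mathcal F(H')\cong\Phi(H')$ completely isometrically and naturally in $H'$, as $\mathcal B$-operator modules. Moreover, if the representation $\pi$ of $\mathcal A$ on $H'$ is completely isometric, then so is the representation of $\mathcal B$ on $\Phi(H')$. -/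

import Mathlib

open CategoryTheory
open scoped TensorProduct InnerProductSpace

set_option linter.unusedSectionVars false

universe u v w w₁ w₂

noncomputable section

namespace DeltaMorita

/-! ### Matrices of operators -/

section MatOp

variable {ι κ μ : Type} [Fintype ι] [Fintype κ] [Fintype μ]
variable {X : Type u} [NormedAddCommGroup X] [InnerProductSpace ℂ X]
variable {Y : Type v} [NormedAddCommGroup Y] [InnerProductSpace ℂ Y]
variable {Z : Type w} [NormedAddCommGroup Z] [InnerProductSpace ℂ Z]

/-- The operator `X^κ → Y^ι` between Hilbert space direct sums given by a matrix of bounded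
operators. -/
def matOp (T : Matrix ι κ (X →L[ℂ] Y)) :
    PiLp 2 (fun _ : κ => X) →L[ℂ] PiLp 2 (fun _ : ι => Y) :=
  ((PiLp.continuousLinearEquiv 2 ℂ (fun _ : ι => Y)).symm :
      (ι → Y) →L[ℂ] PiLp 2 (fun _ : ι => Y)) ∘L
    ContinuousLinearMap.pi
      (fun i => ∑ j, T i j ∘L PiLp.proj (𝕜 := ℂ) 2 (fun _ : κ => X) j)

@[simp] theorem matOp_apply (T : Matrix ι κ (X →L[ℂ] Y)) (x : PiLp 2 (fun _ : κ => X)) (i : ι) :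
    matOp T x i = ∑ j, T i j (x j) := by
  simp [matOp]

/-- The norm of a matrix of bounded operators, viewed as an operator `X^κ → Y^ι`. -/
def matNorm (T : Matrix ι κ (X →L[ℂ] Y)) : ℝ := ‖matOp T‖

theorem matNorm_nonneg (T : Matrix ι κ (X →L[ℂ] Y)) : 0 ≤ matNorm T :=
  (matOp T).opNorm_nonneg

theorem matNorm_add_le (S T : Matrix ι κ (X →L[ℂ] Y)) :
    matNorm (S + T) ≤ matNorm S + matNorm T := by
  have : matOp (S + T) = matOp S + matOp T := by
    ext x i
    simp [Finset.sum_add_distrib]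
  rw [matNorm, this]
  exact (matOp S).opNorm_add_le (matOp T)

theorem matNorm_comp_le (S : Matrix ι κ (Y →L[ℂ] Z)) (T : Matrix κ μ (X →L[ℂ] Y)) :
    matNorm (Matrix.of fun i j => ∑ k, S i k ∘L T k j) ≤ matNorm S * matNorm T := by
  have : matOp (Matrix.of fun i j => ∑ k, S i k ∘L T k j) = matOp S ∘L matOp T := by
    ext x i
    simp only [matOp_apply, ContinuousLinearMap.comp_apply, Matrix.of_apply, sum_apply, map_sum]
    exact Finset.sum_comm
  rw [matNorm, this]
  exact (matOp S).opNorm_comp_le (matOp T)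

theorem matNorm_le {T : Matrix ι κ (X →L[ℂ] Y)} {c : ℝ} (hc : 0 ≤ c)
    (h : ∀ x : κ → X, ∑ i, ‖∑ j, T i j (x j)‖ ^ 2 ≤ c ^ 2 * ∑ j, ‖x j‖ ^ 2) :
    matNorm T ≤ c := by
  refine ContinuousLinearMap.opNorm_le_bound _ hc fun x => ?_
  refine le_of_sq_le_sq ?_ (by positivity)
  rw [mul_pow, PiLp.norm_sq_eq_of_L2, PiLp.norm_sq_eq_of_L2]
  simpa using h x

theorem sum_norm_sq_le (T : Matrix ι κ (X →L[ℂ] Y)) (x : κ → X) :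
    ∑ i, ‖∑ j, T i j (x j)‖ ^ 2 ≤ matNorm T ^ 2 * ∑ j, ‖x j‖ ^ 2 := by
  have h := pow_le_pow_left₀ (norm_nonneg _) ((matOp T).le_opNorm (WithLp.toLp 2 x)) 2
  rw [mul_pow, PiLp.norm_sq_eq_of_L2, PiLp.norm_sq_eq_of_L2] at h
  simpa [matNorm] using h

open scoped Matrix.Norms.L2Operator in
theorem matNorm_smul_le [DecidableEq κ] (S : Matrix ι κ ℂ) :
    matNorm (S.map fun s => s • ContinuousLinearMap.id ℂ X) ≤ ‖S‖ := by
  refine matNorm_le (norm_nonneg _) fun x => ?_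
  let V := Submodule.span ℂ (Set.range x)
  have : FiniteDimensional ℂ V := FiniteDimensional.span_of_finite ℂ (Set.finite_range x)
  let b := stdOrthonormalBasis ℂ V
  let y : κ → V := fun j => ⟨x j, Submodule.subset_span ⟨j, rfl⟩⟩
  have e1 : ∀ i, ‖∑ j, (S.map fun s => s • ContinuousLinearMap.id ℂ X) i j (x j)‖ ^ 2
      = ∑ k, ‖∑ j, S i j * ⟪b k, y j⟫_ℂ‖ ^ 2 := by
    intro i
    have : ∑ j, (S.map fun s => s • ContinuousLinearMap.id ℂ X) i j (x j)
        = ((∑ j, S i j • y j : V) : X) := by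
      simp [y]
    rw [this]
    change ‖(∑ j, S i j • y j : V)‖ ^ 2 = _
    rw [← b.sum_sq_norm_inner_right]
    simp [inner_sum, inner_smul_right]
  have e2 : ∀ j, ‖x j‖ ^ 2 = ∑ k, ‖⟪b k, y j⟫_ℂ‖ ^ 2 := by
    intro j
    rw [b.sum_sq_norm_inner_right (y j)]
    simp [y]
  simp_rw [e1, e2]
  rw [Finset.sum_comm, Finset.sum_comm (s := (Finset.univ : Finset κ)), Finset.mul_sum]
  refine Finset.sum_le_sum fun k _ => ?_
  have h := pow_le_pow_left₀ (norm_nonneg _)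
    (Matrix.l2_opNorm_mulVec S (WithLp.toLp 2 (fun j => ⟪b k, y j⟫_ℂ))) 2
  rw [mul_pow, EuclideanSpace.norm_sq_eq, EuclideanSpace.norm_sq_eq] at h
  simpa [Matrix.mulVec, dotProduct] using h

end MatOp

/-! ### Operator spaces -/

open scoped Matrix.Norms.L2Operator in
/-- Matrix norms on a normed space satisfying Ruan's axioms (norms are given on rectangular
matrices with arbitrary finite index types; scalar matrices carry the operator norm).
A complete normed space with this structure is an (abstract) operator space. -/
class OperatorSpace (V : Type u) [NormedAddCommGroup V] [NormedSpace ℂ V] where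
  mnorm : ∀ {ι κ : Type} [Fintype ι] [Fintype κ], Matrix ι κ V → ℝ
  mnorm_unit : ∀ x : V, mnorm (Matrix.of fun _ _ : Unit => x) = ‖x‖
  mnorm_add_le : ∀ {ι κ : Type} [Fintype ι] [Fintype κ] (x y : Matrix ι κ V),
    mnorm (x + y) ≤ mnorm x + mnorm y
  mnorm_mul_le : ∀ {ι ι' κ κ' : Type} [Fintype ι] [Fintype ι'] [Fintype κ] [Fintype κ']
    [DecidableEq ι] [DecidableEq κ'] (S : Matrix ι' ι ℂ) (x : Matrix ι κ V) (T : Matrix κ κ' ℂ),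
    mnorm (Matrix.of fun i j => ∑ k, ∑ l, (S i k * T l j) • x k l) ≤ ‖S‖ * mnorm x * ‖T‖
  mnorm_fromBlocks_le : ∀ {ι ι' κ κ' : Type} [Fintype ι] [Fintype ι'] [Fintype κ] [Fintype κ']
    (x : Matrix ι κ V) (y : Matrix ι' κ' V),
    mnorm (Matrix.fromBlocks x 0 0 y) ≤ max (mnorm x) (mnorm y)

open OperatorSpace

/-- `f` is completely isometric. -/
def IsCompleteIsometry {V W : Type u} [NormedAddCommGroup V] [NormedSpace ℂ V] [OperatorSpace V]
    [NormedAddCommGroup W] [NormedSpace ℂ W] [OperatorSpace W] (f : V →ₗ[ℂ] W) : Prop :=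
  ∀ {ι κ : Type} [Fintype ι] [Fintype κ] (x : Matrix ι κ V), mnorm (x.map f) = mnorm x

/-- `f` is completely bounded. -/
def IsCompletelyBounded {V W : Type u} [NormedAddCommGroup V] [NormedSpace ℂ V] [OperatorSpace V]
    [NormedAddCommGroup W] [NormedSpace ℂ W] [OperatorSpace W] (f : V →ₗ[ℂ] W) : Prop :=
  ∃ c : ℝ, 0 ≤ c ∧
    ∀ {ι κ : Type} [Fintype ι] [Fintype κ] (x : Matrix ι κ V), mnorm (x.map f) ≤ c * mnorm x

section Column

variable {ι κ μ : Type} [Fintype ι] [Fintype κ] [Fintype μ]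
variable {X : Type u} [NormedAddCommGroup X] [InnerProductSpace ℂ X]
variable {Y : Type v} [NormedAddCommGroup Y] [InnerProductSpace ℂ Y]

/-- A matrix of vectors, viewed as a matrix of operators via `X = B(ℂ, X)`. -/
def columnOp (x : Matrix ι κ X) : Matrix ι κ (ℂ →L[ℂ] X) :=
  x.map (fun ξ => ContinuousLinearMap.toSpanSingleton ℂ ξ)

@[simp] theorem columnOp_apply (x : Matrix ι κ X) (i : ι) (j : κ) (c : ℂ) :
    columnOp x i j c = c • x i j := by
  simp [columnOp]

variable (X) in
/-- The column operator space structure `X_c = B(ℂ, X)` of a Hilbert space `X`. -/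
abbrev columnOperatorSpace : OperatorSpace X where
  mnorm x := matNorm (columnOp x)
  mnorm_unit x := by
    apply le_antisymm
    · refine matNorm_le (norm_nonneg _) fun z => ?_
      simp [norm_smul, mul_pow, mul_comm]
    · have h := sum_norm_sq_le (columnOp (Matrix.of fun _ _ : Unit => x)) (fun _ => 1)
      simp only [columnOp_apply, Matrix.of_apply, Finset.univ_unique, Finset.sum_singleton,
        one_smul, norm_one, one_pow, mul_one] at h
      exact le_of_sq_le_sq h (matNorm_nonneg _)
  mnorm_add_le x y := by
    have : columnOp (x + y) = columnOp x + columnOp y := by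
      ext i j; simp [columnOp]
    rw [this]
    exact matNorm_add_le _ _
  mnorm_mul_le S x T := by
    have : columnOp (Matrix.of fun i j => ∑ k, ∑ l, (S i k * T l j) • x k l)
        = Matrix.of fun i j => ∑ k, (S.map fun s => s • ContinuousLinearMap.id ℂ X) i k ∘L
            (Matrix.of fun k j => ∑ l, columnOp x k l ∘L
              (T.map fun s => s • ContinuousLinearMap.id ℂ ℂ) l j) k j := by
      ext i j
      simp [Finset.smul_sum, mul_smul]
    rw [this, mul_assoc]
    refine (matNorm_comp_le _ _).trans (mul_le_mul (matNorm_smul_le S) ?_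
      (matNorm_nonneg _) ((matNorm_nonneg _).trans (matNorm_smul_le (X := X) S)))
    exact (matNorm_comp_le _ _).trans
      (mul_le_mul_of_nonneg_left (matNorm_smul_le T) (matNorm_nonneg _))
  mnorm_fromBlocks_le x y := by
    refine matNorm_le (le_max_of_le_left (matNorm_nonneg _)) fun z => ?_
    have h1 := sum_norm_sq_le (columnOp x) (fun j => z (Sum.inl j))
    have h2 := sum_norm_sq_le (columnOp y) (fun j => z (Sum.inr j))
    have m1 := pow_le_pow_left₀ (matNorm_nonneg _)
      (le_max_left (matNorm (columnOp x)) (matNorm (columnOp y))) 2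
    have m2 := pow_le_pow_left₀ (matNorm_nonneg _)
      (le_max_right (matNorm (columnOp x)) (matNorm (columnOp y))) 2
    have k1 := h1.trans (mul_le_mul_of_nonneg_right m1 (by positivity))
    have k2 := h2.trans (mul_le_mul_of_nonneg_right m2 (by positivity))
    rw [Fintype.sum_sum_type, Fintype.sum_sum_type, mul_add]
    refine add_le_add (le_of_eq_of_le ?_ k1) (le_of_eq_of_le ?_ k2) <;> simp

theorem columnNorm_mul_le (a : Matrix ι κ (X →L[ℂ] Y)) (x : Matrix κ μ X) :
    matNorm (columnOp (Matrix.of fun i j => ∑ k, a i k (x k j))) ≤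
      matNorm a * matNorm (columnOp x) := by
  have : columnOp (Matrix.of fun i j => ∑ k, a i k (x k j))
      = Matrix.of fun i j => ∑ k, a i k ∘L columnOp x k j := by
    ext i j
    simp
  rw [this]
  exact matNorm_comp_le _ _

theorem columnNorm_map_le (f : X →L[ℂ] Y) (x : Matrix ι κ X) :
    matNorm (columnOp (x.map f)) ≤ ‖f‖ * matNorm (columnOp x) := by
  refine matNorm_le (mul_nonneg (norm_nonneg _) (matNorm_nonneg _)) fun z => ?_
  have h := sum_norm_sq_le (columnOp x) z
  have e : ∀ i, ∑ j, columnOp (x.map f) i j (z j) = f (∑ j, columnOp x i j (z j)) := by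
    intro i; simp
  calc ∑ i, ‖∑ j, columnOp (x.map f) i j (z j)‖ ^ 2
      ≤ ∑ i, ‖f‖ ^ 2 * ‖∑ j, columnOp x i j (z j)‖ ^ 2 := by
        refine Finset.sum_le_sum fun i _ => ?_
        rw [e, ← mul_pow]
        exact pow_le_pow_left₀ (norm_nonneg _) (f.le_opNorm _) 2
    _ ≤ ‖f‖ ^ 2 * (matNorm (columnOp x) ^ 2 * ∑ j, ‖z j‖ ^ 2) := by
        rw [← Finset.mul_sum]
        exact mul_le_mul_of_nonneg_left h (by positivity)
    _ = _ := by ring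

end Column

/-! ### Operator algebras, `Δ`-pairs, ternary rings of operators -/

section Algebras

variable {H₁ : Type w₁} [NormedAddCommGroup H₁] [InnerProductSpace ℂ H₁]
variable {H : Type u} [NormedAddCommGroup H] [InnerProductSpace ℂ H] [CompleteSpace H]
variable {K : Type v} [NormedAddCommGroup K] [InnerProductSpace ℂ K] [CompleteSpace K]

/-- A homomorphism `A → B(H)` on a (concrete) operator algebra is completely contractive. -/
def CompletelyContractive {A : NonUnitalSubalgebra ℂ (H₁ →L[ℂ] H₁)}
    (φ : A →ₙₐ[ℂ] (H →L[ℂ] H)) : Prop :=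
  ∀ {ι κ : Type} [Fintype ι] [Fintype κ] (a : Matrix ι κ A),
    matNorm (a.map φ) ≤ matNorm (a.map (fun a : A => (a : H₁ →L[ℂ] H₁)))

/-- A homomorphism `A → B(H)` on a (concrete) operator algebra is completely isometric. -/
def CompletelyIsometric {A : NonUnitalSubalgebra ℂ (H₁ →L[ℂ] H₁)}
    (φ : A →ₙₐ[ℂ] (H →L[ℂ] H)) : Prop :=
  ∀ {ι κ : Type} [Fintype ι] [Fintype κ] (a : Matrix ι κ A),
    matNorm (a.map φ) = matNorm (a.map (fun a : A => (a : H₁ →L[ℂ] H₁)))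

/-- The norm closure of the linear span of a set of operators. -/
def closedSpan (S : Set (H →L[ℂ] K)) : Set (H →L[ℂ] K) :=
  closure (Submodule.span ℂ S : Set (H →L[ℂ] K))

/-- `(A, C)` is a `Δ`-pair: `A ⊆ B(H)` is an operator algebra (a norm closed subalgebra), `C ⊆ A`
is a C⋆-algebra, and `A` is the closed span of `A C` as well as of `C A`. -/
structure IsDeltaPair (A : NonUnitalSubalgebra ℂ (H →L[ℂ] H))
    (C : NonUnitalStarSubalgebra ℂ (H →L[ℂ] H)) : Prop where
  isClosed_left : IsClosed (A : Set (H →L[ℂ] H))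
  isClosed_right : IsClosed (C : Set (H →L[ℂ] H))
  le : ∀ c ∈ C, c ∈ A
  eq_mul_right : (A : Set (H →L[ℂ] H)) = closedSpan {x | ∃ a ∈ A, ∃ c ∈ C, x = a ∘L c}
  eq_mul_left : (A : Set (H →L[ℂ] H)) = closedSpan {x | ∃ c ∈ C, ∃ a ∈ A, x = c ∘L a}

/-- A ternary ring of operators: a linear subspace `M ⊆ B(H, K)` with `M M⋆ M ⊆ M`. -/
def IsTRO (M : Submodule ℂ (H →L[ℂ] K)) : Prop :=
  ∀ l ∈ M, ∀ m ∈ M, ∀ n ∈ M, l ∘L (ContinuousLinearMap.adjoint m) ∘L n ∈ M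

/-- `P` is the closed span of `M⋆ Q M` and `Q` is the closed span of `M P M⋆`. -/
def TROEquivalentVia (M : Submodule ℂ (H →L[ℂ] K)) (P : Set (H →L[ℂ] H))
    (Q : Set (K →L[ℂ] K)) : Prop :=
  P = closedSpan {x | ∃ m ∈ M, ∃ q ∈ Q, ∃ n ∈ M, x = (ContinuousLinearMap.adjoint m) ∘L q ∘L n} ∧
  Q = closedSpan {y | ∃ m ∈ M, ∃ p ∈ P, ∃ n ∈ M, y = m ∘L p ∘L (ContinuousLinearMap.adjoint n)}

variable {H₂ : Type w₂} [NormedAddCommGroup H₂] [InnerProductSpace ℂ H₂]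
  [CompleteSpace H₁] [CompleteSpace H₂]

/-- The completely isometric homomorphisms `α : A → B(H)`, `β : B → B(K)` and the single TRO
`M ⊆ B(H, K)` implement the `Δ`-equivalences `A ∼ B` and `C ∼ D`. -/
structure ImplementsDeltaEquivalence
    {A : NonUnitalSubalgebra ℂ (H₁ →L[ℂ] H₁)} (C : NonUnitalStarSubalgebra ℂ (H₁ →L[ℂ] H₁))
    {B : NonUnitalSubalgebra ℂ (H₂ →L[ℂ] H₂)} (D : NonUnitalStarSubalgebra ℂ (H₂ →L[ℂ] H₂))
    (α : A →ₙₐ[ℂ] (H →L[ℂ] H)) (β : B →ₙₐ[ℂ] (K →L[ℂ] K))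
    (M : Submodule ℂ (H →L[ℂ] K)) : Prop where
  isometric_left : CompletelyIsometric α
  isometric_right : CompletelyIsometric β
  isTRO : IsTRO M
  algebras : TROEquivalentVia M (Set.range α) (Set.range β)
  diagonals : TROEquivalentVia M
    {x | ∃ c : A, (c : H₁ →L[ℂ] H₁) ∈ C ∧ α c = x} {y | ∃ d : B, (d : H₂ →L[ℂ] H₂) ∈ D ∧ β d = y}

end Algebras

/-! ### The category of essential left operator modules -/

section Modules

variable {H₁ : Type w₁} [NormedAddCommGroup H₁] [InnerProductSpace ℂ H₁]

/-- Essential left operator modules over `A`: operator spaces with a completely contractive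
module action (`‖a • x‖ ≤ ‖a‖ ‖x‖` for all matrices `a` over `A` and `x` over the module of
matching sizes, `a • x` being the matrix product) such that `A • U` has dense span. -/
structure OMod (A : NonUnitalSubalgebra ℂ (H₁ →L[ℂ] H₁)) where
  carrier : Type u
  [normedAddCommGroup : NormedAddCommGroup carrier]
  [normedSpace : NormedSpace ℂ carrier]
  [completeSpace : CompleteSpace carrier]
  [operatorSpace : OperatorSpace carrier]
  act : A →ₗ[ℂ] carrier →ₗ[ℂ] carrier
  act_mul : ∀ (a b : A) (x : carrier), act (a * b) x = act a (act b x)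
  mnorm_act_le : ∀ {ι κ μ : Type} [Fintype ι] [Fintype κ] [Fintype μ]
    (a : Matrix ι κ A) (x : Matrix κ μ carrier),
    mnorm (Matrix.of fun i j => ∑ k, act (a i k) (x k j)) ≤
      matNorm (a.map (fun a : A => (a : H₁ →L[ℂ] H₁))) * mnorm x
  essential : Dense (Submodule.span ℂ {y | ∃ (a : A) (x : carrier), y = act a x} : Set carrier)

attribute [instance] OMod.normedAddCommGroup OMod.normedSpace OMod.completeSpace
  OMod.operatorSpace

variable {A : NonUnitalSubalgebra ℂ (H₁ →L[ℂ] H₁)}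

/-- Morphisms of operator modules: completely bounded `A`-module maps. -/
@[ext] structure OMod.Hom (U V : OMod.{u} A) where
  toLin : U.carrier →ₗ[ℂ] V.carrier
  completelyBounded : IsCompletelyBounded toLin
  map_act : ∀ (a : A) (x : U.carrier), toLin (U.act a x) = V.act a (toLin x)

instance : Category (OMod.{u} A) where
  Hom U V := OMod.Hom U V
  id U := ⟨LinearMap.id, ⟨1, zero_le_one, fun x => by simp⟩, fun _ _ => rfl⟩
  comp {U V W} f g := ⟨g.toLin ∘ₗ f.toLin, by
    obtain ⟨c, hc, hf⟩ := f.completelyBounded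
    obtain ⟨d, hd, hg⟩ := g.completelyBounded
    refine ⟨d * c, mul_nonneg hd hc, fun x => ?_⟩
    have : x.map (g.toLin ∘ₗ f.toLin) = (x.map f.toLin).map g.toLin := rfl
    rw [this, mul_assoc]
    exact (hg _).trans (mul_le_mul_of_nonneg_left (hf x) hd),
    fun a x => by simp [f.map_act, g.map_act]⟩

/-- The underlying linear map of a morphism. -/
def OMod.lin {U V : OMod.{u} A} (f : U ⟶ V) : U.carrier →ₗ[ℂ] V.carrier := OMod.Hom.toLin f

/-! ### The category of Hilbert space representations -/

/-- Hilbert space representations of `A`: completely contractive homomorphisms `π : A → B(X)`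
that are nondegenerate. -/
structure HMod (A : NonUnitalSubalgebra ℂ (H₁ →L[ℂ] H₁)) where
  carrier : Type u
  [normedAddCommGroup : NormedAddCommGroup carrier]
  [innerProductSpace : InnerProductSpace ℂ carrier]
  [completeSpace : CompleteSpace carrier]
  rep : A →ₙₐ[ℂ] (carrier →L[ℂ] carrier)
  completelyContractive : CompletelyContractive rep
  nondegenerate :
    Dense (Submodule.span ℂ {y | ∃ (a : A) (x : carrier), y = rep a x} : Set carrier)

attribute [instance] HMod.normedAddCommGroup HMod.innerProductSpace HMod.completeSpace

/-- Morphisms of representations: bounded intertwining operators. -/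
@[ext] structure HMod.Hom (X Y : HMod.{u} A) where
  toCLM : X.carrier →L[ℂ] Y.carrier
  map_rep : ∀ (a : A) (x : X.carrier), toCLM (X.rep a x) = Y.rep a (toCLM x)

instance : Category (HMod.{u} A) where
  Hom X Y := HMod.Hom X Y
  id X := ⟨ContinuousLinearMap.id ℂ _, fun _ _ => rfl⟩
  comp f g := ⟨g.toCLM ∘L f.toCLM, fun a x => by simp [f.map_rep, g.map_rep]⟩

/-- A representation, viewed as an operator module with the column structure. -/
def HMod.column (X : HMod.{u} A) : OMod.{u} A :=
  letI := columnOperatorSpace X.carrier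
  { carrier := X.carrier
    act := LinearMap.mk₂ ℂ (fun a x => X.rep a x) (fun a b x => by simp) (fun c a x => by simp)
      (fun a x y => by simp) (fun c a x => by simp)
    act_mul := fun a b x => by
      simp
    mnorm_act_le := fun a x => by
      exact (columnNorm_mul_le (a.map X.rep) x).trans
        (mul_le_mul_of_nonneg_right (X.completelyContractive a) (matNorm_nonneg _))
    essential := X.nondegenerate }

variable (A) in
/-- The inclusion of the category of representations into that of operator modules. -/
def columnFunctor : HMod.{u} A ⥤ OMod.{u} A where
  obj X := X.column
  map {X Y} f :=
    { toLin := (f.toCLM : X.carrier →ₗ[ℂ] Y.carrier)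
      completelyBounded := ⟨‖f.toCLM‖, norm_nonneg _, fun x => columnNorm_map_le f.toCLM x⟩
      map_act := fun a x => f.map_rep a x }

end Modules

/-! ### The functor `U ↦ M ⊗ₑʰ U` -/

section TensorFunctor

variable {H₁ : Type w₁} [NormedAddCommGroup H₁] [InnerProductSpace ℂ H₁]
variable {H₂ : Type w₂} [NormedAddCommGroup H₂] [InnerProductSpace ℂ H₂]
variable {H : Type u} [NormedAddCommGroup H] [InnerProductSpace ℂ H] [CompleteSpace H]
variable {K : Type u} [NormedAddCommGroup K] [InnerProductSpace ℂ K] [CompleteSpace K]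
variable {A : NonUnitalSubalgebra ℂ (H₁ →L[ℂ] H₁)} {B : NonUnitalSubalgebra ℂ (H₂ →L[ℂ] H₂)}

/-- The C⋆-algebra `E`, the closed span of `M⋆ M`. -/
def rightAlgebra (M : Submodule ℂ (H →L[ℂ] K)) : Set (H →L[ℂ] H) :=
  closedSpan {x | ∃ m ∈ M, ∃ n ∈ M, x = (ContinuousLinearMap.adjoint m) ∘L n}

/-- The span of the relations `m e ⊗ y = m ⊗ e y` for `m ∈ M`, `e ∈ E` and `y` of the form `a x`
with `a ∈ A`, `x ∈ U`. Here `E` acts on `U` by `e (a x) = (e a) x`, where `e a` is the element `a'`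
of `A` with `α a' = e (α a)`; the elements `a x` span a dense subspace of `U`. -/
def balancedRelations (α : A →ₙₐ[ℂ] (H →L[ℂ] H)) (M : Submodule ℂ (H →L[ℂ] K)) (U : OMod.{u} A) :
    Submodule ℂ (M ⊗[ℂ] U.carrier) :=
  Submodule.span ℂ {t | ∃ (m m' : M) (e : H →L[ℂ] H) (a a' : A) (x : U.carrier),
    e ∈ rightAlgebra M ∧ (m' : H →L[ℂ] K) = (m : H →L[ℂ] K) ∘L e ∧ α a' = e ∘L α a ∧
    t = m' ⊗ₜ[ℂ] U.act a x - m ⊗ₜ[ℂ] U.act a' x}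

/-- The `E`-balanced Haagerup norm of a matrix over `M ⊗ U`: the infimum of `‖x‖ ‖y‖` over all
matrices `x` over `M` and `y` over `U` such that `u = x ⊙ y` modulo the balancing relations. -/
def haagerupNorm (α : A →ₙₐ[ℂ] (H →L[ℂ] H)) (M : Submodule ℂ (H →L[ℂ] K)) (U : OMod.{u} A)
    {ι κ : Type} [Fintype ι] [Fintype κ] (t : Matrix ι κ (M ⊗[ℂ] U.carrier)) : ℝ :=
  sInf {r | ∃ (p : ℕ) (x : Matrix ι (Fin p) M) (y : Matrix (Fin p) κ U.carrier),
    (∀ i j, t i j - ∑ k, x i k ⊗ₜ[ℂ] y k j ∈ balancedRelations α M U) ∧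
    r = matNorm (x.map (fun m : M => (m : H →L[ℂ] K))) * mnorm y}

/-- The operator space `W`, with the canonical map from the algebraic tensor product, is the
balanced Haagerup tensor product of `M` and `U` over `E`: the (separated) completion of `M ⊗ U`
in the `E`-balanced Haagerup matrix norms. -/
structure IsBalancedHaagerupTensor (α : A →ₙₐ[ℂ] (H →L[ℂ] H)) (M : Submodule ℂ (H →L[ℂ] K))
    (U : OMod.{u} A) (W : Type u) [NormedAddCommGroup W] [NormedSpace ℂ W] [CompleteSpace W]
    [OperatorSpace W] (τ : M ⊗[ℂ] U.carrier →ₗ[ℂ] W) : Prop where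
  denseRange : DenseRange τ
  mnorm_map : ∀ {ι κ : Type} [Fintype ι] [Fintype κ] (t : Matrix ι κ (M ⊗[ℂ] U.carrier)),
    mnorm (t.map τ) = haagerupNorm α M U t

/-- The functor `F(U) = M ⊗ₑʰ U` from operator modules over `A` to operator modules over `B`:
the module `F(U)` is the balanced Haagerup tensor product, with the action of `B` given by
`(m a n⋆) (l ⊗ x) = m ⊗ (a n⋆ l) x`, and `F(f)` is given by `F(f)(l ⊗ x) = l ⊗ f(x)`.
These requirements determine `F` up to natural completely isometric isomorphism. -/
structure TensorFunctor (α : A →ₙₐ[ℂ] (H →L[ℂ] H)) (β : B →ₙₐ[ℂ] (K →L[ℂ] K))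
    (M : Submodule ℂ (H →L[ℂ] K)) where
  functor : OMod.{u} A ⥤ OMod.{u} B
  tens : ∀ U : OMod.{u} A, M ⊗[ℂ] U.carrier →ₗ[ℂ] (functor.obj U).carrier
  isTensor : ∀ U : OMod.{u} A,
    IsBalancedHaagerupTensor α M U (functor.obj U).carrier (tens U)
  act_tens : ∀ (U : OMod.{u} A) (b : B) (m n l : M) (a a' : A) (x : U.carrier),
    β b = (m : H →L[ℂ] K) ∘L α a ∘L ContinuousLinearMap.adjoint (n : H →L[ℂ] K) →
    α a' = α a ∘L ContinuousLinearMap.adjoint (n : H →L[ℂ] K) ∘L (l : H →L[ℂ] K) →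
    (functor.obj U).act b (tens U (l ⊗ₜ[ℂ] x)) = tens U (m ⊗ₜ[ℂ] U.act a' x)
  map_tens : ∀ {U V : OMod.{u} A} (f : U ⟶ V) (l : M) (x : U.carrier),
    OMod.lin (functor.map f) (tens U (l ⊗ₜ[ℂ] x)) = tens V (l ⊗ₜ[ℂ] OMod.lin f x)

end TensorFunctor

end DeltaMorita

end

/-!
The functor `F` is tensoring with the equivalence bimodule `M`, so the theorem is a form of Morita
equivalence. Algebraically the inverse functor is tensoring with `M⋆`, because `M⋆ M` acts as the
identity on essential `A`-modules and `M M⋆` acts as the identity on essential `B`-modules. What has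
to be supplied is the analysis: `M⋆ M` and `M M⋆` have only approximate units, and the tensor
product is a completion in the Haagerup norms.

A ternary ring of operators has an approximate unit of the form `∑ mᵢ mᵢ⋆`, where `(m₁, …, mₙ)` is
a contractive row over `M` (`IsTRO.exists_filter`, by polynomial functional calculus). Applied to
the C⋆-algebra of a `Δ`-pair it shows that operators `T` with `T α(A) ⊆ α(A)`, such as the `m⋆ n`,
act completely contractively on every essential operator module (`mnorm_multAct_le`). Hence the
tensor product `M ⊗ U` carries not only creation operators `L(m) u = m ⊗ u` but also annihilation
operators `V(n) (l ⊗ u) = (n⋆ l) u`, and `P = ∑ L(mᵢ) V(mᵢ)` is a net of complete contractions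
converging strongly to the identity and factoring through columns over `U` (`ModuleFrame`,
`ModuleFrame.tendsto_proj`). Every norm estimate on the tensor product is obtained along this net.
For instance `B` acts by `m a n⋆ ↦ L(m) a V(n)`, as the limit of `P b P`, whose matrix coefficients
`mᵢ⋆ b mⱼ` lie in `A` (`ModuleFrame.exists_isAction`); completely bounded module maps are treated in
the same way (`ModuleFrame.exists_map`), which gives the existence of the functor
(`DeltaContext.tensorFunctor`).

When `U` is a column Hilbert space `X`, the norm of `w` in the tensor product is the limit of the
Hilbert space norms `(∑ ‖V(mᵢ) w‖²)^(1/2)`. So it satisfies the parallelogram law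
(`ModuleFrame.parallelogram`), and the matrix norms are those of a column Hilbert space
(`ModuleFrame.mnorm_eq_column`). Multipliers act by a `⋆`-representation (`adjoint_hilbertMult`),
hence `V(m) = L(m)⋆` (`ModuleFrame.adjoint_hilbertL`), and `L` is a representation of `M` by
operators from `X` to a representation `Y` of `B` (`TRORep`). This last notion no longer mentions
tensor products and is symmetric: passing to adjoints exchanges the roles of `A` and `B`
(`TRORep.flip`). Intertwiners on one side determine intertwiners on the other
(`TRORep.exists_map`), and the symmetry turns this into fullness and faithfulness; starting from
a representation of `B` and tensoring with `M⋆` gives essential surjectivity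
(`DeltaContext.exists_troRep`). Finally the norm of a matrix over `B` is the limit of the norms of
its compressions by contractive rows, which are matrices over `A`, so complete isometry passes from
`X` to `Y` (`TRORep.completelyIsometric`).
-/

noncomputable section

namespace DeltaMorita

/-! ### Matrix seminorms -/

section ScalarMatrices

open scoped Matrix.Norms.L2Operator

variable {ι κ : Type} [Fintype ι] [Fintype κ]

theorem l2_opNorm_le_of_sum_sq [DecidableEq κ] (S : Matrix ι κ ℂ) {c : ℝ} (hc : 0 ≤ c)
    (h : ∀ v : κ → ℂ, ∑ i, ‖∑ j, S i j * v j‖ ^ 2 ≤ c ^ 2 * ∑ j, ‖v j‖ ^ 2) : ‖S‖ ≤ c := by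
  rw [Matrix.l2_opNorm_def]
  refine ContinuousLinearMap.opNorm_le_bound _ hc fun x => ?_
  refine le_of_sq_le_sq ?_ (by positivity)
  rw [mul_pow, EuclideanSpace.norm_sq_eq, EuclideanSpace.norm_sq_eq]
  simpa [Matrix.mulVec, dotProduct] using h x

theorem l2_opNorm_one_le [DecidableEq κ] : ‖(1 : Matrix κ κ ℂ)‖ ≤ 1 :=
  l2_opNorm_le_of_sum_sq _ zero_le_one fun v => by simp [Matrix.one_apply]

theorem l2_opNorm_smul_one_le [DecidableEq κ] (c : ℂ) : ‖c • (1 : Matrix κ κ ℂ)‖ ≤ ‖c‖ :=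
  (norm_smul_le _ _).trans (mul_le_of_le_one_right (norm_nonneg _) l2_opNorm_one_le)

/-- Selecting coordinates along an injective map is a contraction. -/
theorem l2_opNorm_select_le [DecidableEq κ] {f : ι → κ} (hf : Function.Injective f) :
    ‖(Matrix.of fun i k => if f i = k then (1 : ℂ) else 0)‖ ≤ 1 := by
  refine l2_opNorm_le_of_sum_sq _ zero_le_one fun v => ?_
  simp only [Matrix.of_apply, ite_mul, one_mul, zero_mul, Finset.sum_ite_eq, Finset.mem_univ,
    if_true, one_pow]
  classical
  rw [← Finset.sum_image (f := fun k => ‖v k‖ ^ 2) (g := f) (s := Finset.univ)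
    (fun a _ b _ h => hf h)]
  exact Finset.sum_le_sum_of_subset_of_nonneg (Finset.subset_univ _) fun _ _ _ => by positivity

theorem l2_opNorm_select_transpose_le [DecidableEq κ] [DecidableEq ι] {f : ι → κ}
    (hf : Function.Injective f) :
    ‖(Matrix.of fun k i => if f i = k then (1 : ℂ) else 0)‖ ≤ 1 := by
  have := Matrix.l2_opNorm_conjTranspose (Matrix.of fun i k => if f i = k then (1 : ℂ) else 0)
  have h2 : (Matrix.of fun i k => if f i = k then (1 : ℂ) else 0).conjTranspose
      = Matrix.of fun k i => if f i = k then (1 : ℂ) else 0 := by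
    ext k i
    simp only [Matrix.conjTranspose_apply, Matrix.of_apply]
    split_ifs <;> simp
  rw [← h2, this]
  exact l2_opNorm_select_le hf

end ScalarMatrices

open scoped Matrix.Norms.L2Operator in
/-- A family of functions on the matrix spaces over a complex vector space which satisfies Ruan's
axioms, without the requirement that it is definite; these are operator space structures before
separation and completion. -/
structure MatrixSeminorm (V : Type u) [AddCommGroup V] [Module ℂ V] where
  toFun : ∀ {ι κ : Type} [Fintype ι] [Fintype κ], Matrix ι κ V → ℝ
  add_le : ∀ {ι κ : Type} [Fintype ι] [Fintype κ] (x y : Matrix ι κ V),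
    toFun (x + y) ≤ toFun x + toFun y
  mul_le : ∀ {ι ι' κ κ' : Type} [Fintype ι] [Fintype ι'] [Fintype κ] [Fintype κ']
    [DecidableEq ι] [DecidableEq κ'] (S : Matrix ι' ι ℂ) (x : Matrix ι κ V) (T : Matrix κ κ' ℂ),
    toFun (Matrix.of fun i j => ∑ k, ∑ l, (S i k * T l j) • x k l) ≤ ‖S‖ * toFun x * ‖T‖
  fromBlocks_le : ∀ {ι ι' κ κ' : Type} [Fintype ι] [Fintype ι'] [Fintype κ] [Fintype κ']
    (x : Matrix ι κ V) (y : Matrix ι' κ' V),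
    toFun (Matrix.fromBlocks x 0 0 y) ≤ max (toFun x) (toFun y)

namespace MatrixSeminorm

variable {V : Type u} [AddCommGroup V] [Module ℂ V] (N : MatrixSeminorm V)
variable {ι κ ι' κ' : Type} [Fintype ι] [Fintype κ] [Fintype ι'] [Fintype κ']

open scoped Matrix.Norms.L2Operator

theorem zero : N.toFun (0 : Matrix ι κ V) = 0 := by
  classical
  apply le_antisymm
  · have h := N.mul_le (0 : Matrix ι ι ℂ) (0 : Matrix ι κ V) (0 : Matrix κ κ ℂ)
    have e : (Matrix.of fun i j => ∑ k, ∑ l, ((0 : Matrix ι ι ℂ) i k * (0 : Matrix κ κ ℂ) l j) •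
        (0 : Matrix ι κ V) k l) = 0 := by ext; simp
    rw [e] at h
    simpa using h
  · have h := N.add_le (0 : Matrix ι κ V) 0
    rw [add_zero] at h
    linarith

/-- Nonnegativity is not an axiom: a negative value at `x` would give a negative value at
`x + (-x) = 0`. -/
theorem nonneg (x : Matrix ι κ V) : 0 ≤ N.toFun x := by
  classical
  by_contra hx
  push Not at hx
  have h := N.mul_le (-1 : Matrix ι ι ℂ) x (1 : Matrix κ κ ℂ)
  have e : (Matrix.of fun i j => ∑ k, ∑ l, ((-1 : Matrix ι ι ℂ) i k *
      (1 : Matrix κ κ ℂ) l j) • x k l) = -x := by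
    ext i j; simp [Matrix.one_apply]
  have h0 := N.add_le x (-x)
  have h1 : ‖(-1 : Matrix ι ι ℂ)‖ * N.toFun x * ‖(1 : Matrix κ κ ℂ)‖ ≤ 0 :=
    mul_nonpos_of_nonpos_of_nonneg
      (mul_nonpos_of_nonneg_of_nonpos (norm_nonneg _) hx.le) (norm_nonneg _)
  rw [add_neg_cancel, N.zero] at h0
  rw [e] at h
  linarith

theorem mulLeft_le [DecidableEq ι] (S : Matrix ι' ι ℂ) (x : Matrix ι κ V) :
    N.toFun (Matrix.of fun i j => ∑ k, S i k • x k j) ≤ ‖S‖ * N.toFun x := by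
  classical
  have h := N.mul_le S x (1 : Matrix κ κ ℂ)
  have e : (Matrix.of fun i j => ∑ k, ∑ l, (S i k * (1 : Matrix κ κ ℂ) l j) • x k l)
      = Matrix.of fun i j => ∑ k, S i k • x k j := by
    ext i j; simp [Matrix.one_apply]
  rw [e] at h
  exact h.trans (mul_le_of_le_one_right (mul_nonneg (norm_nonneg _) (N.nonneg _))
    l2_opNorm_one_le)

theorem mulRight_le [DecidableEq κ'] (x : Matrix ι κ V) (T : Matrix κ κ' ℂ) :
    N.toFun (Matrix.of fun i j => ∑ l, T l j • x i l) ≤ N.toFun x * ‖T‖ := by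
  classical
  have h := N.mul_le (1 : Matrix ι ι ℂ) x T
  have e : (Matrix.of fun i j => ∑ k, ∑ l, ((1 : Matrix ι ι ℂ) i k * T l j) • x k l)
      = Matrix.of fun i j => ∑ l, T l j • x i l := by
    ext i j; simp [Matrix.one_apply]
  rw [e] at h
  refine h.trans (mul_le_mul_of_nonneg_right ?_ (norm_nonneg _))
  exact mul_le_of_le_one_left (N.nonneg _) l2_opNorm_one_le

theorem smul_le (c : ℂ) (x : Matrix ι κ V) : N.toFun (c • x) ≤ ‖c‖ * N.toFun x := by
  classical
  have h := N.mulLeft_le (c • (1 : Matrix ι ι ℂ)) x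
  have e : (Matrix.of fun i j => ∑ k, (c • (1 : Matrix ι ι ℂ)) i k • x k j) = c • x := by
    ext i j; simp [Matrix.one_apply]
  rw [e] at h
  exact h.trans (mul_le_mul_of_nonneg_right (l2_opNorm_smul_one_le c) (N.nonneg _))

theorem neg_eq (x : Matrix ι κ V) : N.toFun (-x) = N.toFun x := by
  have h1 := N.smul_le (-1) x
  have h2 := N.smul_le (-1) (-x)
  simp only [norm_neg, norm_one, one_mul, neg_smul, one_smul, neg_neg] at h1 h2
  exact le_antisymm h1 h2

theorem sum_le {σ : Type*} (s : Finset σ) (x : σ → Matrix ι κ V) :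
    N.toFun (∑ i ∈ s, x i) ≤ ∑ i ∈ s, N.toFun (x i) := by
  classical
  induction s using Finset.induction_on with
  | empty => simp [N.zero]
  | insert a s ha ih =>
    rw [Finset.sum_insert ha, Finset.sum_insert ha]
    exact (N.add_le _ _).trans (by gcongr)

theorem submatrix_le (x : Matrix ι κ V) {f : ι' → ι} {g : κ' → κ} (hf : Function.Injective f)
    (hg : Function.Injective g) : N.toFun (x.submatrix f g) ≤ N.toFun x := by
  classical
  have h := N.mul_le (Matrix.of fun i k => if f i = k then (1 : ℂ) else 0) x
    (Matrix.of fun k i => if g i = k then (1 : ℂ) else 0)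
  have e : (Matrix.of fun i j => ∑ k, ∑ l,
      ((Matrix.of fun i k => if f i = k then (1 : ℂ) else 0) i k *
      (Matrix.of fun k i => if g i = k then (1 : ℂ) else 0) l j) • x k l) = x.submatrix f g := by
    ext i j; simp
  rw [e] at h
  refine h.trans ?_
  calc _ ≤ 1 * N.toFun x * 1 := by
        gcongr
        · exact mul_nonneg zero_le_one (N.nonneg _)
        · exact N.nonneg _
        · exact l2_opNorm_select_le hf
        · exact l2_opNorm_select_transpose_le hg
    _ = _ := by ring

/-- The seminorm of a vector, viewed as a `1 × 1` matrix. -/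
def vec (v : V) : ℝ := N.toFun (Matrix.of fun _ _ : Unit => v)

theorem entry_le (x : Matrix ι κ V) (i : ι) (j : κ) : N.vec (x i j) ≤ N.toFun x :=
  N.submatrix_le x (f := fun _ : Unit => i) (g := fun _ : Unit => j)
    (Function.injective_of_subsingleton _) (Function.injective_of_subsingleton _)

theorem single_le [DecidableEq ι] [DecidableEq κ] (i : ι) (j : κ) (v : V) :
    N.toFun (Matrix.single i j v) ≤ N.vec v := by
  have h := N.mul_le (Matrix.of fun (a : ι) (_ : Unit) => if i = a then (1 : ℂ) else 0)
    (Matrix.of fun _ _ : Unit => v)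
    (Matrix.of fun (_ : Unit) (b : κ) => if j = b then (1 : ℂ) else 0)
  have e : (Matrix.of fun a b => ∑ k : Unit, ∑ l : Unit,
      ((Matrix.of fun (a : ι) (_ : Unit) => if i = a then (1 : ℂ) else 0) a k *
      (Matrix.of fun (_ : Unit) (b : κ) => if j = b then (1 : ℂ) else 0) l b) •
      (Matrix.of fun _ _ : Unit => v) k l) = Matrix.single i j v := by
    ext a b
    by_cases h1 : i = a <;> by_cases h2 : j = b <;> simp [Matrix.single, h1, h2]
  rw [e] at h
  refine h.trans ?_
  have b1 := l2_opNorm_select_transpose_le (f := fun _ : Unit => i)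
    (Function.injective_of_subsingleton _)
  have b2 := l2_opNorm_select_le (f := fun _ : Unit => j) (Function.injective_of_subsingleton _)
  calc _ ≤ 1 * N.vec v * 1 :=
        mul_le_mul (mul_le_mul_of_nonneg_right b1 (N.nonneg _)) b2 (norm_nonneg _)
          (mul_nonneg zero_le_one (N.nonneg _))
    _ = _ := by ring

theorem le_sum_entries (x : Matrix ι κ V) : N.toFun x ≤ ∑ i, ∑ j, N.vec (x i j) := by
  classical
  conv_lhs => rw [Matrix.matrix_eq_sum_single x]
  refine (N.sum_le _ _).trans (Finset.sum_le_sum fun i _ => ?_)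
  exact (N.sum_le _ _).trans (Finset.sum_le_sum fun j _ => N.single_le i j _)

theorem vec_add_le (v v' : V) : N.vec (v + v') ≤ N.vec v + N.vec v' :=
  N.add_le (Matrix.of fun _ _ : Unit => v) (Matrix.of fun _ _ : Unit => v')

theorem vec_smul_le (c : ℂ) (v : V) : N.vec (c • v) ≤ ‖c‖ * N.vec v :=
  N.smul_le c (Matrix.of fun _ _ : Unit => v)

theorem vec_zero : N.vec (0 : V) = 0 := N.zero

theorem vec_neg (v : V) : N.vec (-v) = N.vec v := N.neg_eq (Matrix.of fun _ _ : Unit => v)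

/-- The Pythagorean bound for a column of two matrices: the column is the product of the diagonal
matrix with blocks `x / √c` and `y / √d` and a scalar column of norm `√(c + d)`. -/
theorem fromRows_le (x : Matrix ι κ V) (y : Matrix ι' κ V) {c d : ℝ} (hc : 0 < c) (hd : 0 < d)
    (hx : N.toFun x ≤ √c) (hy : N.toFun y ≤ √d) :
    N.toFun (Matrix.fromRows x y) ≤ √(c + d) := by
  classical
  have sc := Real.sqrt_pos.2 hc
  have sd := Real.sqrt_pos.2 hd
  have nx : N.toFun (((√c : ℂ)⁻¹) • x) ≤ 1 := by
    refine (N.smul_le _ _).trans ?_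
    rw [norm_inv, Complex.norm_real, Real.norm_of_nonneg sc.le, inv_mul_le_iff₀ sc]
    simpa using hx
  have ny : N.toFun (((√d : ℂ)⁻¹) • y) ≤ 1 := by
    refine (N.smul_le _ _).trans ?_
    rw [norm_inv, Complex.norm_real, Real.norm_of_nonneg sd.le, inv_mul_le_iff₀ sd]
    simpa using hy
  let T : Matrix (κ ⊕ κ) κ ℂ :=
    Matrix.fromRows ((√c : ℂ) • (1 : Matrix κ κ ℂ)) ((√d : ℂ) • (1 : Matrix κ κ ℂ))
  have hT : ‖T‖ ≤ √(c + d) := by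
    refine l2_opNorm_le_of_sum_sq _ (Real.sqrt_nonneg _) fun v => ?_
    rw [Fintype.sum_sum_type, Real.sq_sqrt (by positivity), add_mul, Finset.mul_sum,
      Finset.mul_sum]
    refine le_of_eq ?_
    congr 1 <;> refine Finset.sum_congr rfl fun k _ => ?_
    · simp [T, Matrix.one_apply, mul_pow, Real.sq_sqrt hc.le]
    · simp [T, Matrix.one_apply, mul_pow, Real.sq_sqrt hd.le]
  have h := N.mulRight_le (Matrix.fromBlocks (((√c : ℂ)⁻¹) • x) 0 0 (((√d : ℂ)⁻¹) • y)) T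
  have e : (Matrix.of fun i j => ∑ l, T l j •
      Matrix.fromBlocks (((√c : ℂ)⁻¹) • x) 0 0 (((√d : ℂ)⁻¹) • y) i l) = Matrix.fromRows x y := by
    have c0 : (√c : ℂ) ≠ 0 := by exact_mod_cast sc.ne'
    have d0 : (√d : ℂ) ≠ 0 := by exact_mod_cast sd.ne'
    ext i j
    cases i
    · simp [T, Matrix.one_apply, Fintype.sum_sum_type]
      rw [← Complex.coe_smul, smul_smul, mul_inv_cancel₀ c0, one_smul]
    · simp [T, Matrix.one_apply, Fintype.sum_sum_type]
      rw [← Complex.coe_smul, smul_smul, mul_inv_cancel₀ d0, one_smul]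
  rw [e] at h
  refine h.trans ?_
  calc _ ≤ 1 * ‖T‖ := by
        gcongr
        exact (N.fromBlocks_le _ _).trans (max_le nx ny)
    _ ≤ _ := by rw [one_mul]; exact hT

end MatrixSeminorm

/-- The matrix norms of an operator space. -/
def OperatorSpace.matrixSeminorm (V : Type u) [NormedAddCommGroup V] [NormedSpace ℂ V]
    [OperatorSpace V] : MatrixSeminorm V where
  toFun := OperatorSpace.mnorm
  add_le := OperatorSpace.mnorm_add_le
  mul_le := OperatorSpace.mnorm_mul_le
  fromBlocks_le := OperatorSpace.mnorm_fromBlocks_le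

open OperatorSpace

section OperatorSpaces

variable {V W : Type u} [NormedAddCommGroup V] [NormedSpace ℂ V] [OperatorSpace V]
  [NormedAddCommGroup W] [NormedSpace ℂ W] [OperatorSpace W]
variable {ι κ : Type} [Fintype ι] [Fintype κ]

theorem matrixSeminorm_vec (v : V) : (matrixSeminorm V).vec v = ‖v‖ := mnorm_unit v

theorem mnorm_nonneg (x : Matrix ι κ V) : 0 ≤ mnorm x := (matrixSeminorm V).nonneg x

theorem mnorm_le_sum_norm (x : Matrix ι κ V) : mnorm x ≤ ∑ i, ∑ j, ‖x i j‖ := by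
  simp only [← matrixSeminorm_vec]
  exact (matrixSeminorm V).le_sum_entries x

theorem norm_entry_le (x : Matrix ι κ V) (i : ι) (j : κ) : ‖x i j‖ ≤ mnorm x := by
  rw [← matrixSeminorm_vec]
  exact (matrixSeminorm V).entry_le x i j

theorem abs_mnorm_sub_le (x y : Matrix ι κ V) : |mnorm x - mnorm y| ≤ mnorm (x - y) := by
  have h1 := mnorm_add_le (x - y) y
  have h2 := mnorm_add_le (y - x) x
  have h3 := (matrixSeminorm V).neg_eq (x - y)
  rw [neg_sub] at h3
  change mnorm (y - x) = mnorm (x - y) at h3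
  rw [sub_add_cancel] at h1 h2
  rw [abs_le]
  constructor <;> linarith

theorem continuous_mnorm : Continuous (fun x : Matrix ι κ V => mnorm x) := by
  rw [continuous_iff_continuousAt]
  intro x
  rw [ContinuousAt, tendsto_iff_dist_tendsto_zero]
  have h : Filter.Tendsto (fun y : Matrix ι κ V => ∑ i, ∑ j, ‖y i j - x i j‖) (nhds x)
      (nhds 0) := by
    have hc : Continuous (fun y : Matrix ι κ V => ∑ i, ∑ j, ‖y i j - x i j‖) := by
      refine continuous_finsetSum _ fun i _ => continuous_finsetSum _ fun j _ => ?_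
      exact ((continuous_apply_apply i j).sub continuous_const).norm
    simpa using hc.tendsto x
  refine squeeze_zero (fun _ => dist_nonneg) (fun y => ?_) h
  exact (abs_mnorm_sub_le y x).trans (mnorm_le_sum_norm (y - x))

theorem continuous_mnorm_comp {T : Type*} [TopologicalSpace T] {f : T → Matrix ι κ V}
    (hf : ∀ i j, Continuous fun t => f t i j) : Continuous fun t => mnorm (f t) :=
  continuous_mnorm.comp (continuous_pi fun i => continuous_pi fun j => hf i j)

theorem tendsto_mnorm {T : Type*} {l : Filter T} {f : T → Matrix ι κ V} {x : Matrix ι κ V}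
    (hf : ∀ i j, Filter.Tendsto (fun t => f t i j) l (nhds (x i j))) :
    Filter.Tendsto (fun t => mnorm (f t)) l (nhds (mnorm x)) :=
  (continuous_mnorm.tendsto x).comp
    (tendsto_pi_nhds.2 fun i => tendsto_pi_nhds.2 fun j => hf i j)

/-- Matrices over a dense subset are dense. -/
theorem denseRange_matrix_map {X Y : Type*} [TopologicalSpace Y] {f : X → Y}
    (hf : DenseRange f) : DenseRange (fun x : Matrix ι κ X => x.map f) := by
  have h1 : DenseRange (Pi.map (fun _ : κ => f)) := DenseRange.piMap fun _ => hf
  exact DenseRange.piMap fun _ : ι => h1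

end OperatorSpaces

end DeltaMorita

namespace DeltaMorita

/-! ### Completion of a matrix seminorm -/

namespace MatrixSeminorm

open scoped Matrix.Norms.L2Operator

variable {V : Type u} [AddCommGroup V] [Module ℂ V] (N : MatrixSeminorm V)
variable {W : Type v} [NormedAddCommGroup W] [NormedSpace ℂ W] (τ : V →ₗ[ℂ] W)
variable {ι κ ι' κ' : Type} [Fintype ι] [Fintype κ] [Fintype ι'] [Fintype κ']

/-- The candidates whose infimum is the extension of `N` to the completion: `N v` plus the
entrywise distance from `v` to the given matrix. -/
def extendSet (x : Matrix ι κ W) : Set ℝ :=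
  Set.range fun v : Matrix ι κ V => N.toFun v + ∑ i, ∑ j, ‖x i j - τ (v i j)‖

/-- The extension of the matrix seminorm `N` along a map `τ : V → W` which is isometric on
vectors, as the largest extension that is Lipschitz for the entrywise distance. -/
def extend (x : Matrix ι κ W) : ℝ := sInf (N.extendSet τ x)

theorem extend_le (x : Matrix ι κ W) (v : Matrix ι κ V) :
    N.extend τ x ≤ N.toFun v + ∑ i, ∑ j, ‖x i j - τ (v i j)‖ := by
  refine csInf_le ⟨0, ?_⟩ ⟨v, rfl⟩
  rintro _ ⟨v, rfl⟩
  have := N.nonneg v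
  positivity

theorem le_extend (x : Matrix ι κ W) {c : ℝ}
    (h : ∀ v : Matrix ι κ V, c ≤ N.toFun v + ∑ i, ∑ j, ‖x i j - τ (v i j)‖) :
    c ≤ N.extend τ x := by
  refine le_csInf (Set.range_nonempty _) ?_
  rintro _ ⟨v, rfl⟩
  exact h v

/-- On the image of `V` the infimum is attained at the given matrix, since `N` is dominated by the
sum of the norms of the entries. -/
theorem extend_map (hτ : ∀ v, ‖τ v‖ = N.vec v) (v : Matrix ι κ V) :
    N.extend τ (v.map τ) = N.toFun v := by
  apply le_antisymm
  · simpa using N.extend_le τ (v.map τ) v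
  · refine N.le_extend τ _ fun v' => ?_
    have h1 := N.add_le v' (v - v')
    have h2 := N.le_sum_entries (v - v')
    rw [add_sub_cancel] at h1
    refine h1.trans ?_
    gcongr
    refine h2.trans (le_of_eq ?_)
    simp [← hτ]

theorem extend_le_extend_add (x y : Matrix ι κ W) :
    N.extend τ x ≤ N.extend τ y + ∑ i, ∑ j, ‖x i j - y i j‖ := by
  rw [← sub_le_iff_le_add]
  refine N.le_extend τ _ fun v => ?_
  rw [sub_le_iff_le_add]
  refine (N.extend_le τ x v).trans ?_
  rw [add_assoc, ← Finset.sum_add_distrib]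
  gcongr with i
  rw [← Finset.sum_add_distrib]
  gcongr with j
  rw [add_comm]
  exact norm_sub_le_norm_sub_add_norm_sub _ _ _

theorem continuous_extend : Continuous (fun x : Matrix ι κ W => N.extend τ x) := by
  rw [continuous_iff_continuousAt]
  intro x
  rw [ContinuousAt, tendsto_iff_dist_tendsto_zero]
  have h : Filter.Tendsto (fun y : Matrix ι κ W => ∑ i, ∑ j, ‖y i j - x i j‖) (nhds x)
      (nhds 0) := by
    have hc : Continuous (fun y : Matrix ι κ W => ∑ i, ∑ j, ‖y i j - x i j‖) := by
      refine continuous_finsetSum _ fun i _ => continuous_finsetSum _ fun j _ => ?_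
      exact ((continuous_apply_apply i j).sub continuous_const).norm
    simpa using hc.tendsto x
  refine squeeze_zero (fun _ => dist_nonneg) (fun y => ?_) h
  rw [Real.dist_eq, abs_le]
  have h1 := N.extend_le_extend_add τ x y
  have h2 := N.extend_le_extend_add τ y x
  simp only [norm_sub_rev (x _ _)] at h1
  constructor <;> linarith

theorem continuous_extend_comp {T : Type*} [TopologicalSpace T] {f : T → Matrix ι κ W}
    (hf : ∀ i j, Continuous fun t => f t i j) : Continuous fun t => N.extend τ (f t) :=
  (N.continuous_extend τ).comp (continuous_pi fun i => continuous_pi fun j => hf i j)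

/-- The operator space structure on a space in which `V` is dense. -/
abbrev extendOperatorSpace (hτ : ∀ v, ‖τ v‖ = N.vec v) (hd : DenseRange τ) : OperatorSpace W where
  mnorm x := N.extend τ x
  mnorm_unit x := by
    refine hd.induction_on (p := fun x => N.extend τ (Matrix.of fun _ _ : Unit => x) = ‖x‖) x
      (isClosed_eq (N.continuous_extend_comp τ fun i j => continuous_id) continuous_norm) ?_
    intro v
    rw [hτ]
    exact N.extend_map τ hτ (Matrix.of fun _ _ : Unit => v)
  mnorm_add_le x y := by
    refine (denseRange_matrix_map hd).induction_on₂
      (p := fun x y => N.extend τ (x + y) ≤ N.extend τ x + N.extend τ y) ?_ ?_ x y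
    · exact isClosed_le ((N.continuous_extend τ).comp (continuous_fst.add continuous_snd))
        (((N.continuous_extend τ).comp continuous_fst).add
          ((N.continuous_extend τ).comp continuous_snd))
    · intro a b
      have : a.map τ + b.map τ = (a + b).map τ := by ext; simp
      rw [this, N.extend_map τ hτ, N.extend_map τ hτ, N.extend_map τ hτ]
      exact N.add_le a b
  mnorm_mul_le S x T := by
    refine (denseRange_matrix_map hd).induction_on
      (p := fun x => N.extend τ (Matrix.of fun i j => ∑ k, ∑ l, (S i k * T l j) • x k l) ≤
        ‖S‖ * N.extend τ x * ‖T‖) x ?_ ?_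
    · refine isClosed_le (N.continuous_extend_comp τ fun i j => ?_)
        ((continuous_const.mul (N.continuous_extend τ)).mul continuous_const)
      exact continuous_finsetSum _ fun k _ => continuous_finsetSum _ fun l _ =>
        (continuous_apply_apply k l).const_smul _
    · intro a
      have : (Matrix.of fun i j => ∑ k, ∑ l, (S i k * T l j) • a.map τ k l)
          = (Matrix.of fun i j => ∑ k, ∑ l, (S i k * T l j) • a k l).map τ := by
        ext; simp
      rw [this, N.extend_map τ hτ, N.extend_map τ hτ]
      exact N.mul_le S a T
  mnorm_fromBlocks_le {ι ι' κ κ'} _ _ _ _ x y := by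
    have key : ∀ (x : Matrix ι κ W) (y : Matrix ι' κ' W),
        N.extend τ (Matrix.fromBlocks x 0 0 y) ≤ max (N.extend τ x) (N.extend τ y) := by
      intro x
      refine fun y => (denseRange_matrix_map hd).induction_on y ?_ ?_
      · refine isClosed_le (N.continuous_extend_comp τ fun i j => ?_)
          (continuous_const.max (N.continuous_extend τ))
        rcases i with i | i <;> rcases j with j | j
        · exact continuous_const
        · exact continuous_const
        · exact continuous_const
        · exact continuous_apply_apply i j
      · intro b
        refine (denseRange_matrix_map hd).induction_on x ?_ ?_
        · refine isClosed_le (N.continuous_extend_comp τ fun i j => ?_)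
            ((N.continuous_extend τ).max continuous_const)
          rcases i with i | i <;> rcases j with j | j
          · exact continuous_apply_apply i j
          · exact continuous_const
          · exact continuous_const
          · exact continuous_const
        · intro a
          have : Matrix.fromBlocks (a.map τ) 0 0 (b.map τ) = (Matrix.fromBlocks a 0 0 b).map τ := by
            rw [Matrix.fromBlocks_map]
            congr 1 <;> ext <;> simp
          rw [this, N.extend_map τ hτ, N.extend_map τ hτ, N.extend_map τ hτ]
          exact N.fromBlocks_le a b
    exact key x y

/-- The separated completion of a matrix seminorm is an operator space. -/
theorem exists_completion :
    ∃ (W : Type u) (_ : NormedAddCommGroup W) (_ : NormedSpace ℂ W) (_ : CompleteSpace W)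
      (_ : OperatorSpace W) (τ : V →ₗ[ℂ] W), DenseRange τ ∧
      ∀ {ι κ : Type} [Fintype ι] [Fintype κ] (x : Matrix ι κ V),
        OperatorSpace.mnorm (x.map τ) = N.toFun x := by
  let p : AddGroupSeminorm V :=
    { toFun := N.vec
      map_zero' := N.vec_zero
      add_le' := N.vec_add_le
      neg' := N.vec_neg }
  let _ : SeminormedAddCommGroup V := p.toSeminormedAddCommGroup
  let _ : NormedSpace ℂ V := { norm_smul_le := fun c v => N.vec_smul_le c v }
  let τ : V →ₗ[ℂ] UniformSpace.Completion V :=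
    (UniformSpace.Completion.toComplₗᵢ (𝕜 := ℂ) (E := V)).toLinearMap
  have hτ : ∀ v, ‖τ v‖ = N.vec v := fun v => UniformSpace.Completion.norm_coe v
  have hd : DenseRange τ := UniformSpace.Completion.denseRange_coe
  refine ⟨UniformSpace.Completion V, inferInstance, inferInstance, inferInstance,
    N.extendOperatorSpace τ hτ hd, τ, hd, fun x => N.extend_map τ hτ x⟩

end MatrixSeminorm

end DeltaMorita

namespace DeltaMorita

/-! ### The balanced Haagerup norm satisfies Ruan's axioms -/

open OperatorSpace

section MatNorm

variable {ι κ ι' κ' : Type} [Fintype ι] [Fintype κ] [Fintype ι'] [Fintype κ']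
variable {X : Type u} [NormedAddCommGroup X] [InnerProductSpace ℂ X]
variable {Y : Type v} [NormedAddCommGroup Y] [InnerProductSpace ℂ Y]

theorem matNorm_submatrix_equiv_le (T : Matrix ι κ (X →L[ℂ] Y)) (e : κ' ≃ κ) :
    matNorm (T.submatrix id e) ≤ matNorm T := by
  refine matNorm_le (matNorm_nonneg _) fun z => ?_
  have h := sum_norm_sq_le T (z ∘ e.symm)
  refine le_of_eq_of_le (Finset.sum_congr rfl fun i _ => ?_) (h.trans (le_of_eq ?_))
  · congr 2
    exact Fintype.sum_equiv e _ _ fun j => by simp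
  · congr 1
    exact (Fintype.sum_equiv e _ _ fun j => by simp).symm

theorem sum_norm_sq_add_le {u v : ι → Y} {a b s t : ℝ} (ha : 0 ≤ a) (hb : 0 ≤ b)
    (hs : 0 ≤ s) (ht : 0 ≤ t)
    (hu : ∑ i, ‖u i‖ ^ 2 ≤ a * s) (hv : ∑ i, ‖v i‖ ^ 2 ≤ b * t) :
    ∑ i, ‖u i + v i‖ ^ 2 ≤ (a + b) * (s + t) := by
  have e : ∀ z : ι → Y, ∑ i, ‖z i‖ ^ 2 = ‖(WithLp.toLp 2 z : PiLp 2 fun _ : ι => Y)‖ ^ 2 :=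
    fun z => by rw [PiLp.norm_sq_eq_of_L2]
  rw [e] at hu hv
  have h := e (fun i => u i + v i)
  rw [h]
  have ht := norm_add_le (WithLp.toLp 2 u : PiLp 2 fun _ : ι => Y) (WithLp.toLp 2 v)
  have hsq := pow_le_pow_left₀ (norm_nonneg _) ht 2
  refine hsq.trans ?_
  set p := ‖(WithLp.toLp 2 u : PiLp 2 fun _ : ι => Y)‖
  set q := ‖(WithLp.toLp 2 v : PiLp 2 fun _ : ι => Y)‖
  have hp : 0 ≤ p := norm_nonneg _
  have hq : 0 ≤ q := norm_nonneg _
  have key : p * q ≤ (a * t + b * s) / 2 := by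
    have : (p * q) ^ 2 ≤ ((a * t + b * s) / 2) ^ 2 := by
      have h1 : p ^ 2 * q ^ 2 ≤ (a * s) * (b * t) := by gcongr
      nlinarith [sq_nonneg (a * t - b * s)]
    exact le_of_sq_le_sq this (by positivity)
  nlinarith

theorem matNorm_fromCols_le (S : Matrix ι κ (X →L[ℂ] Y)) (T : Matrix ι κ' (X →L[ℂ] Y))
    {c d : ℝ} (hc : 0 ≤ c) (hd : 0 ≤ d) (hS : matNorm S ≤ √c) (hT : matNorm T ≤ √d) :
    matNorm (Matrix.fromCols S T) ≤ √(c + d) := by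
  refine matNorm_le (Real.sqrt_nonneg _) fun z => ?_
  rw [Real.sq_sqrt (by positivity), Fintype.sum_sum_type]
  simp only [Fintype.sum_sum_type, Matrix.fromCols_apply_inl, Matrix.fromCols_apply_inr]
  have h1 := pow_le_pow_left₀ (matNorm_nonneg S) hS 2
  have h2 := pow_le_pow_left₀ (matNorm_nonneg T) hT 2
  rw [Real.sq_sqrt hc] at h1
  rw [Real.sq_sqrt hd] at h2
  refine sum_norm_sq_add_le hc hd (by positivity) (by positivity) ?_ ?_
  · exact (sum_norm_sq_le S _).trans (by gcongr)
  · exact (sum_norm_sq_le T _).trans (by gcongr)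

theorem matNorm_fromBlocks_diag_le (S : Matrix ι κ (X →L[ℂ] Y)) (T : Matrix ι' κ' (X →L[ℂ] Y)) :
    matNorm (Matrix.fromBlocks S 0 0 T) ≤ max (matNorm S) (matNorm T) := by
  refine matNorm_le (le_max_of_le_left (matNorm_nonneg _)) fun z => ?_
  have h1 := sum_norm_sq_le S (fun j => z (Sum.inl j))
  have h2 := sum_norm_sq_le T (fun j => z (Sum.inr j))
  have m1 := pow_le_pow_left₀ (matNorm_nonneg _) (le_max_left (matNorm S) (matNorm T)) 2
  have m2 := pow_le_pow_left₀ (matNorm_nonneg _) (le_max_right (matNorm S) (matNorm T)) 2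
  have k1 := h1.trans (mul_le_mul_of_nonneg_right m1 (by positivity))
  have k2 := h2.trans (mul_le_mul_of_nonneg_right m2 (by positivity))
  rw [Fintype.sum_sum_type, Fintype.sum_sum_type, mul_add]
  refine add_le_add (le_of_eq_of_le ?_ k1) (le_of_eq_of_le ?_ k2) <;> simp

theorem matNorm_const_smul_le (c : ℂ) (T : Matrix ι κ (X →L[ℂ] Y)) :
    matNorm (c • T) ≤ ‖c‖ * matNorm T := by
  have : matOp (c • T) = c • matOp T := by
    ext x i
    simp [Finset.smul_sum]
  rw [matNorm, this]
  exact (matOp T).opNorm_smul_le c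

open scoped Matrix.Norms.L2Operator in
theorem matNorm_scalar_mul_le [DecidableEq ι] (S : Matrix ι' ι ℂ) (T : Matrix ι κ (X →L[ℂ] Y)) :
    matNorm (Matrix.of fun i j => ∑ k, S i k • T k j) ≤ ‖S‖ * matNorm T := by
  have e : (Matrix.of fun i j => ∑ k, S i k • T k j) = Matrix.of fun i j =>
      ∑ k, (S.map fun s => s • ContinuousLinearMap.id ℂ Y) i k ∘L T k j := by
    ext i j; simp
  rw [e]
  exact (matNorm_comp_le _ _).trans
    (mul_le_mul_of_nonneg_right (matNorm_smul_le S) (matNorm_nonneg _))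

theorem matNorm_unit (T : X →L[ℂ] Y) : matNorm (Matrix.of fun _ _ : Unit => T) = ‖T‖ := by
  apply le_antisymm
  · refine matNorm_le (norm_nonneg _) fun z => ?_
    simpa [← mul_pow] using pow_le_pow_left₀ (norm_nonneg _) (T.le_opNorm (z ())) 2
  · refine T.opNorm_le_bound (matNorm_nonneg _) fun z => ?_
    have h := sum_norm_sq_le (Matrix.of fun _ _ : Unit => T) (fun _ => z)
    simp only [Matrix.of_apply, Finset.univ_unique, Finset.sum_singleton, ← mul_pow] at h
    exact le_of_sq_le_sq h (mul_nonneg (matNorm_nonneg _) (norm_nonneg _))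

end MatNorm

/-- Homomorphisms `A → B(H)` of a (concrete) operator algebra. -/
abbrev RepHom {H₁ : Type w₁} [NormedAddCommGroup H₁] [InnerProductSpace ℂ H₁]
    (A : NonUnitalSubalgebra ℂ (H₁ →L[ℂ] H₁)) (H : Type u) [NormedAddCommGroup H]
    [InnerProductSpace ℂ H] :=
  A →ₙₐ[ℂ] (H →L[ℂ] H)

section Haagerup

variable {H₁ : Type w₁} [NormedAddCommGroup H₁] [InnerProductSpace ℂ H₁]
variable {H : Type u} [NormedAddCommGroup H] [InnerProductSpace ℂ H] [CompleteSpace H]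
variable {K : Type u} [NormedAddCommGroup K] [InnerProductSpace ℂ K] [CompleteSpace K]
variable {A : NonUnitalSubalgebra ℂ (H₁ →L[ℂ] H₁)}
variable (α : RepHom A H) (M : Submodule ℂ (H →L[ℂ] K)) (U : OMod.{u} A)
variable {ι κ ι' κ' π : Type} [Fintype ι] [Fintype κ] [Fintype ι'] [Fintype κ'] [Fintype π]

variable {M} in
/-- The norm of a matrix over a space of operators. -/
def rowNorm (x : Matrix ι κ M) : ℝ := matNorm (x.map (fun m : M => (m : H →L[ℂ] K)))

variable {M} in
theorem rowNorm_nonneg (x : Matrix ι κ M) : 0 ≤ rowNorm x := matNorm_nonneg _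

variable {M U} in
/-- The matrix product `x ⊙ y` with entries `∑ k, x i k ⊗ y k j`. -/
def odot (x : Matrix ι π M) (y : Matrix π κ U.carrier) : Matrix ι κ (M ⊗[ℂ] U.carrier) :=
  Matrix.of fun i j => ∑ k, x i k ⊗ₜ[ℂ] y k j

variable {M U} in
@[simp] theorem odot_apply (x : Matrix ι π M) (y : Matrix π κ U.carrier) (i : ι) (j : κ) :
    odot x y i j = ∑ k, x i k ⊗ₜ[ℂ] y k j := rfl

/-- The factorizations in the Haagerup norm may be indexed by any finite type. -/
theorem haagerupNorm_le_of_factor (t : Matrix ι κ (M ⊗[ℂ] U.carrier)) (x : Matrix ι π M)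
    (y : Matrix π κ U.carrier)
    (h : ∀ i j, t i j - ∑ k, x i k ⊗ₜ[ℂ] y k j ∈ balancedRelations α M U) :
    haagerupNorm α M U t ≤ rowNorm x * mnorm y := by
  have hbdd : BddBelow {r | ∃ (p : ℕ) (x : Matrix ι (Fin p) M) (y : Matrix (Fin p) κ U.carrier),
      (∀ i j, t i j - ∑ k, x i k ⊗ₜ[ℂ] y k j ∈ balancedRelations α M U) ∧
      r = matNorm (x.map (fun m : M => (m : H →L[ℂ] K))) * mnorm y} := by
    refine ⟨0, ?_⟩
    rintro _ ⟨p, x, y, -, rfl⟩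
    exact mul_nonneg (matNorm_nonneg _) (mnorm_nonneg _)
  obtain ⟨p, ⟨e⟩⟩ : ∃ p, Nonempty (π ≃ Fin p) := ⟨_, ⟨Fintype.equivFin π⟩⟩
  have hmem : ∀ i j, t i j - ∑ k, (x.submatrix id e.symm) i k ⊗ₜ[ℂ] (y.submatrix e.symm id) k j
      ∈ balancedRelations α M U := by
    intro i j
    have : ∑ k, (x.submatrix id e.symm) i k ⊗ₜ[ℂ] (y.submatrix e.symm id) k j
        = ∑ k, x i k ⊗ₜ[ℂ] y k j :=
      Fintype.sum_equiv e.symm _ (fun k => x i k ⊗ₜ[ℂ] y k j) fun k => rfl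
    rw [this]
    exact h i j
  refine (csInf_le hbdd ⟨p, _, _, hmem, rfl⟩).trans ?_
  have h1 : matNorm ((x.submatrix id e.symm).map (fun m : M => (m : H →L[ℂ] K))) ≤ rowNorm x :=
    matNorm_submatrix_equiv_le (x.map (fun m : M => (m : H →L[ℂ] K))) e.symm
  have h2 : mnorm (y.submatrix e.symm id) ≤ mnorm y :=
    (matrixSeminorm U.carrier).submatrix_le y e.symm.injective Function.injective_id
  exact mul_le_mul h1 h2 (mnorm_nonneg _) (rowNorm_nonneg x)

/-- Every matrix over the algebraic tensor product is of the form `x ⊙ y`, so the infimum in the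
Haagerup norm is over a nonempty set. -/
theorem exists_odot (t : Matrix ι κ (M ⊗[ℂ] U.carrier)) :
    ∃ (p : ℕ) (x : Matrix ι (Fin p) M) (y : Matrix (Fin p) κ U.carrier), t = odot x y := by
  classical
  choose n m v h using fun ij : ι × κ => TensorProduct.exists_sum_tmul_eq (t ij.1 ij.2)
  let π := Σ ij : ι × κ, Fin (n ij)
  let e := Fintype.equivFin π
  let x : Matrix ι π M := Matrix.of fun i q => if i = q.1.1 then m q.1 q.2 else 0
  let y : Matrix π κ U.carrier := Matrix.of fun q j => if j = q.1.2 then v q.1 q.2 else 0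
  refine ⟨_, x.submatrix id e.symm, y.submatrix e.symm id, ?_⟩
  refine Matrix.ext fun i j => ?_
  have h1 : odot (x.submatrix id e.symm) (y.submatrix e.symm id) i j
      = ∑ q : π, x i q ⊗ₜ[ℂ] y q j :=
    Fintype.sum_equiv e.symm _ (fun q : π => x i q ⊗ₜ[ℂ] y q j) fun k => rfl
  rw [h1, Fintype.sum_sigma, Finset.sum_eq_single (i, j)]
  · simpa [x, y] using h (i, j)
  · rintro ⟨i', j'⟩ - hne
    refine Finset.sum_eq_zero fun q _ => ?_
    by_cases hi : i = i'
    · by_cases hj : j = j'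
      · exact absurd (by rw [hi, hj]) hne
      · simp [x, y, hj]
    · simp [x, y, hi]
  · simp

theorem exists_factor_lt (t : Matrix ι κ (M ⊗[ℂ] U.carrier)) {c : ℝ}
    (h : haagerupNorm α M U t < c) :
    ∃ (p : ℕ) (x : Matrix ι (Fin p) M) (y : Matrix (Fin p) κ U.carrier),
      (∀ i j, t i j - ∑ k, x i k ⊗ₜ[ℂ] y k j ∈ balancedRelations α M U) ∧
      rowNorm x * mnorm y < c := by
  obtain ⟨p, x, y, rfl⟩ := exists_odot M U t
  unfold haagerupNorm at h
  obtain ⟨_, ⟨p, x, y, hxy, rfl⟩, hlt⟩ := exists_lt_of_csInf_lt (by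
    exact ⟨_, p, x, y, fun i j => by simp, rfl⟩) h
  exact ⟨p, x, y, hxy, hlt⟩

/-- A matrix of Haagerup norm less than `c` has a factorization with both factors of norm at most
`√c`. -/
theorem exists_factor_le_sqrt (t : Matrix ι κ (M ⊗[ℂ] U.carrier)) {c : ℝ} (hc : 0 < c)
    (h : haagerupNorm α M U t < c) :
    ∃ (p : ℕ) (x : Matrix ι (Fin p) M) (y : Matrix (Fin p) κ U.carrier),
      (∀ i j, t i j - ∑ k, x i k ⊗ₜ[ℂ] y k j ∈ balancedRelations α M U) ∧
      rowNorm x ≤ √c ∧ mnorm y ≤ √c := by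
  obtain ⟨p, x, y, hxy, hlt⟩ := exists_factor_lt α M U t h
  have sc := Real.sqrt_pos.2 hc
  obtain ⟨r, hr, h1, h2⟩ : ∃ r : ℝ, 0 < r ∧ r * rowNorm x ≤ √c ∧ r⁻¹ * mnorm y ≤ √c := by
    rcases (rowNorm_nonneg x).eq_or_lt with h0 | h0
    · refine ⟨mnorm y / √c + 1, by have := mnorm_nonneg y; positivity, by simp [← h0], ?_⟩
      have := mnorm_nonneg y
      rw [inv_mul_le_iff₀ (by positivity), add_mul, div_mul_cancel₀ _ sc.ne']
      linarith
    · refine ⟨√c / rowNorm x, by positivity, by rw [div_mul_cancel₀ _ h0.ne'], ?_⟩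
      rw [inv_div, div_mul_eq_mul_div, div_le_iff₀ sc, Real.mul_self_sqrt hc.le]
      exact hlt.le
  have hr' : (r : ℂ) ≠ 0 := by exact_mod_cast hr.ne'
  refine ⟨p, (r : ℂ) • x, (r : ℂ)⁻¹ • y, fun i j => ?_, ?_, ?_⟩
  · have : ∀ k, ((r : ℂ) • x) i k ⊗ₜ[ℂ] ((r : ℂ)⁻¹ • y) k j = x i k ⊗ₜ[ℂ] y k j := by
      intro k
      rw [Matrix.smul_apply, Matrix.smul_apply, TensorProduct.smul_tmul_smul,
        mul_inv_cancel₀ hr', one_smul]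
    simp only [this]
    exact hxy i j
  · have : ((r : ℂ) • x).map (fun m : M => (m : H →L[ℂ] K))
        = (r : ℂ) • x.map (fun m : M => (m : H →L[ℂ] K)) := by ext; simp
    rw [rowNorm, this]
    refine (matNorm_const_smul_le _ _).trans ?_
    rw [Complex.norm_real, Real.norm_of_nonneg hr.le]
    exact h1
  · refine ((matrixSeminorm U.carrier).smul_le _ _).trans ?_
    rw [norm_inv, Complex.norm_real, Real.norm_of_nonneg hr.le]
    exact h2

theorem haagerupNorm_nonneg (t : Matrix ι κ (M ⊗[ℂ] U.carrier)) : 0 ≤ haagerupNorm α M U t := by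
  refine Real.sInf_nonneg ?_
  rintro _ ⟨p, x, y, -, rfl⟩
  exact mul_nonneg (matNorm_nonneg _) (mnorm_nonneg _)

/-- Factorizations `x ⊙ y` and `x' ⊙ y'` combine to the product of the row `(x, x')` and the column
`(y, y')`, whose norms satisfy Pythagorean bounds. -/
theorem haagerupNorm_add_le (t t' : Matrix ι κ (M ⊗[ℂ] U.carrier)) :
    haagerupNorm α M U (t + t') ≤ haagerupNorm α M U t + haagerupNorm α M U t' := by
  refine le_of_forall_pos_le_add fun ε hε => ?_
  have n1 := haagerupNorm_nonneg α M U t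
  have n2 := haagerupNorm_nonneg α M U t'
  obtain ⟨p, x, y, hxy, hx, hy⟩ := exists_factor_le_sqrt α M U t
    (c := haagerupNorm α M U t + ε / 2) (by positivity) (by linarith)
  obtain ⟨p', x', y', hxy', hx', hy'⟩ := exists_factor_le_sqrt α M U t'
    (c := haagerupNorm α M U t' + ε / 2) (by positivity) (by linarith)
  refine (haagerupNorm_le_of_factor α M U (t + t') (Matrix.fromCols x x')
    (Matrix.fromRows y y') fun i j => ?_).trans ?_
  · have e : (t + t') i j - ∑ k, Matrix.fromCols x x' i k ⊗ₜ[ℂ] Matrix.fromRows y y' k j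
        = (t i j - ∑ k, x i k ⊗ₜ[ℂ] y k j) + (t' i j - ∑ k, x' i k ⊗ₜ[ℂ] y' k j) := by
      rw [Fintype.sum_sum_type]
      simp only [Matrix.add_apply, Matrix.fromCols_apply_inl, Matrix.fromCols_apply_inr,
        Matrix.fromRows_apply_inl, Matrix.fromRows_apply_inr]
      abel
    rw [e]
    exact add_mem (hxy i j) (hxy' i j)
  · have r1 : rowNorm (Matrix.fromCols x x')
        ≤ √((haagerupNorm α M U t + ε / 2) + (haagerupNorm α M U t' + ε / 2)) := by
      have e : (Matrix.fromCols x x').map (fun m : M => (m : H →L[ℂ] K)) = Matrix.fromCols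
          (x.map (fun m : M => (m : H →L[ℂ] K))) (x'.map (fun m : M => (m : H →L[ℂ] K))) := by
        ext i j; cases j <;> rfl
      rw [rowNorm, e]
      exact matNorm_fromCols_le _ _ (by positivity) (by positivity) hx hx'
    have r2 := (matrixSeminorm U.carrier).fromRows_le y y' (by positivity) (by positivity) hy hy'
    refine (mul_le_mul r1 r2 (mnorm_nonneg _) (Real.sqrt_nonneg _)).trans (le_of_eq ?_)
    rw [Real.mul_self_sqrt (by positivity)]
    ring

open scoped Matrix.Norms.L2Operator in
theorem haagerupNorm_mul_le [DecidableEq ι] [DecidableEq κ'] (S : Matrix ι' ι ℂ)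
    (t : Matrix ι κ (M ⊗[ℂ] U.carrier)) (T : Matrix κ κ' ℂ) :
    haagerupNorm α M U (Matrix.of fun i j => ∑ k, ∑ l, (S i k * T l j) • t k l) ≤
      ‖S‖ * haagerupNorm α M U t * ‖T‖ := by
  have key : ∀ c, haagerupNorm α M U t < c →
      haagerupNorm α M U (Matrix.of fun i j => ∑ k, ∑ l, (S i k * T l j) • t k l) ≤
        ‖S‖ * c * ‖T‖ := by
    intro c hc
    obtain ⟨p, x, y, hxy, hlt⟩ := exists_factor_lt α M U t hc
    refine (haagerupNorm_le_of_factor α M U _ (Matrix.of fun i q => ∑ k, S i k • x k q)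
      (Matrix.of fun q j => ∑ l, T l j • y q l) fun i j => ?_).trans ?_
    · have e : (Matrix.of fun i j => ∑ k, ∑ l, (S i k * T l j) • t k l) i j
          - ∑ q, (Matrix.of fun i q => ∑ k, S i k • x k q) i q ⊗ₜ[ℂ]
              (Matrix.of fun q j => ∑ l, T l j • y q l) q j
          = ∑ k, ∑ l, (S i k * T l j) • (t k l - ∑ q, x k q ⊗ₜ[ℂ] y q l) := by
        have e1 : ∀ q, (Matrix.of fun i q => ∑ k, S i k • x k q) i q ⊗ₜ[ℂ]
            (Matrix.of fun q j => ∑ l, T l j • y q l) q j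
            = ∑ k, ∑ l, (S i k * T l j) • (x k q ⊗ₜ[ℂ] y q l) := fun q => by
          simp only [Matrix.of_apply, TensorProduct.sum_tmul, TensorProduct.tmul_sum,
            TensorProduct.smul_tmul_smul]
          exact Finset.sum_comm
        have e2 : ∀ k l, (S i k * T l j) • t k l
            = (S i k * T l j) • (t k l - ∑ q, x k q ⊗ₜ[ℂ] y q l)
              + ∑ q, (S i k * T l j) • (x k q ⊗ₜ[ℂ] y q l) := fun k l => by
          rw [← Finset.smul_sum, ← smul_add, sub_add_cancel]
        simp only [e1]
        rw [sub_eq_iff_eq_add, Matrix.of_apply]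
        simp only [e2, Finset.sum_add_distrib]
        congr 1
        rw [Finset.sum_comm]
        conv_rhs => rw [Finset.sum_comm]
        rw [Finset.sum_comm]
        refine Finset.sum_congr rfl fun k _ => Finset.sum_comm
      rw [e]
      exact Submodule.sum_mem _ fun k _ => Submodule.sum_mem _ fun l _ =>
        Submodule.smul_mem _ _ (hxy k l)
    · have h1 : rowNorm (Matrix.of fun i q => ∑ k, S i k • x k q) ≤ ‖S‖ * rowNorm x := by
        have e : (Matrix.of fun i q => ∑ k, S i k • x k q).map (fun m : M => (m : H →L[ℂ] K))
            = Matrix.of fun i q => ∑ k, S i k • x.map (fun m : M => (m : H →L[ℂ] K)) k q := by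
          ext; simp
        rw [rowNorm, e]
        exact matNorm_scalar_mul_le _ _
      have h2 := (matrixSeminorm U.carrier).mulRight_le y T
      have n1 := rowNorm_nonneg x
      calc _ ≤ (‖S‖ * rowNorm x) * (mnorm y * ‖T‖) :=
            mul_le_mul h1 h2 (mnorm_nonneg _) (by positivity)
        _ = ‖S‖ * (rowNorm x * mnorm y) * ‖T‖ := by ring
        _ ≤ _ := by gcongr
  have hlim : Filter.Tendsto (fun c => ‖S‖ * c * ‖T‖)
      (nhdsWithin (haagerupNorm α M U t) (Set.Ioi (haagerupNorm α M U t)))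
      (nhds (‖S‖ * haagerupNorm α M U t * ‖T‖)) :=
    (Continuous.tendsto (by fun_prop) _).mono_left nhdsWithin_le_nhds
  exact ge_of_tendsto hlim (Filter.eventually_of_mem self_mem_nhdsWithin fun c hc => key c hc)

theorem haagerupNorm_fromBlocks_le (t : Matrix ι κ (M ⊗[ℂ] U.carrier))
    (t' : Matrix ι' κ' (M ⊗[ℂ] U.carrier)) :
    haagerupNorm α M U (Matrix.fromBlocks t 0 0 t') ≤
      max (haagerupNorm α M U t) (haagerupNorm α M U t') := by
  refine le_of_forall_pos_le_add fun ε hε => ?_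
  set c := max (haagerupNorm α M U t) (haagerupNorm α M U t') + ε
  have n1 := haagerupNorm_nonneg α M U t
  have l1 : haagerupNorm α M U t < c := (le_max_left _ _).trans_lt (lt_add_of_pos_right _ hε)
  have l2 : haagerupNorm α M U t' < c := (le_max_right _ _).trans_lt (lt_add_of_pos_right _ hε)
  have hc : 0 < c := n1.trans_lt l1
  obtain ⟨p, x, y, hxy, hx, hy⟩ := exists_factor_le_sqrt α M U t hc l1
  obtain ⟨p', x', y', hxy', hx', hy'⟩ := exists_factor_le_sqrt α M U t' hc l2
  refine (haagerupNorm_le_of_factor α M U _ (Matrix.fromBlocks x 0 0 x')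
    (Matrix.fromBlocks y 0 0 y') fun i j => ?_).trans ?_
  · rw [Fintype.sum_sum_type]
    rcases i with i | i <;> rcases j with j | j
    · simpa using hxy i j
    · simp
    · simp
    · simpa using hxy' i j
  · have r1 : rowNorm (Matrix.fromBlocks x 0 0 x') ≤ √c := by
      have e : (Matrix.fromBlocks x 0 0 x').map (fun m : M => (m : H →L[ℂ] K))
          = Matrix.fromBlocks (x.map (fun m : M => (m : H →L[ℂ] K))) 0 0
            (x'.map (fun m : M => (m : H →L[ℂ] K))) := by
        rw [Matrix.fromBlocks_map]
        rfl
      rw [rowNorm, e]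
      exact (matNorm_fromBlocks_diag_le _ _).trans (max_le hx hx')
    have r2 : mnorm (Matrix.fromBlocks y 0 0 y') ≤ √c :=
      (mnorm_fromBlocks_le _ _).trans (max_le hy hy')
    refine (mul_le_mul r1 r2 (mnorm_nonneg _) (Real.sqrt_nonneg _)).trans (le_of_eq ?_)
    rw [Real.mul_self_sqrt hc.le]

/-- The balanced Haagerup norms, as a matrix seminorm on the algebraic tensor product. -/
def haagerupSeminorm : MatrixSeminorm (M ⊗[ℂ] U.carrier) where
  toFun t := haagerupNorm α M U t
  add_le := haagerupNorm_add_le α M U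
  mul_le := haagerupNorm_mul_le α M U
  fromBlocks_le := haagerupNorm_fromBlocks_le α M U

theorem exists_isBalancedHaagerupTensor :
    ∃ (W : Type u) (_ : NormedAddCommGroup W) (_ : NormedSpace ℂ W) (_ : CompleteSpace W)
      (_ : OperatorSpace W) (τ : M ⊗[ℂ] U.carrier →ₗ[ℂ] W), IsBalancedHaagerupTensor α M U W τ := by
  obtain ⟨W, i1, i2, i3, i4, τ, h1, h2⟩ := (haagerupSeminorm α M U).exists_completion
  exact ⟨W, i1, i2, i3, i4, τ, ⟨h1, h2⟩⟩

end Haagerup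

end DeltaMorita

namespace DeltaMorita

open OperatorSpace Filter Topology

/-! ### Extension by density -/

section Density

variable {E F : Type*} [SeminormedAddCommGroup E] [Module ℂ E] [NormedAddCommGroup F]
  [NormedSpace ℂ F]

/-- Pointwise convergence of a bounded family of linear maps may be checked on a set with dense
linear span. -/
theorem tendsto_of_mem_closure_span {σ : Type*} {l : Filter σ} {T : σ → E →ₗ[ℂ] F}
    {S : E →ₗ[ℂ] F} {C : ℝ} (hT : ∀ i x, ‖T i x‖ ≤ C * ‖x‖) (hS : ∀ x, ‖S x‖ ≤ C * ‖x‖)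
    {D : Set E} (hD : ∀ d ∈ D, Tendsto (fun i => T i d) l (𝓝 (S d))) {x : E}
    (hx : x ∈ closure (Submodule.span ℂ D : Set E)) :
    Tendsto (fun i => T i x) l (𝓝 (S x)) := by
  have hspan : ∀ y ∈ Submodule.span ℂ D, Tendsto (fun i => T i y) l (𝓝 (S y)) := by
    intro y hy
    induction hy using Submodule.span_induction with
    | mem y hy => exact hD y hy
    | zero => simpa using tendsto_const_nhds (x := (0 : F)) (f := l)
    | add y z _ _ hy hz => simpa using hy.add hz
    | smul c y _ hy => simpa using hy.const_smul c
  rw [Metric.tendsto_nhds]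
  intro ε hε
  have hC : 0 < |C| + 1 := by positivity
  obtain ⟨y, hy, hxy⟩ := Metric.mem_closure_iff.1 hx (ε / (3 * (|C| + 1))) (by positivity)
  have hb : C * ‖x - y‖ ≤ ε / 3 := by
    rw [← dist_eq_norm]
    calc C * dist x y ≤ (|C| + 1) * (ε / (3 * (|C| + 1))) := by
          gcongr
          linarith [le_abs_self C]
      _ = ε / 3 := by field_simp
  filter_upwards [Metric.tendsto_nhds.1 (hspan y hy) (ε / 3) (by positivity)] with i hi
  have h1 := hT i (x - y)
  have h2 := hS (x - y)
  rw [dist_eq_norm] at hi ⊢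
  have e : T i x - S x = T i (x - y) + (T i y - S y) - S (x - y) := by
    simp only [map_sub]; abel
  rw [e]
  calc _ ≤ ‖T i (x - y)‖ + ‖T i y - S y‖ + ‖S (x - y)‖ :=
        (norm_sub_le _ _).trans (by gcongr; exact norm_add_le _ _)
    _ < ε := by linarith

/-- A bounded assignment on a family with dense span extends to a bounded operator. -/
theorem exists_clm_of_dense_span [IsBoundedSMul ℂ E] [CompleteSpace F] {σ : Type*} (e : σ → E)
    (f : σ → F) (C : ℝ)
    (hd : Dense (Submodule.span ℂ (Set.range e) : Set E))
    (h : ∀ c : σ →₀ ℂ, ‖c.sum fun i z => z • f i‖ ≤ C * ‖c.sum fun i z => z • e i‖) :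
    ∃ T : E →L[ℂ] F, (∀ i, T (e i) = f i) ∧ ∀ x, ‖T x‖ ≤ C * ‖x‖ := by
  have hd' : DenseRange (Finsupp.linearCombination ℂ e) := by
    have : Set.range (Finsupp.linearCombination ℂ e) =
        (Submodule.span ℂ (Set.range e) : Set E) := by
      rw [← Finsupp.range_linearCombination]; rfl
    rw [DenseRange, this]
    exact hd
  have h' : ∀ c, ‖Finsupp.linearCombination ℂ f c‖ ≤ C * ‖Finsupp.linearCombination ℂ e c‖ :=
    fun c => by simpa only [Finsupp.linearCombination_apply] using h c
  refine ⟨(Finsupp.linearCombination ℂ f).extendOfNorm (Finsupp.linearCombination ℂ e),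
    fun i => ?_, LinearMap.norm_extendOfNorm_apply_le hd' C h'⟩
  have := LinearMap.extendOfNorm_eq hd' ⟨C, h'⟩ (Finsupp.single i 1)
  simpa using this

theorem clm_ext_of_dense_span {T S : E →L[ℂ] F} {D : Set E}
    (hd : Dense (Submodule.span ℂ D : Set E)) (h : ∀ d ∈ D, T d = S d) : T = S := by
  refine ContinuousLinearMap.ext_on hd ?_
  exact fun d hd => h d hd

end Density

/-! ### Approximate units of ternary rings of operators -/

/-- A polynomial `p` with `p(t) ^ 2 t ≤ 1` for which `(1 - p(t) ^ 2 t) ^ 2 t` is small: for the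
function `t ↦ (t + δ)^(-1/2)` both estimates hold with room to spare, so they hold for polynomials
close to it. -/
theorem exists_polynomial_approx {N δ : ℝ} (hN : 0 ≤ N) (hδ : 0 < δ) :
    ∃ p : Polynomial ℝ, ∀ t ∈ Set.Icc 0 N,
      p.eval t ^ 2 * t ≤ 1 ∧ (1 - p.eval t ^ 2 * t) ^ 2 * t ≤ 4 * δ := by
  have hsq : 0 < √δ := Real.sqrt_pos.2 hδ
  set η : ℝ := min 1 (δ / (N + δ) / ((2 / √δ + 1) * (N + 1))) with hη
  have hη0 : 0 < η := by
    apply lt_min one_pos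
    positivity
  have hcont : ContinuousOn (fun t : ℝ => (√(t + δ))⁻¹) (Set.Icc 0 N) := by
    refine ContinuousOn.inv₀ (by fun_prop) fun t ht => ?_
    exact (Real.sqrt_pos.2 (by linarith [ht.1])).ne'
  obtain ⟨p, hp⟩ := exists_polynomial_near_of_continuousOn 0 N _ hcont η hη0
  refine ⟨p, fun t ht => ?_⟩
  have ht0 := ht.1
  have htN := ht.2
  set g := (√(t + δ))⁻¹ with hg
  have hpos : 0 < t + δ := by linarith
  have hg0 : 0 < g := by positivity
  have hg2 : g ^ 2 = (t + δ)⁻¹ := by rw [hg, inv_pow, Real.sq_sqrt hpos.le]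
  have hgle : g ≤ 1 / √δ := by
    rw [hg, ← one_div]
    gcongr
    linarith
  have hpt := (hp t ht).le
  set q := p.eval t
  -- the error of `q ^ 2 * t` as an approximation of `t / (t + δ)`
  have herr : |q ^ 2 * t - g ^ 2 * t| ≤ δ / (N + δ) := by
    have e : q ^ 2 * t - g ^ 2 * t = (q - g) * ((q - g) + 2 * g) * t := by ring
    rw [e, abs_mul, abs_mul, abs_of_nonneg ht0]
    have h1 : |q - g + 2 * g| ≤ 2 / √δ + 1 := by
      calc |q - g + 2 * g| ≤ |q - g| + |2 * g| := abs_add_le _ _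
        _ ≤ 1 + 2 * (1 / √δ) := by
          rw [abs_of_pos (by positivity : 0 < 2 * g)]
          gcongr
          exact hpt.trans (min_le_left _ _)
        _ = _ := by ring
    calc |q - g| * |q - g + 2 * g| * t
        ≤ (δ / (N + δ) / ((2 / √δ + 1) * (N + 1))) * (2 / √δ + 1) * (N + 1) := by
          gcongr
          · exact hpt.trans (min_le_right _ _)
          · linarith
      _ = δ / (N + δ) := by field_simp
  rw [abs_le] at herr
  have hgt : g ^ 2 * t = 1 - δ / (t + δ) := by
    rw [hg2]; field_simp; ring
  have hmono : δ / (N + δ) ≤ δ / (t + δ) := by gcongr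
  have ha0 : 0 ≤ δ / (t + δ) := by positivity
  constructor
  · linarith
  · have h1 : 0 ≤ 1 - q ^ 2 * t := by linarith
    have h2 : 1 - q ^ 2 * t ≤ 2 * (δ / (t + δ)) := by linarith
    calc (1 - q ^ 2 * t) ^ 2 * t ≤ (2 * (δ / (t + δ))) ^ 2 * t := by gcongr
      _ = 4 * δ * (δ * t / (t + δ) ^ 2) := by field_simp; ring
      _ ≤ 4 * δ * 1 := by
          gcongr
          rw [div_le_one (by positivity)]
          nlinarith
      _ = 4 * δ := mul_one _

section TRO

variable {H : Type u} [NormedAddCommGroup H] [InnerProductSpace ℂ H] [CompleteSpace H]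
variable {K : Type v} [NormedAddCommGroup K] [InnerProductSpace ℂ K] [CompleteSpace K]

open ContinuousLinearMap (adjoint adjoint_inner_left adjoint_inner_right)

/-- The operator `∑ mᵢ mᵢ⋆` of a finite family of operators. -/
def gramOp {n : ℕ} (m : Fin n → H →L[ℂ] K) : K →L[ℂ] K := ∑ i, m i ∘L adjoint (m i)

section GramOp

variable {n : ℕ} (m : Fin n → H →L[ℂ] K)

theorem gramOp_apply (y : K) : gramOp m y = ∑ i, m i (adjoint (m i) y) := by
  simp [gramOp, sum_apply]

theorem adjoint_gramOp : adjoint (gramOp m) = gramOp m := by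
  simp [gramOp, map_sum, ContinuousLinearMap.adjoint_comp]

theorem isSelfAdjoint_gramOp : IsSelfAdjoint (gramOp m) := adjoint_gramOp m

theorem inner_gramOp (y : K) :
    ⟪y, gramOp m y⟫_ℂ = ((∑ j, ‖adjoint (m j) y‖ ^ 2 : ℝ) : ℂ) := by
  rw [gramOp_apply, inner_sum, Complex.ofReal_sum]
  refine Finset.sum_congr rfl fun j _ => ?_
  rw [← adjoint_inner_left, inner_self_eq_norm_sq_to_K]
  simp

theorem gramOp_nonneg : 0 ≤ gramOp m := by
  rw [ContinuousLinearMap.nonneg_iff_isPositive, ContinuousLinearMap.isPositive_iff']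
  refine ⟨adjoint_gramOp m, fun y => ?_⟩
  rw [← adjoint_inner_right, adjoint_gramOp, inner_gramOp]
  exact Complex.zero_le_real.2 (by positivity)

theorem sum_norm_sq_adjoint_comp_le {T : K →L[ℂ] K} (hT : IsSelfAdjoint T) (y : K) :
    ∑ j, ‖adjoint (m j) (T y)‖ ^ 2 ≤ ‖T * gramOp m * T‖ * ‖y‖ ^ 2 := by
  have h1 := inner_gramOp m (T y)
  have h2 : ⟪T y, gramOp m (T y)⟫_ℂ = ⟪y, (T * gramOp m * T) y⟫_ℂ := by
    have : adjoint T = T := hT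
    conv_lhs => rw [← this, adjoint_inner_left]
    simp [this]
  have h3 : ‖⟪y, (T * gramOp m * T) y⟫_ℂ‖ ≤ ‖T * gramOp m * T‖ * ‖y‖ ^ 2 := by
    refine (norm_inner_le_norm _ _).trans ?_
    have := (T * gramOp m * T).le_opNorm y
    nlinarith [norm_nonneg y]
  rw [← h2, h1, Complex.norm_real] at h3
  exact (le_abs_self _).trans h3

theorem spectrum_gramOp_subset : spectrum ℝ (gramOp m) ⊆ Set.Icc 0 ‖gramOp m‖ := by
  intro t ht
  refine ⟨spectrum_nonneg_of_nonneg (gramOp_nonneg m) ht, (le_abs_self t).trans ?_⟩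
  have h1 := spectrum.norm_le_norm_mul_of_mem ht
  exact h1.trans (mul_le_of_le_one_right (norm_nonneg _) ContinuousLinearMap.norm_id_le)

/-- For a polynomial `f` bounded by `c` on the relevant interval, `f(∑ mᵢ mᵢ⋆)` has norm at most
`c`. -/
theorem norm_aeval_gramOp_le (f : Polynomial ℝ) {c : ℝ} (hc : 0 ≤ c)
    (h : ∀ t ∈ Set.Icc 0 ‖gramOp m‖, |f.eval t| ≤ c) :
    ‖(Polynomial.aeval (gramOp m) f : K →L[ℂ] K)‖ ≤ c := by
  rw [← cfc_polynomial f (gramOp m) (isSelfAdjoint_gramOp m)]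
  exact norm_cfc_le hc fun t ht => h t (spectrum_gramOp_subset m ht)

theorem isSelfAdjoint_aeval_gramOp (f : Polynomial ℝ) :
    IsSelfAdjoint (Polynomial.aeval (gramOp m) f : K →L[ℂ] K) := by
  rw [← cfc_polynomial f (gramOp m) (isSelfAdjoint_gramOp m)]
  exact IsSelfAdjoint.cfc

end GramOp

/-- A finite row `(m₁, …, mₙ)` over `M` which is contractive as an operator `Hⁿ → K`; the second
estimate says that its adjoint column is contractive. -/
structure ContractiveRow (M : Submodule ℂ (H →L[ℂ] K)) where
  n : ℕ
  entry : Fin n → M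
  norm_row_le : ∀ z : Fin n → H, ‖∑ i, (entry i : H →L[ℂ] K) (z i)‖ ^ 2 ≤ ∑ i, ‖z i‖ ^ 2
  norm_col_le : ∀ y : K, ∑ i, ‖adjoint (entry i : H →L[ℂ] K) y‖ ^ 2 ≤ ‖y‖ ^ 2

namespace ContractiveRow

variable {M : Submodule ℂ (H →L[ℂ] K)}

/-- The operator `∑ mᵢ mᵢ⋆` of a contractive row. -/
def gram (r : ContractiveRow M) : K →L[ℂ] K := gramOp fun i => (r.entry i : H →L[ℂ] K)

theorem gram_apply (r : ContractiveRow M) (y : K) :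
    r.gram y = ∑ i, (r.entry i : H →L[ℂ] K) (adjoint (r.entry i : H →L[ℂ] K) y) :=
  gramOp_apply _ y

theorem norm_gram_le (r : ContractiveRow M) : ‖r.gram‖ ≤ 1 := by
  refine ContinuousLinearMap.opNorm_le_bound _ zero_le_one fun y => ?_
  rw [r.gram_apply, one_mul]
  exact le_of_sq_le_sq ((r.norm_row_le _).trans (r.norm_col_le y)) (norm_nonneg _)

theorem adjoint_gram (r : ContractiveRow M) : adjoint r.gram = r.gram := adjoint_gramOp _

theorem norm_row_le_of_col {n : ℕ} (m : Fin n → H →L[ℂ] K)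
    (h : ∀ y : K, ∑ i, ‖adjoint (m i) y‖ ^ 2 ≤ ‖y‖ ^ 2) (z : Fin n → H) :
    ‖∑ i, m i (z i)‖ ^ 2 ≤ ∑ i, ‖z i‖ ^ 2 := by
  set v := ∑ i, m i (z i) with hv
  have h1 : ‖v‖ ^ 2 ≤ ∑ i, ‖adjoint (m i) v‖ * ‖z i‖ := by
    have e : (‖v‖ ^ 2 : ℝ) = ‖∑ i, ⟪adjoint (m i) v, z i⟫_ℂ‖ := by
      simp only [adjoint_inner_left]
      rw [← inner_sum, ← hv, inner_self_eq_norm_sq_to_K]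
      simp
    rw [e]
    exact (norm_sum_le _ _).trans (Finset.sum_le_sum fun i _ => norm_inner_le_norm _ _)
  have h2 := Finset.sum_mul_sq_le_sq_mul_sq Finset.univ (fun i => ‖adjoint (m i) v‖)
    (fun i => ‖z i‖)
  have h3 : (‖v‖ ^ 2) ^ 2 ≤ ‖v‖ ^ 2 * ∑ i, ‖z i‖ ^ 2 := by
    refine (pow_le_pow_left₀ (by positivity) h1 2).trans (h2.trans ?_)
    gcongr
    exact h v
  rcases (sq_nonneg ‖v‖).eq_or_lt with h0 | h0
  · rw [← h0]; positivity
  · rw [pow_two (‖v‖ ^ 2)] at h3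
    exact le_of_mul_le_mul_left h3 h0

end ContractiveRow

theorem aeval_comp_mem {M : Submodule ℂ (H →L[ℂ] K)} {S : K →L[ℂ] K}
    (hS : ∀ m ∈ M, S ∘L m ∈ M) (p : Polynomial ℝ) :
    ∀ m ∈ M, (Polynomial.aeval S p : K →L[ℂ] K) ∘L m ∈ M := by
  induction p using Polynomial.induction_on' with
  | add p q hp hq =>
    intro m hm
    rw [map_add, ContinuousLinearMap.add_comp]
    exact M.add_mem (hp m hm) (hq m hm)
  | monomial n c =>
    intro m hm
    rw [Polynomial.aeval_monomial]
    have hpow : ∀ n : ℕ, (S ^ n) ∘L m ∈ M := by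
      intro n
      induction n with
      | zero => exact hm
      | succ n ih =>
        rw [pow_succ']
        exact hS _ ih
    have e : (algebraMap ℝ (K →L[ℂ] K) c * S ^ n) ∘L m = (c : ℂ) • ((S ^ n) ∘L m) := by
      ext x
      simp [Algebra.algebraMap_eq_smul_one]
    rw [e]
    exact M.smul_mem _ (hpow n)

/-- Contractive rows over a ternary ring of operators whose operators `∑ mᵢ mᵢ⋆` almost fix given
elements: with `S = ∑ lⱼ lⱼ⋆` the row consists of the `p(S) lⱼ`, for a polynomial `p` such that
`p(t) ^ 2 t` is close to `1` away from zero. -/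
theorem IsTRO.exists_row {M : Submodule ℂ (H →L[ℂ] K)} (hM : IsTRO M) {n : ℕ} (l : Fin n → M)
    {ε : ℝ} (hε : 0 < ε) :
    ∃ r : ContractiveRow M, ∀ j, ‖r.gram ∘L (l j : H →L[ℂ] K) - l j‖ ≤ ε := by
  set m : Fin n → H →L[ℂ] K := fun j => l j with hm
  set S : K →L[ℂ] K := gramOp m with hS
  obtain ⟨p, hp⟩ := exists_polynomial_approx (norm_nonneg S) (δ := ε ^ 2 / 4) (by positivity)
  set q : K →L[ℂ] K := Polynomial.aeval S p with hq
  have hqa : IsSelfAdjoint q := isSelfAdjoint_aeval_gramOp m p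
  have hqa' : adjoint q = q := hqa
  have hqSq : q * S * q = Polynomial.aeval S (p * Polynomial.X * p) := by simp [hq]
  have hSl : ∀ x ∈ M, S ∘L x ∈ M := by
    intro x hx
    have : S ∘L x = ∑ j, m j ∘L adjoint (m j) ∘L x := by
      ext; simp [hS, gramOp_apply]
    rw [this]
    exact M.sum_mem fun j _ => hM _ (l j).2 _ (l j).2 _ hx
  have hcol : ∀ y : K, ∑ j, ‖adjoint (q ∘L m j) y‖ ^ 2 ≤ ‖y‖ ^ 2 := by
    intro y
    simp only [ContinuousLinearMap.adjoint_comp, ContinuousLinearMap.comp_apply, hqa']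
    refine (sum_norm_sq_adjoint_comp_le m hqa y).trans
      (mul_le_of_le_one_left (by positivity) ?_)
    rw [hqSq]
    refine norm_aeval_gramOp_le m _ zero_le_one fun t ht => ?_
    have e : (p * Polynomial.X * p).eval t = p.eval t ^ 2 * t := by simp; ring
    rw [e, abs_of_nonneg (mul_nonneg (sq_nonneg _) ht.1)]
    exact (hp t ht).1
  let r : ContractiveRow M :=
    { n := n
      entry := fun j => ⟨q ∘L m j, aeval_comp_mem hSl p _ (l j).2⟩
      norm_row_le := ContractiveRow.norm_row_le_of_col _ hcol
      norm_col_le := hcol }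
  have hgram : r.gram = q * S * q := by
    ext y
    simp [r, ContractiveRow.gram_apply, ContinuousLinearMap.adjoint_comp, hqa', hS, gramOp_apply]
  have hT : IsSelfAdjoint (1 - r.gram) :=
    (IsSelfAdjoint.one (K →L[ℂ] K)).sub r.adjoint_gram
  have hnorm : ‖(1 - r.gram) * S * (1 - r.gram)‖ ≤ ε ^ 2 := by
    have e : (1 - r.gram) * S * (1 - r.gram) = Polynomial.aeval S
        ((1 - p * Polynomial.X * p) * Polynomial.X * (1 - p * Polynomial.X * p)) := by
      rw [hgram, hqSq]; simp
    rw [e]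
    refine norm_aeval_gramOp_le m _ (by positivity) fun t ht => ?_
    have e : ((1 - p * Polynomial.X * p) * Polynomial.X * (1 - p * Polynomial.X * p)).eval t
        = (1 - p.eval t ^ 2 * t) ^ 2 * t := by simp; ring
    rw [e, abs_of_nonneg (mul_nonneg (sq_nonneg _) ht.1)]
    exact (hp t ht).2.trans (by linarith)
  refine ⟨r, fun j => ?_⟩
  have hadj : adjoint (r.gram ∘L m j - m j) = -(adjoint (m j) ∘L (1 - r.gram)) := by
    rw [map_sub, ContinuousLinearMap.adjoint_comp, r.adjoint_gram]
    ext y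
    simp
  have hle : ‖adjoint (m j) ∘L (1 - r.gram)‖ ≤ ε := by
    refine ContinuousLinearMap.opNorm_le_bound _ hε.le fun y => ?_
    refine le_of_sq_le_sq ?_ (by positivity)
    rw [mul_pow]
    refine le_trans ?_ ((sum_norm_sq_adjoint_comp_le m hT y).trans
      (mul_le_mul_of_nonneg_right hnorm (by positivity)))
    exact Finset.single_le_sum (f := fun j => ‖adjoint (m j) ((1 - r.gram) y)‖ ^ 2)
      (fun _ _ => by positivity) (Finset.mem_univ j)
  calc ‖r.gram ∘L m j - m j‖ = ‖adjoint (r.gram ∘L m j - m j)‖ :=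
        ((adjoint : (H →L[ℂ] K) ≃ₗᵢ⋆[ℂ] (K →L[ℂ] H)).norm_map _).symm
    _ ≤ ε := by rw [hadj, norm_neg]; exact hle

/-- Along a suitable filter of contractive rows the operators `∑ mᵢ mᵢ⋆` form a left approximate
unit for `M`. -/
theorem IsTRO.exists_filter {M : Submodule ℂ (H →L[ℂ] K)} (hM : IsTRO M) :
    ∃ l : Filter (ContractiveRow M), l.NeBot ∧
      ∀ m ∈ M, Tendsto (fun r : ContractiveRow M => r.gram ∘L m) l (𝓝 m) := by
  classical
  have key : ∀ s : Finset M × ℕ, ∃ r : ContractiveRow M,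
      ∀ m ∈ s.1, ‖r.gram ∘L (m : H →L[ℂ] K) - m‖ ≤ 1 / ((s.2 : ℝ) + 1) := by
    intro s
    obtain ⟨r, hr⟩ := hM.exists_row (fun j => (s.1.equivFin.symm j : M))
      (Nat.one_div_pos_of_nat (n := s.2))
    refine ⟨r, fun m hm => ?_⟩
    simpa using hr (s.1.equivFin ⟨m, hm⟩)
  choose r hr using key
  refine ⟨map r atTop, inferInstance, fun m hm => ?_⟩
  rw [tendsto_map'_iff, Metric.tendsto_atTop]
  intro ε hε
  obtain ⟨N, hN⟩ := exists_nat_one_div_lt hε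
  refine ⟨({⟨m, hm⟩}, N), fun s hs => ?_⟩
  rw [dist_eq_norm]
  refine (hr s ⟨m, hm⟩ (hs.1 (Finset.mem_singleton_self _))).trans_lt (lt_of_le_of_lt ?_ hN)
  have : N ≤ s.2 := hs.2
  gcongr

end TRO

end DeltaMorita

namespace DeltaMorita

open OperatorSpace Filter Topology

/-! ### The action of left multipliers on operator modules -/

section Multipliers

variable {H₁ : Type w₁} [NormedAddCommGroup H₁] [InnerProductSpace ℂ H₁] [CompleteSpace H₁]
variable {H : Type v} [NormedAddCommGroup H] [InnerProductSpace ℂ H] [CompleteSpace H]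
variable {A : NonUnitalSubalgebra ℂ (H₁ →L[ℂ] H₁)} {C : NonUnitalStarSubalgebra ℂ (H₁ →L[ℂ] H₁)}

open ContinuousLinearMap (adjoint)

/-- A C⋆-algebra of operators is a ternary ring of operators. -/
theorem isTRO_toSubmodule (C : NonUnitalStarSubalgebra ℂ (H₁ →L[ℂ] H₁)) : IsTRO C.toSubmodule := by
  intro l hl m hm n hn
  have hm' : star m ∈ C := star_mem (show m ∈ C from hm)
  exact C.mul_mem hl (C.mul_mem hm' hn)

/-- The C⋆-algebra of a `Δ`-pair contains a contractive left approximate unit of the operator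
algebra, since it is itself a ternary ring of operators. -/
theorem IsDeltaPair.exists_approxUnit (hAC : IsDeltaPair A C) :
    ∃ l : Filter {c : A // ‖c‖ ≤ 1}, l.NeBot ∧
      ∀ a : A, Tendsto (fun c : {c : A // ‖c‖ ≤ 1} => (c : A) * a) l (𝓝 a) := by
  obtain ⟨l, hl, h⟩ := (isTRO_toSubmodule C).exists_filter
  have hmem : ∀ r : ContractiveRow C.toSubmodule, r.gram ∈ A := by
    intro r
    refine hAC.le _ ?_
    change ∑ i, (r.entry i : H₁ →L[ℂ] H₁) * star (r.entry i : H₁ →L[ℂ] H₁) ∈ C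
    refine sum_mem fun i _ => mul_mem (r.entry i).2 ?_
    exact (star_mem (show (r.entry i : H₁ →L[ℂ] H₁) ∈ C from (r.entry i).2) :
      star (r.entry i : H₁ →L[ℂ] H₁) ∈ C)
  let f : ContractiveRow C.toSubmodule → {c : A // ‖c‖ ≤ 1} :=
    fun r => ⟨⟨r.gram, hmem r⟩, r.norm_gram_le⟩
  refine ⟨map f l, inferInstance, fun a => ?_⟩
  rw [tendsto_map'_iff, tendsto_subtype_rng]
  have ha : (a : H₁ →L[ℂ] H₁) ∈ closure (Submodule.span ℂ
      {x | ∃ c ∈ C, ∃ a ∈ A, x = c ∘L a} : Set (H₁ →L[ℂ] H₁)) := by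
    have := a.2
    rw [← SetLike.mem_coe, hAC.eq_mul_left] at this
    exact this
  refine tendsto_of_mem_closure_span (C := 1)
    (T := fun r : ContractiveRow C.toSubmodule => LinearMap.mulLeft ℂ r.gram)
    (S := LinearMap.id) (fun r x => ?_) (fun x => by simp) ?_ ha
  · exact (norm_mul_le _ _).trans (mul_le_mul_of_nonneg_right r.norm_gram_le (norm_nonneg _))
  · rintro _ ⟨c, hc, b, -, rfl⟩
    have hb : Continuous fun T : H₁ →L[ℂ] H₁ => T ∘L b := continuous_id.clm_comp continuous_const
    exact (hb.tendsto c).comp (h c hc)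

variable {α : RepHom A H}

theorem CompletelyIsometric.norm_map (hα : CompletelyIsometric α) (a : A) : ‖α a‖ = ‖a‖ := by
  have h := hα (Matrix.of fun _ _ : Unit => a)
  have e1 : (Matrix.of fun _ _ : Unit => a).map α = Matrix.of fun _ _ : Unit => α a := rfl
  have e2 : (Matrix.of fun _ _ : Unit => a).map (fun a : A => (a : H₁ →L[ℂ] H₁))
      = Matrix.of fun _ _ : Unit => (a : H₁ →L[ℂ] H₁) := rfl
  rw [e1, e2, matNorm_unit, matNorm_unit] at h
  exact h

theorem CompletelyIsometric.isometry (hα : CompletelyIsometric α) : Isometry α :=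
  AddMonoidHomClass.isometry_of_norm α hα.norm_map

theorem CompletelyIsometric.injective (hα : CompletelyIsometric α) : Function.Injective α :=
  hα.isometry.injective

/-- Tendsto in `A` may be checked after applying a complete isometry. -/
theorem CompletelyIsometric.tendsto_iff (hα : CompletelyIsometric α) {σ : Type*} {l : Filter σ}
    {f : σ → A} {a : A} : Tendsto f l (𝓝 a) ↔ Tendsto (fun i => α (f i)) l (𝓝 (α a)) :=
  hα.isometry.isEmbedding.tendsto_nhds_iff

variable (α) in
/-- The operators `T` on `H` with `T α(A) ⊆ α(A)`. -/
def leftMult : Subalgebra ℂ (H →L[ℂ] H) where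
  carrier := {T | ∀ a, ∃ a', α a' = T ∘L α a}
  mul_mem' {S T} hS hT a := by
    obtain ⟨b, hb⟩ := hT a
    obtain ⟨c, hc⟩ := hS b
    exact ⟨c, by rw [hc, hb]; rfl⟩
  add_mem' {S T} hS hT a := by
    obtain ⟨b, hb⟩ := hT a
    obtain ⟨c, hc⟩ := hS a
    exact ⟨c + b, by rw [map_add, hc, hb, ContinuousLinearMap.add_comp]⟩
  algebraMap_mem' z a := ⟨z • a, by
    rw [map_smul, Algebra.algebraMap_eq_smul_one, ContinuousLinearMap.smul_comp]; rfl⟩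

theorem map_mem_leftMult (a : A) : α a ∈ leftMult α := fun b => ⟨a * b, map_mul α a b⟩

variable (U : OMod.{u} A)

theorem OMod.norm_act_le (a : A) (x : U.carrier) : ‖U.act a x‖ ≤ ‖a‖ * ‖x‖ := by
  have h := U.mnorm_act_le (Matrix.of fun _ _ : Unit => a) (Matrix.of fun _ _ : Unit => x)
  have e1 : (Matrix.of fun i j : Unit => ∑ k : Unit, U.act ((Matrix.of fun _ _ : Unit => a) i k)
      ((Matrix.of fun _ _ : Unit => x) k j)) = Matrix.of fun _ _ : Unit => U.act a x := by
    ext; simp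
  have e2 : (Matrix.of fun _ _ : Unit => a).map (fun a : A => (a : H₁ →L[ℂ] H₁))
      = Matrix.of fun _ _ : Unit => (a : H₁ →L[ℂ] H₁) := rfl
  rw [e1, e2, matNorm_unit, mnorm_unit, mnorm_unit] at h
  exact h

/-- The bounded operator by which an element of `A` acts. -/
def OMod.actL (a : A) : U.carrier →L[ℂ] U.carrier :=
  (U.act a).mkContinuous ‖a‖ (U.norm_act_le a)

@[simp] theorem OMod.actL_apply (a : A) (x : U.carrier) : U.actL a x = U.act a x := rfl

theorem OMod.tendsto_act {σ : Type*} {l : Filter σ} {f : σ → A} {a : A} (h : Tendsto f l (𝓝 a))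
    (x : U.carrier) : Tendsto (fun i => U.act (f i) x) l (𝓝 (U.act a x)) := by
  let T : A →L[ℂ] U.carrier := (U.act.flip x).mkContinuous ‖x‖ fun a => by
    rw [mul_comm]; exact U.norm_act_le a x
  exact (T.continuous.tendsto a).comp h

theorem OMod.tendsto_approxUnit {l : Filter {c : A // ‖c‖ ≤ 1}}
    (hl : ∀ a : A, Tendsto (fun c : {c : A // ‖c‖ ≤ 1} => (c : A) * a) l (𝓝 a))
    (x : U.carrier) : Tendsto (fun c : {c : A // ‖c‖ ≤ 1} => U.act c x) l (𝓝 x) := by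
  refine tendsto_of_mem_closure_span (C := 1)
    (T := fun c : {c : A // ‖c‖ ≤ 1} => U.act c) (S := LinearMap.id) (fun c x => ?_)
    (fun x => by simp) ?_ (U.essential x)
  · exact (U.norm_act_le _ _).trans (mul_le_mul_of_nonneg_right c.2 (norm_nonneg _))
  · rintro _ ⟨a, x, rfl⟩
    simp only [← U.act_mul]
    exact U.tendsto_act (hl a) x

variable (α) in
/-- The operator by which a left multiplier `T` acts on a module: `T (a x) = (T a) x`. It is set
to zero when there is no bounded operator with this property. -/
def multAct (T : H →L[ℂ] H) : U.carrier →L[ℂ] U.carrier :=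
  open Classical in
  if h : ∃ S : U.carrier →L[ℂ] U.carrier,
      ∀ (a a' : A) (x : U.carrier), α a' = T ∘L α a → S (U.act a x) = U.act a' x
  then h.choose else 0

theorem OMod.clm_ext {V : Type*} [NormedAddCommGroup V] [NormedSpace ℂ V]
    {S T : U.carrier →L[ℂ] V} (h : ∀ (a : A) (x : U.carrier), S (U.act a x) = T (U.act a x)) :
    S = T := by
  refine clm_ext_of_dense_span U.essential ?_
  rintro _ ⟨a, x, rfl⟩
  exact h a x

section Properties

variable (hAC : IsDeltaPair A C) (hα : CompletelyIsometric α)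
include hAC hα

/-- Multipliers act boundedly: with an approximate unit `c` of `A`, the vector
`∑ (T aᵢ) xᵢ` is the limit of `(T c) ∑ aᵢ xᵢ`, and `‖T c‖ ≤ ‖T‖`. -/
theorem exists_multAct {T : H →L[ℂ] H} (hT : T ∈ leftMult α) :
    ∃ S : U.carrier →L[ℂ] U.carrier,
      ∀ (a a' : A) (x : U.carrier), α a' = T ∘L α a → S (U.act a x) = U.act a' x := by
  obtain ⟨l, hl, hlim⟩ := hAC.exists_approxUnit
  choose m hm using hT
  have hd : Dense (Submodule.span ℂ (Set.range fun q : A × U.carrier => U.act q.1 q.2) :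
      Set U.carrier) := by
    have : Set.range (fun q : A × U.carrier => U.act q.1 q.2)
        = {y | ∃ (a : A) (x : U.carrier), y = U.act a x} := by
      ext y
      constructor
      · rintro ⟨q, rfl⟩; exact ⟨_, _, rfl⟩
      · rintro ⟨a, x, rfl⟩; exact ⟨(a, x), rfl⟩
    rw [this]
    exact U.essential
  have hb : ∀ z : A × U.carrier →₀ ℂ, ‖z.sum fun q w => w • U.act (m q.1) q.2‖ ≤
      ‖T‖ * ‖z.sum fun q w => w • U.act q.1 q.2‖ := by
    intro z
    have htend : Tendsto (fun c : {c : A // ‖c‖ ≤ 1} =>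
        U.act (m c) (z.sum fun q w => w • U.act q.1 q.2)) l
        (𝓝 (z.sum fun q w => w • U.act (m q.1) q.2)) := by
      simp only [Finsupp.sum, map_sum, map_smul, ← U.act_mul]
      refine tendsto_finsetSum _ fun q _ => Tendsto.const_smul ?_ _
      refine U.tendsto_act ?_ _
      rw [hα.tendsto_iff]
      have e : ∀ c : {c : A // ‖c‖ ≤ 1}, α (m c * q.1) = T ∘L α (c * q.1) := fun c => by
        rw [map_mul, hm, map_mul]; rfl
      simp only [e, hm]
      have hcont : Continuous fun S : H →L[ℂ] H => T ∘L S := continuous_const.clm_comp continuous_id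
      exact (hcont.tendsto _).comp (hα.tendsto_iff.1 (hlim q.1))
    refine le_of_tendsto htend.norm (Eventually.of_forall fun c => ?_)
    refine (U.norm_act_le _ _).trans (mul_le_mul_of_nonneg_right ?_ (norm_nonneg _))
    rw [← hα.norm_map, hm]
    refine (ContinuousLinearMap.opNorm_comp_le _ _).trans
      (mul_le_of_le_one_right (norm_nonneg _) ?_)
    rw [hα.norm_map]
    exact c.2
  obtain ⟨S, hS, -⟩ := exists_clm_of_dense_span _ _ ‖T‖ hd hb
  refine ⟨S, fun a a' x h => ?_⟩
  rw [← hm] at h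
  rw [hα.injective h]
  exact hS (a, x)

theorem multAct_act {T : H →L[ℂ] H} (hT : T ∈ leftMult α) {a a' : A} (h : α a' = T ∘L α a)
    (x : U.carrier) : multAct α U T (U.act a x) = U.act a' x := by
  have hex := exists_multAct U hAC hα hT
  rw [multAct, dif_pos hex]
  exact hex.choose_spec a a' x h

theorem eq_multAct {T : H →L[ℂ] H} (hT : T ∈ leftMult α) {S : U.carrier →L[ℂ] U.carrier}
    (h : ∀ (a a' : A) (x : U.carrier), α a' = T ∘L α a → S (U.act a x) = U.act a' x) :
    S = multAct α U T := by
  refine U.clm_ext fun a x => ?_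
  obtain ⟨a', ha'⟩ := hT a
  rw [h a a' x ha', multAct_act U hAC hα hT ha']

theorem multAct_one : multAct α U 1 = ContinuousLinearMap.id ℂ U.carrier := by
  refine (eq_multAct U hAC hα (one_mem _) fun a a' x h => ?_).symm
  have : a' = a := hα.injective h
  rw [this]; rfl

theorem multAct_mul {S T : H →L[ℂ] H} (hS : S ∈ leftMult α) (hT : T ∈ leftMult α)
    (x : U.carrier) : multAct α U (S ∘L T) x = multAct α U S (multAct α U T x) := by
  have : multAct α U S ∘L multAct α U T = multAct α U (S ∘L T) := by
    refine eq_multAct U hAC hα (mul_mem hS hT) fun a a' x h => ?_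
    obtain ⟨b, hb⟩ := hT a
    rw [ContinuousLinearMap.comp_apply, multAct_act U hAC hα hT hb]
    refine multAct_act U hAC hα hS ?_ x
    rw [h, hb]; rfl
  rw [← this]; rfl

theorem multAct_add {S T : H →L[ℂ] H} (hS : S ∈ leftMult α) (hT : T ∈ leftMult α) :
    multAct α U (S + T) = multAct α U S + multAct α U T := by
  refine (eq_multAct U hAC hα (add_mem hS hT) fun a a' x h => ?_).symm
  obtain ⟨b, hb⟩ := hT a
  obtain ⟨c, hc⟩ := hS a
  have : a' = c + b := hα.injective (by rw [h, map_add, hb, hc, ContinuousLinearMap.add_comp])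
  rw [add_apply, multAct_act U hAC hα hT hb, multAct_act U hAC hα hS hc, this]
  simp

theorem multAct_smul (z : ℂ) {T : H →L[ℂ] H} (hT : T ∈ leftMult α) :
    multAct α U (z • T) = z • multAct α U T := by
  refine (eq_multAct U hAC hα ((leftMult α).smul_mem hT z) fun a a' x h => ?_).symm
  obtain ⟨b, hb⟩ := hT a
  have : a' = z • b := hα.injective (by rw [h, map_smul, hb, ContinuousLinearMap.smul_comp])
  rw [smul_apply, multAct_act U hAC hα hT hb, this]
  simp

theorem multAct_map (a : A) : multAct α U (α a) = U.actL a := by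
  refine (eq_multAct U hAC hα (map_mem_leftMult a) fun b b' x h => ?_).symm
  have : b' = a * b := hα.injective (by rw [h, map_mul]; rfl)
  rw [this, U.act_mul]; rfl

/-- The action of left multipliers is completely contractive. -/
theorem mnorm_multAct_le {ι κ μ : Type} [Fintype ι] [Fintype κ] [Fintype μ]
    (T : Matrix ι κ (H →L[ℂ] H)) (hT : ∀ i k, T i k ∈ leftMult α) (y : Matrix κ μ U.carrier) :
    mnorm (Matrix.of fun i j => ∑ k, multAct α U (T i k) (y k j)) ≤ matNorm T * mnorm y := by
  obtain ⟨l, hl, hlim⟩ := hAC.exists_approxUnit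
  choose m hm using hT
  have htend : Tendsto (fun c : {c : A // ‖c‖ ≤ 1} =>
      mnorm (Matrix.of fun i j => ∑ k, U.act (m i k c) (y k j))) l
      (𝓝 (mnorm (Matrix.of fun i j => ∑ k, multAct α U (T i k) (y k j)))) := by
    refine tendsto_mnorm fun i j => ?_
    simp only [Matrix.of_apply]
    refine tendsto_finsetSum _ fun k _ => ?_
    have e : ∀ c : {c : A // ‖c‖ ≤ 1},
        U.act (m i k c) (y k j) = multAct α U (T i k) (U.act c (y k j)) := fun c =>
      (multAct_act U hAC hα (fun a => ⟨_, hm i k a⟩) (hm i k c) _).symm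
    simp only [e]
    exact ((multAct α U (T i k)).continuous.tendsto _).comp (U.tendsto_approxUnit hlim _)
  refine le_of_tendsto htend (Eventually.of_forall fun c => ?_)
  refine (U.mnorm_act_le (Matrix.of fun i k => m i k c) y).trans
    (mul_le_mul_of_nonneg_right ?_ (mnorm_nonneg _))
  rw [← hα]
  refine matNorm_le (matNorm_nonneg _) fun z => ?_
  have e : ∀ i, ∑ j, ((Matrix.of fun i k => m i k c).map α) i j (z j)
      = ∑ j, T i j (α c (z j)) := fun i => by simp [hm]
  simp only [e]
  refine (sum_norm_sq_le T fun j => α c (z j)).trans ?_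
  gcongr with j
  refine ((α c).le_opNorm _).trans (mul_le_of_le_one_left (norm_nonneg _) ?_)
  rw [hα.norm_map]
  exact c.2

theorem norm_multAct_le {T : H →L[ℂ] H} (hT : T ∈ leftMult α) (x : U.carrier) :
    ‖multAct α U T x‖ ≤ ‖T‖ * ‖x‖ := by
  have h := mnorm_multAct_le U hAC hα (Matrix.of fun _ _ : Unit => T) (fun _ _ => hT)
    (Matrix.of fun _ _ : Unit => x)
  have e1 : (Matrix.of fun i j : Unit => ∑ k : Unit,
      multAct α U ((Matrix.of fun _ _ : Unit => T) i k) ((Matrix.of fun _ _ : Unit => x) k j))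
      = Matrix.of fun _ _ : Unit => multAct α U T x := by
    ext; simp
  rwa [e1, matNorm_unit, mnorm_unit, mnorm_unit] at h

/-- Module maps commute with the action of left multipliers. -/
theorem map_multAct {V : OMod.{u} A} (f : U.carrier →L[ℂ] V.carrier)
    (hf : ∀ (a : A) (x : U.carrier), f (U.act a x) = V.act a (f x)) {T : H →L[ℂ] H}
    (hT : T ∈ leftMult α) (x : U.carrier) : f (multAct α U T x) = multAct α V T (f x) := by
  have : f ∘L multAct α U T = multAct α V T ∘L f := by
    refine U.clm_ext fun a x => ?_
    obtain ⟨b, hb⟩ := hT a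
    rw [ContinuousLinearMap.comp_apply, ContinuousLinearMap.comp_apply,
      multAct_act U hAC hα hT hb, hf, hf, multAct_act V hAC hα hT hb]
  exact DFunLike.congr_fun this x

end Properties

end Multipliers

end DeltaMorita

namespace DeltaMorita

open OperatorSpace Filter Topology
open ContinuousLinearMap (adjoint)

/-! ### The algebra of a `Δ`-equivalence -/

theorem mem_of_mem_closure_span {E F : Type*} [NormedAddCommGroup E] [NormedSpace ℂ E]
    [NormedAddCommGroup F] [NormedSpace ℂ F] {D : Set E} {R : Submodule ℂ F}
    (hR : IsClosed (R : Set F)) (f : E →L[ℂ] F) (h : ∀ d ∈ D, f d ∈ R) {x : E}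
    (hx : x ∈ closure (Submodule.span ℂ D : Set E)) : f x ∈ R := by
  have h1 : Submodule.span ℂ D ≤ R.comap (f : E →ₗ[ℂ] F) := Submodule.span_le.2 h
  have h2 : closure (Submodule.span ℂ D : Set E) ⊆ f ⁻¹' R :=
    closure_minimal h1 (hR.preimage f.continuous)
  exact h2 hx

section Context

variable {H₁ : Type w₁} [NormedAddCommGroup H₁] [InnerProductSpace ℂ H₁] [CompleteSpace H₁]
variable {H₂ : Type w₂} [NormedAddCommGroup H₂] [InnerProductSpace ℂ H₂] [CompleteSpace H₂]
variable {H : Type u} [NormedAddCommGroup H] [InnerProductSpace ℂ H] [CompleteSpace H]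
variable {K : Type u} [NormedAddCommGroup K] [InnerProductSpace ℂ K] [CompleteSpace K]
variable {A : NonUnitalSubalgebra ℂ (H₁ →L[ℂ] H₁)} {C : NonUnitalStarSubalgebra ℂ (H₁ →L[ℂ] H₁)}
variable {B : NonUnitalSubalgebra ℂ (H₂ →L[ℂ] H₂)} {D : NonUnitalStarSubalgebra ℂ (H₂ →L[ℂ] H₂)}

/-- Two `Δ`-pairs together with a `Δ`-equivalence between them. -/
structure DeltaContext (C : NonUnitalStarSubalgebra ℂ (H₁ →L[ℂ] H₁))
    (D : NonUnitalStarSubalgebra ℂ (H₂ →L[ℂ] H₂))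
    (α : RepHom A H) (β : RepHom B K) (M : Submodule ℂ (H →L[ℂ] K)) : Prop where
  left : IsDeltaPair A C
  right : IsDeltaPair B D
  equiv : ImplementsDeltaEquivalence C D α β M

/-- The space `M⋆` of adjoints of the operators in `M`. -/
def adjointSpace (M : Submodule ℂ (H →L[ℂ] K)) : Submodule ℂ (K →L[ℂ] H) where
  carrier := {x | adjoint x ∈ M}
  add_mem' {x y} hx hy := by
    change adjoint (x + y) ∈ M
    rw [map_add]; exact M.add_mem hx hy
  zero_mem' := by
    change adjoint (0 : K →L[ℂ] H) ∈ M
    rw [map_zero]; exact M.zero_mem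
  smul_mem' c x hx := by
    change adjoint (c • x) ∈ M
    rw [map_smulₛₗ]; exact M.smul_mem _ hx

theorem mem_adjointSpace {M : Submodule ℂ (H →L[ℂ] K)} {x : K →L[ℂ] H} :
    x ∈ adjointSpace M ↔ adjoint x ∈ M := Iff.rfl

theorem adjoint_mem_adjointSpace {M : Submodule ℂ (H →L[ℂ] K)} {m : H →L[ℂ] K} (hm : m ∈ M) :
    adjoint m ∈ adjointSpace M := by
  rw [mem_adjointSpace, ContinuousLinearMap.adjoint_adjoint]; exact hm

theorem TROEquivalentVia.symm {M : Submodule ℂ (H →L[ℂ] K)} {P : Set (H →L[ℂ] H)}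
    {Q : Set (K →L[ℂ] K)} (h : TROEquivalentVia M P Q) : TROEquivalentVia (adjointSpace M) Q P := by
  obtain ⟨h1, h2⟩ := h
  constructor
  · convert h2 using 2
    ext y
    constructor
    · rintro ⟨m, hm, p, hp, n, hn, rfl⟩
      exact ⟨_, hm, p, hp, _, hn, by rw [ContinuousLinearMap.adjoint_adjoint]⟩
    · rintro ⟨m, hm, p, hp, n, hn, rfl⟩
      exact ⟨_, adjoint_mem_adjointSpace hm, p, hp, _, adjoint_mem_adjointSpace hn,
        by rw [ContinuousLinearMap.adjoint_adjoint]⟩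
  · convert h1 using 2
    ext y
    constructor
    · rintro ⟨m, hm, p, hp, n, hn, rfl⟩
      exact ⟨_, hm, p, hp, _, hn, by rw [ContinuousLinearMap.adjoint_adjoint]⟩
    · rintro ⟨m, hm, p, hp, n, hn, rfl⟩
      exact ⟨_, adjoint_mem_adjointSpace hm, p, hp, _, adjoint_mem_adjointSpace hn,
        by rw [ContinuousLinearMap.adjoint_adjoint]⟩

variable {α : RepHom A H} {β : RepHom B K} {M : Submodule ℂ (H →L[ℂ] K)}

/-- A `Δ`-equivalence implemented by `M` is implemented by `M⋆` in the other direction. -/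
theorem DeltaContext.symm (ctx : DeltaContext C D α β M) :
    DeltaContext D C β α (adjointSpace M) where
  left := ctx.right
  right := ctx.left
  equiv :=
    { isometric_left := ctx.equiv.isometric_right
      isometric_right := ctx.equiv.isometric_left
      isTRO := fun l hl m hm n hn => by
        rw [mem_adjointSpace]
        have := ctx.equiv.isTRO _ hn _ hm _ hl
        simpa [ContinuousLinearMap.adjoint_comp, ContinuousLinearMap.comp_assoc] using this
      algebras := ctx.equiv.algebras.symm
      diagonals := ctx.equiv.diagonals.symm }

variable (α) in
/-- The range of a homomorphism, as a subspace. -/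
def rangeSubmodule : Submodule ℂ (H →L[ℂ] H) := LinearMap.range (α : A →ₗ[ℂ] (H →L[ℂ] H))

namespace DeltaContext

variable (ctx : DeltaContext C D α β M)
include ctx

theorem isoLeft : CompletelyIsometric α := ctx.equiv.isometric_left

theorem isoRight : CompletelyIsometric β := ctx.equiv.isometric_right

theorem isClosed_range : IsClosed (rangeSubmodule α : Set (H →L[ℂ] H)) := by
  have : (rangeSubmodule α : Set (H →L[ℂ] H)) = Set.range α := rfl
  rw [this, ctx.equiv.algebras.1]
  exact isClosed_closure

theorem map_mem_closure (a : A) : α a ∈ closure (Submodule.span ℂ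
    {x | ∃ m ∈ M, ∃ b : B, ∃ n ∈ M, x = adjoint m ∘L β b ∘L n} : Set (H →L[ℂ] H)) := by
  have h : α a ∈ Set.range α := ⟨a, rfl⟩
  rw [ctx.equiv.algebras.1] at h
  refine closure_mono (Submodule.span_mono ?_) h
  rintro _ ⟨m, hm, _, ⟨b, rfl⟩, n, hn, rfl⟩
  exact ⟨m, hm, b, n, hn, rfl⟩

theorem map_mem_closure' (b : B) : β b ∈ closure (Submodule.span ℂ
    {x | ∃ m ∈ M, ∃ a : A, ∃ n ∈ M, x = m ∘L α a ∘L adjoint n} : Set (K →L[ℂ] K)) := by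
  have h : β b ∈ Set.range β := ⟨b, rfl⟩
  rw [ctx.equiv.algebras.2] at h
  refine closure_mono (Submodule.span_mono ?_) h
  rintro _ ⟨m, hm, _, ⟨a, rfl⟩, n, hn, rfl⟩
  exact ⟨m, hm, a, n, hn, rfl⟩

theorem exists_left (b : B) {m n : H →L[ℂ] K} (hm : m ∈ M) (hn : n ∈ M) :
    ∃ a, α a = adjoint m ∘L β b ∘L n := by
  have : adjoint m ∘L β b ∘L n ∈ Set.range α := by
    rw [ctx.equiv.algebras.1]
    exact subset_closure (Submodule.subset_span ⟨m, hm, _, ⟨b, rfl⟩, n, hn, rfl⟩)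
  exact this

theorem exists_right (a : A) {m n : H →L[ℂ] K} (hm : m ∈ M) (hn : n ∈ M) :
    ∃ b, β b = m ∘L α a ∘L adjoint n := by
  have : m ∘L α a ∘L adjoint n ∈ Set.range β := by
    rw [ctx.equiv.algebras.2]
    exact subset_closure (Submodule.subset_span ⟨m, hm, _, ⟨a, rfl⟩, n, hn, rfl⟩)
  exact this

/-- `B` absorbs the products `m n⋆` from the left. -/
theorem exists_mul_right (b : B) {m n : H →L[ℂ] K} (hm : m ∈ M) (hn : n ∈ M) :
    ∃ b', β b' = m ∘L adjoint n ∘L β b := by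
  set f : (K →L[ℂ] K) →L[ℂ] (K →L[ℂ] K) := ContinuousLinearMap.compL ℂ K K K (m ∘L adjoint n)
  have hf : ∀ T, f T = m ∘L adjoint n ∘L T := fun T => rfl
  clear_value f
  have key : f (β b) ∈ rangeSubmodule β := by
    refine mem_of_mem_closure_span ctx.symm.isClosed_range f ?_ (ctx.map_mem_closure' b)
    rintro _ ⟨m₁, hm₁, a, n₁, hn₁, rfl⟩
    obtain ⟨b', hb'⟩ := ctx.exists_right a (ctx.equiv.isTRO m hm n hn m₁ hm₁) hn₁
    exact ⟨b', by rw [hf]; exact hb'⟩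
  obtain ⟨b', hb'⟩ := key
  exact ⟨b', hb'.trans (hf _)⟩

theorem comp_mem_leftMult {m n : H →L[ℂ] K} (hm : m ∈ M) (hn : n ∈ M) :
    adjoint m ∘L n ∈ leftMult α := by
  intro a
  have := ctx.symm.exists_mul_right a (adjoint_mem_adjointSpace hm) (adjoint_mem_adjointSpace hn)
  rwa [ContinuousLinearMap.adjoint_adjoint] at this

theorem isClosed_leftMult : IsClosed ((Subalgebra.toSubmodule (leftMult α) :
    Submodule ℂ (H →L[ℂ] H)) : Set (H →L[ℂ] H)) := by
  have : ((Subalgebra.toSubmodule (leftMult α) : Submodule ℂ (H →L[ℂ] H)) : Set (H →L[ℂ] H))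
      = ⋂ a : A, (fun T : H →L[ℂ] H => T ∘L α a) ⁻¹' (rangeSubmodule α) := by
    ext T
    rw [Set.mem_iInter]
    rfl
  rw [this]
  exact isClosed_iInter fun a => ctx.isClosed_range.preimage
    (continuous_id.clm_comp continuous_const)

/-- The C⋆-algebra `E` acts on `A` from the left, hence on every operator module over `A`. -/
theorem rightAlgebra_le_leftMult {e : H →L[ℂ] H} (he : e ∈ rightAlgebra M) : e ∈ leftMult α := by
  refine mem_of_mem_closure_span ctx.isClosed_leftMult (ContinuousLinearMap.id ℂ _) ?_ he
  rintro _ ⟨m, hm, n, hn, rfl⟩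
  exact ctx.comp_mem_leftMult hm hn

theorem comp_mem_rightAlgebra {m n : H →L[ℂ] K} (hm : m ∈ M) (hn : n ∈ M) :
    adjoint m ∘L n ∈ rightAlgebra M :=
  subset_closure (Submodule.subset_span ⟨m, hm, n, hn, rfl⟩)

/-- `A` absorbs the products `n⋆ l` from the right. -/
theorem exists_mul_left (a : A) {n l : H →L[ℂ] K} (hn : n ∈ M) (hl : l ∈ M) :
    ∃ a', α a' = α a ∘L adjoint n ∘L l := by
  set f : (H →L[ℂ] H) →L[ℂ] (H →L[ℂ] H) :=
    (ContinuousLinearMap.compL ℂ H H H).flip (adjoint n ∘L l)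
  have hf : ∀ T, f T = T ∘L adjoint n ∘L l := fun T => rfl
  clear_value f
  have key : f (α a) ∈ rangeSubmodule α := by
    refine mem_of_mem_closure_span ctx.isClosed_range f ?_ (ctx.map_mem_closure a)
    rintro _ ⟨m₁, hm₁, b, n₁, hn₁, rfl⟩
    obtain ⟨a', ha'⟩ := ctx.exists_left b hm₁ (ctx.equiv.isTRO n₁ hn₁ n hn l hl)
    exact ⟨a', by rw [hf]; exact ha'⟩
  obtain ⟨a', ha'⟩ := key
  exact ⟨a', ha'.trans (hf _)⟩

/-- The operators `∑ mᵢ mᵢ⋆` of the approximate unit also act as an approximate unit on `B`. -/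
theorem tendsto_gram_comp {l : Filter (ContractiveRow M)}
    (hl : ∀ m ∈ M, Tendsto (fun r : ContractiveRow M => r.gram ∘L m) l (𝓝 m)) (b : B) :
    Tendsto (fun r : ContractiveRow M => r.gram ∘L β b) l (𝓝 (β b)) := by
  refine tendsto_of_mem_closure_span (C := 1)
    (T := fun r : ContractiveRow M => LinearMap.mulLeft ℂ r.gram)
    (S := LinearMap.id) (fun r x => ?_) (fun x => by simp) ?_ (ctx.map_mem_closure' b)
  · exact (norm_mul_le _ _).trans (mul_le_mul_of_nonneg_right r.norm_gram_le (norm_nonneg _))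
  · rintro _ ⟨m, hm, a, n, hn, rfl⟩
    have hc : Continuous fun T : H →L[ℂ] K => T ∘L (α a ∘L adjoint n) :=
      continuous_id.clm_comp continuous_const
    have h := (hc.tendsto m).comp (hl m hm)
    refine h.congr fun r => ?_
    ext y
    simp

theorem tendsto_comp_gram {l : Filter (ContractiveRow M)}
    (hl : ∀ m ∈ M, Tendsto (fun r : ContractiveRow M => r.gram ∘L m) l (𝓝 m)) (b : B) :
    Tendsto (fun r : ContractiveRow M => β b ∘L r.gram) l (𝓝 (β b)) := by
  refine tendsto_of_mem_closure_span (C := 1)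
    (T := fun r : ContractiveRow M => LinearMap.mulRight ℂ r.gram)
    (S := LinearMap.id) (fun r x => ?_) (fun x => by simp) ?_ (ctx.map_mem_closure' b)
  · rw [one_mul]
    exact (norm_mul_le _ _).trans (mul_le_of_le_one_right (norm_nonneg _) r.norm_gram_le)
  · rintro _ ⟨m, hm, a, n, hn, rfl⟩
    have hc : Continuous fun T : H →L[ℂ] K => (m ∘L α a) ∘L adjoint T :=
      continuous_const.clm_comp (adjoint : (H →L[ℂ] K) ≃ₗᵢ⋆[ℂ] (K →L[ℂ] H)).continuous
    have := (hc.tendsto n).comp (hl n hn)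
    refine this.congr fun r => ?_
    simp only [Function.comp_apply, ContinuousLinearMap.adjoint_comp, r.adjoint_gram]
    rfl

end DeltaContext

end Context

end DeltaMorita

namespace DeltaMorita

open OperatorSpace Filter Topology
open ContinuousLinearMap (adjoint)

/-! ### The structure of a balanced Haagerup tensor product -/

section Frames

variable {H₁ : Type w₁} [NormedAddCommGroup H₁] [InnerProductSpace ℂ H₁] [CompleteSpace H₁]
variable {H₂ : Type w₂} [NormedAddCommGroup H₂] [InnerProductSpace ℂ H₂] [CompleteSpace H₂]
variable {H : Type u} [NormedAddCommGroup H] [InnerProductSpace ℂ H] [CompleteSpace H]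
variable {K : Type u} [NormedAddCommGroup K] [InnerProductSpace ℂ K] [CompleteSpace K]
variable {A : NonUnitalSubalgebra ℂ (H₁ →L[ℂ] H₁)} {C : NonUnitalStarSubalgebra ℂ (H₁ →L[ℂ] H₁)}
variable {B : NonUnitalSubalgebra ℂ (H₂ →L[ℂ] H₂)} {D : NonUnitalStarSubalgebra ℂ (H₂ →L[ℂ] H₂)}
variable {α : RepHom A H} {β : RepHom B K} {M : Submodule ℂ (H →L[ℂ] K)}

/-- The structure carried by the balanced Haagerup tensor product `W` of `M` and `U`: creation
operators `L m : u ↦ m ⊗ u` and annihilation operators `V n : l ⊗ u ↦ (n⋆ l) u`, such that rows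
of creation operators and columns of annihilation operators over a contractive row are
completely contractive. -/
structure ModuleFrame (α : RepHom A H) (M : Submodule ℂ (H →L[ℂ] K)) (U : OMod.{u} A)
    (W : Type u) [NormedAddCommGroup W] [NormedSpace ℂ W] [OperatorSpace W] where
  L : M →ₗ[ℂ] (U.carrier →L[ℂ] W)
  V : M → W →L[ℂ] U.carrier
  V_L : ∀ (n l : M) (x : U.carrier), V n (L l x) =
    multAct α U (adjoint (n : H →L[ℂ] K) ∘L (l : H →L[ℂ] K)) x
  L_comp : ∀ (m n l k : M) (x : U.carrier),
    (k : H →L[ℂ] K) = (m : H →L[ℂ] K) ∘L adjoint (n : H →L[ℂ] K) ∘L (l : H →L[ℂ] K) →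
    L k x = L m (multAct α U (adjoint (n : H →L[ℂ] K) ∘L (l : H →L[ℂ] K)) x)
  norm_L_le : ∀ (m : M) (x : U.carrier), ‖L m x‖ ≤ ‖(m : H →L[ℂ] K)‖ * ‖x‖
  mnorm_L_le : ∀ (r : ContractiveRow M) {ι κ : Type} [Fintype ι] [Fintype κ]
    (y : Matrix (ι × Fin r.n) κ U.carrier),
    mnorm (Matrix.of fun i j => ∑ p, L (r.entry p) (y (i, p) j)) ≤ mnorm y
  mnorm_V_le : ∀ (r : ContractiveRow M) {ι κ : Type} [Fintype ι] [Fintype κ] (t : Matrix ι κ W),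
    mnorm (Matrix.of fun (ip : ι × Fin r.n) j => V (r.entry ip.2) (t ip.1 j)) ≤ mnorm t
  dense : Dense (Submodule.span ℂ {w | ∃ (l : M) (x : U.carrier), w = L l x} : Set W)

section Tensor

variable (ctx : DeltaContext C D α β M) (U : OMod.{u} A)
variable {W : Type u} [NormedAddCommGroup W] [NormedSpace ℂ W] [CompleteSpace W] [OperatorSpace W]
  {τ : M ⊗[ℂ] U.carrier →ₗ[ℂ] W}

theorem IsBalancedHaagerupTensor.norm_map (hτ : IsBalancedHaagerupTensor α M U W τ)
    (t : M ⊗[ℂ] U.carrier) :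
    ‖τ t‖ = haagerupNorm α M U (Matrix.of fun _ _ : Unit => t) := by
  rw [← hτ.mnorm_map, ← mnorm_unit]; rfl

theorem IsBalancedHaagerupTensor.map_eq_zero (hτ : IsBalancedHaagerupTensor α M U W τ)
    {t : M ⊗[ℂ] U.carrier} (ht : t ∈ balancedRelations α M U) : τ t = 0 := by
  rw [← norm_le_zero_iff, hτ.norm_map]
  -- modulo the relations `t` is the empty sum, which has factors of norm zero
  have h := haagerupNorm_le_of_factor α M U (Matrix.of fun _ _ : Unit => t)
    (0 : Matrix Unit Empty M) (0 : Matrix Empty Unit U.carrier)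
    (fun i j => by convert ht using 1; exact sub_zero t)
  refine h.trans (le_of_eq ?_)
  rw [show mnorm (0 : Matrix Empty Unit U.carrier) = 0 from (matrixSeminorm U.carrier).zero,
    mul_zero]

theorem IsBalancedHaagerupTensor.mnorm_odot_le (hτ : IsBalancedHaagerupTensor α M U W τ)
    {ι κ π : Type} [Fintype ι] [Fintype κ] [Fintype π] (x : Matrix ι π M)
    (y : Matrix π κ U.carrier) : mnorm ((odot x y).map τ) ≤ rowNorm x * mnorm y := by
  rw [hτ.mnorm_map]
  exact haagerupNorm_le_of_factor α M U _ x y fun i j => by simp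

theorem rowNorm_unit (m : M) : rowNorm (Matrix.of fun _ _ : Unit => m) = ‖(m : H →L[ℂ] K)‖ :=
  matNorm_unit (m : H →L[ℂ] K)

theorem IsBalancedHaagerupTensor.norm_tmul_le (hτ : IsBalancedHaagerupTensor α M U W τ)
    (m : M) (x : U.carrier) : ‖τ (m ⊗ₜ[ℂ] x)‖ ≤ ‖(m : H →L[ℂ] K)‖ * ‖x‖ := by
  have h := hτ.mnorm_odot_le U (Matrix.of fun _ _ : Unit => m) (Matrix.of fun _ _ : Unit => x)
  rw [rowNorm_unit, mnorm_unit] at h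
  have e : (odot (Matrix.of fun _ _ : Unit => m) (Matrix.of fun _ _ : Unit => x)).map τ () ()
      = τ (m ⊗ₜ[ℂ] x) := by
    rw [Matrix.map_apply, odot_apply, Fintype.sum_unique]; rfl
  rw [← e]
  refine le_trans ?_ h
  exact norm_entry_le
    ((odot (Matrix.of fun _ _ : Unit => m) (Matrix.of fun _ _ : Unit => x)).map τ) () ()

/-- The creation operators `x ↦ m ⊗ x`. -/
def IsBalancedHaagerupTensor.creation (hτ : IsBalancedHaagerupTensor α M U W τ) :
    M →ₗ[ℂ] (U.carrier →L[ℂ] W) where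
  toFun m := (τ ∘ₗ TensorProduct.mk ℂ M U.carrier m).mkContinuous ‖(m : H →L[ℂ] K)‖
    (hτ.norm_tmul_le U m)
  map_add' m n := by
    refine ContinuousLinearMap.ext fun x => ?_
    change τ ((m + n) ⊗ₜ[ℂ] x) = τ (m ⊗ₜ[ℂ] x) + τ (n ⊗ₜ[ℂ] x)
    rw [TensorProduct.add_tmul, map_add]
  map_smul' c m := by
    refine ContinuousLinearMap.ext fun x => ?_
    change τ ((c • m) ⊗ₜ[ℂ] x) = c • τ (m ⊗ₜ[ℂ] x)
    rw [← TensorProduct.smul_tmul', map_smul]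

@[simp] theorem IsBalancedHaagerupTensor.creation_apply
    (hτ : IsBalancedHaagerupTensor α M U W τ) (m : M) (x : U.carrier) :
    hτ.creation U m x = τ (m ⊗ₜ[ℂ] x) := rfl

include ctx

/-- The algebraic annihilation operators `l ⊗ x ↦ (n⋆ l) x`. -/
def DeltaContext.annihilation (n : M) : M ⊗[ℂ] U.carrier →ₗ[ℂ] U.carrier :=
  TensorProduct.lift (LinearMap.mk₂ ℂ
    (fun (l : M) (x : U.carrier) =>
      multAct α U (adjoint (n : H →L[ℂ] K) ∘L (l : H →L[ℂ] K)) x)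
    (fun l l' x => by
      have h := multAct_add U ctx.left ctx.isoLeft (ctx.comp_mem_leftMult n.2 l.2)
        (ctx.comp_mem_leftMult n.2 l'.2)
      rw [Submodule.coe_add, ContinuousLinearMap.comp_add, h, add_apply])
    (fun c l x => by
      have h := multAct_smul U ctx.left ctx.isoLeft c (ctx.comp_mem_leftMult n.2 l.2)
      rw [Submodule.coe_smul, ContinuousLinearMap.comp_smul, h, smul_apply])
    (fun l x y => map_add _ _ _)
    (fun c l x => map_smul _ _ _))

@[simp] theorem DeltaContext.annihilation_tmul (n l : M) (x : U.carrier) :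
    ctx.annihilation U n (l ⊗ₜ[ℂ] x) =
      multAct α U (adjoint (n : H →L[ℂ] K) ∘L (l : H →L[ℂ] K)) x := rfl

/-- The annihilation operators respect the balancing relations. -/
theorem DeltaContext.annihilation_eq_zero (n : M) {t : M ⊗[ℂ] U.carrier}
    (ht : t ∈ balancedRelations α M U) : ctx.annihilation U n t = 0 := by
  have : balancedRelations α M U ≤ LinearMap.ker (ctx.annihilation U n) := by
    refine Submodule.span_le.2 ?_
    rintro _ ⟨m, m', e, a, a', x, he, hm', ha', rfl⟩
    have he' := ctx.rightAlgebra_le_leftMult he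
    have h1 : adjoint (n : H →L[ℂ] K) ∘L (m' : H →L[ℂ] K)
        = (adjoint (n : H →L[ℂ] K) ∘L (m : H →L[ℂ] K)) ∘L e := by rw [hm']; rfl
    have h2 := multAct_mul U ctx.left ctx.isoLeft (ctx.comp_mem_leftMult n.2 m.2) he' (U.act a x)
    rw [SetLike.mem_coe, LinearMap.mem_ker, map_sub, ctx.annihilation_tmul, ctx.annihilation_tmul,
      h1, h2, multAct_act U ctx.left ctx.isoLeft he' ha', sub_self]
  exact this ht

/-- Columns of annihilation operators are bounded for the Haagerup norm: on `x ⊙ y` they act by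
multiplication with the matrix `(nₚ⋆ x)`. -/
theorem DeltaContext.mnorm_annihilation_le {q : ℕ} (n : Fin q → M) {c : ℝ} (hc : 0 ≤ c)
    (hn : ∀ y : K, ∑ p, ‖adjoint (n p : H →L[ℂ] K) y‖ ^ 2 ≤ c ^ 2 * ‖y‖ ^ 2)
    {ι κ : Type} [Fintype ι] [Fintype κ] (t : Matrix ι κ (M ⊗[ℂ] U.carrier)) :
    mnorm (Matrix.of fun (ip : ι × Fin q) j => ctx.annihilation U (n ip.2) (t ip.1 j)) ≤
      c * haagerupNorm α M U t := by
  have key : ∀ d, haagerupNorm α M U t < d →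
      mnorm (Matrix.of fun (ip : ι × Fin q) j => ctx.annihilation U (n ip.2) (t ip.1 j)) ≤
        c * d := by
    intro d hd
    obtain ⟨s, x, y, hxy, hlt⟩ := exists_factor_lt α M U t hd
    let T : Matrix (ι × Fin q) (Fin s) (H →L[ℂ] H) := Matrix.of fun ip k =>
      adjoint (n ip.2 : H →L[ℂ] K) ∘L (x ip.1 k : H →L[ℂ] K)
    have e : (Matrix.of fun (ip : ι × Fin q) j => ctx.annihilation U (n ip.2) (t ip.1 j))
        = Matrix.of fun ip j => ∑ k, multAct α U (T ip k) (y k j) := by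
      refine Matrix.ext fun ip j => ?_
      have h := ctx.annihilation_eq_zero U (n ip.2) (hxy ip.1 j)
      rw [map_sub, sub_eq_zero, map_sum] at h
      exact h
    rw [e]
    have hT : matNorm T ≤ c * rowNorm x := by
      refine matNorm_le (mul_nonneg hc (rowNorm_nonneg _)) fun z => ?_
      rw [Fintype.sum_prod_type]
      have h1 := sum_norm_sq_le (x.map (fun m : M => (m : H →L[ℂ] K))) z
      calc ∑ i, ∑ p, ‖∑ k, T (i, p) k (z k)‖ ^ 2
          = ∑ i, ∑ p, ‖adjoint (n p : H →L[ℂ] K) (∑ k, (x i k : H →L[ℂ] K) (z k))‖ ^ 2 := by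
            simp [T, map_sum]
        _ ≤ ∑ i, c ^ 2 * ‖∑ k, (x i k : H →L[ℂ] K) (z k)‖ ^ 2 :=
            Finset.sum_le_sum fun i _ => hn _
        _ ≤ c ^ 2 * (rowNorm x ^ 2 * ∑ k, ‖z k‖ ^ 2) := by
            rw [← Finset.mul_sum]
            exact mul_le_mul_of_nonneg_left h1 (by positivity)
        _ = _ := by ring
    have h2 := mnorm_multAct_le U ctx.left ctx.isoLeft T
      (fun ip k => ctx.comp_mem_leftMult (n ip.2).2 (x ip.1 k).2) y
    refine h2.trans ?_
    calc matNorm T * mnorm y ≤ c * rowNorm x * mnorm y :=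
          mul_le_mul_of_nonneg_right hT (mnorm_nonneg _)
      _ = c * (rowNorm x * mnorm y) := by ring
      _ ≤ c * d := mul_le_mul_of_nonneg_left hlt.le hc
  have hlim : Tendsto (fun d => c * d)
      (nhdsWithin (haagerupNorm α M U t) (Set.Ioi (haagerupNorm α M U t)))
      (𝓝 (c * haagerupNorm α M U t)) :=
    (Continuous.tendsto (by fun_prop) _).mono_left nhdsWithin_le_nhds
  exact ge_of_tendsto hlim (Filter.eventually_of_mem self_mem_nhdsWithin fun d hd => key d hd)

theorem DeltaContext.norm_annihilation_le (hτ : IsBalancedHaagerupTensor α M U W τ) (n : M)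
    (t : M ⊗[ℂ] U.carrier) : ‖ctx.annihilation U n t‖ ≤ ‖(n : H →L[ℂ] K)‖ * ‖τ t‖ := by
  have hn : ∀ y : K, ∑ _p : Fin 1, ‖adjoint (n : H →L[ℂ] K) y‖ ^ 2 ≤
      ‖(n : H →L[ℂ] K)‖ ^ 2 * ‖y‖ ^ 2 := by
    intro y
    rw [Fin.sum_univ_one, ← mul_pow, ← (adjoint : (H →L[ℂ] K) ≃ₗᵢ⋆[ℂ] (K →L[ℂ] H)).norm_map]
    exact pow_le_pow_left₀ (norm_nonneg _) (ContinuousLinearMap.le_opNorm _ _) 2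
  rw [hτ.norm_map]
  refine le_trans ?_ (ctx.mnorm_annihilation_le U (fun _ : Fin 1 => n)
    (norm_nonneg (n : H →L[ℂ] K)) hn (Matrix.of fun _ _ : Unit => t))
  exact norm_entry_le (Matrix.of fun (_ : Unit × Fin 1) (_ : Unit) => ctx.annihilation U n t)
    ((), 0) ()

theorem denseRange_tensor_span (hτ : IsBalancedHaagerupTensor α M U W τ) :
    Dense (Submodule.span ℂ {w | ∃ (l : M) (x : U.carrier), w = τ (l ⊗ₜ[ℂ] x)} : Set W) := by
  refine hτ.denseRange.mono ?_
  rintro _ ⟨t, rfl⟩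
  induction t using TensorProduct.induction_on with
  | zero => rw [map_zero]; exact Submodule.zero_mem _
  | tmul l x => exact Submodule.subset_span ⟨l, x, rfl⟩
  | add s t hs ht => rw [map_add]; exact Submodule.add_mem _ hs ht

/-- The relation `m (n⋆ l) ⊗ x = m ⊗ (n⋆ l) x`. It is imposed for `x` in the span of the vectors
`a u` and extends to all `x` by density. -/
theorem IsBalancedHaagerupTensor.creation_comp (hτ : IsBalancedHaagerupTensor α M U W τ)
    (m n l k : M) (x : U.carrier)
    (hk : (k : H →L[ℂ] K) = (m : H →L[ℂ] K) ∘L adjoint (n : H →L[ℂ] K) ∘L (l : H →L[ℂ] K)) :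
    hτ.creation U k x = hτ.creation U m
      (multAct α U (adjoint (n : H →L[ℂ] K) ∘L (l : H →L[ℂ] K)) x) := by
  have hT := ctx.comp_mem_leftMult n.2 l.2
  have : hτ.creation U k = hτ.creation U m ∘L
      multAct α U (adjoint (n : H →L[ℂ] K) ∘L (l : H →L[ℂ] K)) := by
    refine U.clm_ext fun a x => ?_
    obtain ⟨a', ha'⟩ := hT a
    rw [ContinuousLinearMap.comp_apply, multAct_act U ctx.left ctx.isoLeft hT ha',
      hτ.creation_apply, hτ.creation_apply, ← sub_eq_zero, ← map_sub]
    refine hτ.map_eq_zero U (Submodule.subset_span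
      ⟨m, k, _, a, a', x, ctx.comp_mem_rightAlgebra n.2 l.2, hk, ha', rfl⟩)
  rw [this]; rfl

/-- Rows of creation operators over a contractive row are completely contractive, since they map
`y` to `(1 ⊗ r) ⊙ y`. -/
theorem IsBalancedHaagerupTensor.mnorm_creation_le (hτ : IsBalancedHaagerupTensor α M U W τ)
    (r : ContractiveRow M) {ι κ : Type} [Fintype ι] [Fintype κ]
    (y : Matrix (ι × Fin r.n) κ U.carrier) :
    mnorm (Matrix.of fun i j => ∑ p, hτ.creation U (r.entry p) (y (i, p) j)) ≤ mnorm y := by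
  classical
  let x : Matrix ι (ι × Fin r.n) M := Matrix.of fun i kp => if i = kp.1 then r.entry kp.2 else 0
  have hx : ∀ (i : ι) (p : Fin r.n), x i (i, p) = r.entry p := fun i p => if_pos rfl
  have hx' : ∀ (i k : ι) (p : Fin r.n), k ≠ i → x i (k, p) = 0 := fun i k p hk => if_neg hk.symm
  have e : (Matrix.of fun i j => ∑ p, hτ.creation U (r.entry p) (y (i, p) j))
      = (odot x y).map τ := by
    refine Matrix.ext fun i j => ?_
    have h0 : ∀ k : ι, k ≠ i → ∑ p : Fin r.n, τ (x i (k, p) ⊗ₜ[ℂ] y (k, p) j) = 0 := fun k hk =>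
      Finset.sum_eq_zero fun p _ => by rw [hx' i k p hk, TensorProduct.zero_tmul, map_zero]
    rw [Matrix.of_apply, Matrix.map_apply, odot_apply, map_sum, Fintype.sum_prod_type,
      Fintype.sum_eq_single i h0]
    refine Finset.sum_congr rfl fun p _ => ?_
    rw [hx, hτ.creation_apply]
  rw [e]
  refine (hτ.mnorm_odot_le U x y).trans (mul_le_of_le_one_left (mnorm_nonneg _) ?_)
  refine matNorm_le zero_le_one fun z => ?_
  rw [one_pow, one_mul, Fintype.sum_prod_type]
  refine Finset.sum_le_sum fun i _ => ?_
  have e2 : ∑ j, (x.map (fun m : M => (m : H →L[ℂ] K))) i j (z j)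
      = ∑ p, (r.entry p : H →L[ℂ] K) (z (i, p)) := by
    have h0 : ∀ k, k ≠ i → ∑ p, (x i (k, p) : H →L[ℂ] K) (z (k, p)) = 0 := fun k hk =>
      Finset.sum_eq_zero fun p _ => by rw [hx' i k p hk]; rfl
    rw [Fintype.sum_prod_type]
    simp only [Matrix.map_apply]
    rw [Fintype.sum_eq_single i h0]
    exact Finset.sum_congr rfl fun p _ => by rw [hx]
  rw [e2]
  exact r.norm_row_le fun p => z (i, p)

theorem DeltaContext.exists_annihilationL (hτ : IsBalancedHaagerupTensor α M U W τ) (n : M) :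
    ∃ V : W →L[ℂ] U.carrier, ∀ t, V (τ t) = ctx.annihilation U n t := by
  have hd : Dense (Submodule.span ℂ (Set.range τ) : Set W) :=
    hτ.denseRange.mono Submodule.subset_span
  obtain ⟨V, hV, -⟩ := exists_clm_of_dense_span (fun t => τ t) (fun t => ctx.annihilation U n t)
    ‖(n : H →L[ℂ] K)‖ hd (fun c => by
      have h := ctx.norm_annihilation_le U hτ n (∑ t ∈ c.support, c t • t)
      simp only [map_sum, map_smul] at h
      exact h)
  exact ⟨V, hV⟩

/-- The annihilation operators on the completed tensor product. -/
def DeltaContext.annihilationL (hτ : IsBalancedHaagerupTensor α M U W τ) (n : M) :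
    W →L[ℂ] U.carrier :=
  (ctx.exists_annihilationL U hτ n).choose

theorem DeltaContext.annihilationL_map (hτ : IsBalancedHaagerupTensor α M U W τ) (n : M)
    (t : M ⊗[ℂ] U.carrier) : ctx.annihilationL U hτ n (τ t) = ctx.annihilation U n t :=
  (ctx.exists_annihilationL U hτ n).choose_spec t

theorem DeltaContext.mnorm_annihilationL_le (hτ : IsBalancedHaagerupTensor α M U W τ)
    (r : ContractiveRow M) {ι κ : Type} [Fintype ι] [Fintype κ] (t : Matrix ι κ W) :
    mnorm (Matrix.of fun (ip : ι × Fin r.n) j =>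
      ctx.annihilationL U hτ (r.entry ip.2) (t ip.1 j)) ≤ mnorm t := by
  refine (denseRange_matrix_map hτ.denseRange).induction_on (p := fun t : Matrix ι κ W =>
    mnorm (Matrix.of fun (ip : ι × Fin r.n) j =>
      ctx.annihilationL U hτ (r.entry ip.2) (t ip.1 j)) ≤ mnorm t) t ?_ ?_
  · refine isClosed_le (continuous_mnorm_comp fun ip j => ?_) continuous_mnorm
    exact (ContinuousLinearMap.continuous _).comp (continuous_apply_apply ip.1 j)
  · intro s
    have e : (Matrix.of fun (ip : ι × Fin r.n) j =>
        ctx.annihilationL U hτ (r.entry ip.2) (s.map τ ip.1 j))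
        = Matrix.of fun (ip : ι × Fin r.n) j => ctx.annihilation U (r.entry ip.2) (s ip.1 j) := by
      refine Matrix.ext fun ip j => ?_
      rw [Matrix.of_apply, Matrix.of_apply, Matrix.map_apply, ctx.annihilationL_map U hτ]
    rw [e, hτ.mnorm_map, ← one_mul (haagerupNorm α M U s)]
    exact ctx.mnorm_annihilation_le U r.entry zero_le_one
      (fun y => by rw [one_pow, one_mul]; exact r.norm_col_le y) s

/-- The frame of a balanced Haagerup tensor product. -/
def IsBalancedHaagerupTensor.frame (hτ : IsBalancedHaagerupTensor α M U W τ) :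
    ModuleFrame α M U W where
  L := hτ.creation U
  V := ctx.annihilationL U hτ
  V_L n l x := ctx.annihilationL_map U hτ n (l ⊗ₜ[ℂ] x)
  L_comp := hτ.creation_comp ctx U
  norm_L_le := hτ.norm_tmul_le U
  mnorm_L_le := hτ.mnorm_creation_le ctx U
  mnorm_V_le := ctx.mnorm_annihilationL_le U hτ
  dense := denseRange_tensor_span ctx U hτ

end Tensor

end Frames

end DeltaMorita

namespace DeltaMorita

open OperatorSpace Filter Topology
open ContinuousLinearMap (adjoint)

/-! ### The action of `B` on a framed space -/

section FrameAction

variable {H₁ : Type w₁} [NormedAddCommGroup H₁] [InnerProductSpace ℂ H₁] [CompleteSpace H₁]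
variable {H₂ : Type w₂} [NormedAddCommGroup H₂] [InnerProductSpace ℂ H₂] [CompleteSpace H₂]
variable {H : Type u} [NormedAddCommGroup H] [InnerProductSpace ℂ H] [CompleteSpace H]
variable {K : Type u} [NormedAddCommGroup K] [InnerProductSpace ℂ K] [CompleteSpace K]
variable {A : NonUnitalSubalgebra ℂ (H₁ →L[ℂ] H₁)} {C : NonUnitalStarSubalgebra ℂ (H₁ →L[ℂ] H₁)}
variable {B : NonUnitalSubalgebra ℂ (H₂ →L[ℂ] H₂)} {D : NonUnitalStarSubalgebra ℂ (H₂ →L[ℂ] H₂)}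
variable {α : RepHom A H} {β : RepHom B K} {M : Submodule ℂ (H →L[ℂ] K)}

theorem norm_le_of_mnorm_unit {V W : Type*} [NormedAddCommGroup V] [NormedSpace ℂ V]
    [OperatorSpace V] [NormedAddCommGroup W] [NormedSpace ℂ W] [OperatorSpace W] {v : V} {w : W}
    {c : ℝ}
    (h : mnorm (Matrix.of fun _ _ : Unit => v) ≤ c * mnorm (Matrix.of fun _ _ : Unit => w)) :
    ‖v‖ ≤ c * ‖w‖ := by
  rwa [mnorm_unit, mnorm_unit] at h

/-- A set of elements of `A` whose images span a dense subspace of `α(A)` spans a dense subspace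
of `A`. -/
theorem CompletelyIsometric.dense_span (hα : CompletelyIsometric α) {S : Set (H →L[ℂ] H)}
    (hS : ∀ x ∈ S, ∃ a, α a = x)
    (h : ∀ a, α a ∈ closure (Submodule.span ℂ S : Set (H →L[ℂ] H))) :
    Dense (Submodule.span ℂ {a | α a ∈ S} : Set A) := by
  intro a
  rw [hα.isometry.isEmbedding.closure_eq_preimage_closure_image, Set.mem_preimage]
  refine closure_mono ?_ (h a)
  have e : Submodule.span ℂ S ≤
      (Submodule.span ℂ {a | α a ∈ S}).map (α : A →ₗ[ℂ] (H →L[ℂ] H)) := by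
    refine Submodule.span_le.2 fun x hx => ?_
    obtain ⟨a, rfl⟩ := hS x hx
    exact ⟨a, Submodule.subset_span hx, rfl⟩
  exact e

theorem ContractiveRow.gram_comp_eq_sum (r : ContractiveRow M) (m : H →L[ℂ] K) :
    r.gram ∘L m = ∑ p, (r.entry p : H →L[ℂ] K) ∘L adjoint (r.entry p : H →L[ℂ] K) ∘L m := by
  refine ContinuousLinearMap.ext fun y => ?_
  rw [ContinuousLinearMap.comp_apply, r.gram_apply, sum_apply]
  rfl

theorem ContractiveRow.gram_comp_mem (hM : IsTRO M) (r : ContractiveRow M) {m : H →L[ℂ] K}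
    (hm : m ∈ M) : r.gram ∘L m ∈ M := by
  rw [r.gram_comp_eq_sum]
  exact M.sum_mem fun p _ => hM _ (r.entry p).2 _ (r.entry p).2 _ hm

namespace DeltaContext

variable (ctx : DeltaContext C D α β M)
include ctx

/-- The elements `m⋆ b n` span a dense subspace of `A`. -/
theorem dense_left : Dense (Submodule.span ℂ {a : A | ∃ (m n : M) (b : B),
    α a = adjoint (m : H →L[ℂ] K) ∘L β b ∘L (n : H →L[ℂ] K)} : Set A) := by
  refine (CompletelyIsometric.dense_span ctx.isoLeft ?_ ctx.map_mem_closure).mono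
    (Submodule.span_mono ?_)
  · rintro _ ⟨m, hm, b, n, hn, rfl⟩
    exact ctx.exists_left b hm hn
  · rintro a ⟨m, hm, b, n, hn, h⟩
    exact ⟨⟨m, hm⟩, ⟨n, hn⟩, b, h⟩

/-- The elements `m a n⋆` span a dense subspace of `B`. -/
theorem dense_right : Dense (Submodule.span ℂ {b : B | ∃ (m n : M) (a : A),
    β b = (m : H →L[ℂ] K) ∘L α a ∘L adjoint (n : H →L[ℂ] K)} : Set B) := by
  refine (CompletelyIsometric.dense_span ctx.isoRight ?_ ctx.map_mem_closure').mono
    (Submodule.span_mono ?_)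
  · rintro _ ⟨m, hm, a, n, hn, rfl⟩
    exact ctx.exists_right a hm hn
  · rintro b ⟨m, hm, a, n, hn, h⟩
    exact ⟨⟨m, hm⟩, ⟨n, hn⟩, a, h⟩

theorem exists_compress (m n : M) : ∃ T : B →ₗ[ℂ] A, ∀ b,
    α (T b) = adjoint (m : H →L[ℂ] K) ∘L β b ∘L (n : H →L[ℂ] K) := by
  choose f hf using fun b : B => ctx.exists_left b m.2 n.2
  have hinj := CompletelyIsometric.injective ctx.isoLeft
  exact ⟨
    { toFun := f
      map_add' := fun b c => hinj (by
        rw [map_add, hf, hf, hf, map_add, ContinuousLinearMap.add_comp,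
          ContinuousLinearMap.comp_add])
      map_smul' := fun z b => hinj (by
        rw [RingHom.id_apply, map_smul, hf, hf, map_smul, ContinuousLinearMap.smul_comp,
          ContinuousLinearMap.comp_smul]) }, hf⟩

/-- The map `b ↦ m⋆ b n` from `B` to `A`. -/
def compress (m n : M) : B →ₗ[ℂ] A := (ctx.exists_compress m n).choose

theorem map_compress (m n : M) (b : B) :
    α (ctx.compress m n b) = adjoint (m : H →L[ℂ] K) ∘L β b ∘L (n : H →L[ℂ] K) :=
  (ctx.exists_compress m n).choose_spec b

theorem norm_compress_le (m n : M) (b : B) :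
    ‖ctx.compress m n b‖ ≤ ‖adjoint (m : H →L[ℂ] K)‖ * ‖(n : H →L[ℂ] K)‖ * ‖b‖ := by
  rw [← CompletelyIsometric.norm_map ctx.isoLeft, ctx.map_compress,
    ← CompletelyIsometric.norm_map ctx.isoRight]
  calc _ ≤ ‖adjoint (m : H →L[ℂ] K)‖ * (‖β b‖ * ‖(n : H →L[ℂ] K)‖) :=
        (ContinuousLinearMap.opNorm_comp_le _ _).trans (by
          gcongr; exact ContinuousLinearMap.opNorm_comp_le _ _)
    _ = _ := by ring

/-- Compressing with a contractive row, `b ↦ (mₚ⋆ b m_q)`, does not increase matrix norms. -/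
theorem matNorm_compress_le (r : ContractiveRow M) {ι κ : Type} [Fintype ι] [Fintype κ]
    (b : Matrix ι κ B) :
    matNorm ((Matrix.of fun (ip : ι × Fin r.n) (kq : κ × Fin r.n) =>
      ctx.compress (r.entry ip.2) (r.entry kq.2) (b ip.1 kq.1)).map
        (fun a : A => (a : H₁ →L[ℂ] H₁))) ≤
      matNorm (b.map (fun b : B => (b : H₂ →L[ℂ] H₂))) := by
  rw [← ctx.isoLeft, ← ctx.isoRight]
  refine matNorm_le (matNorm_nonneg _) fun z => ?_
  rw [Fintype.sum_prod_type, Fintype.sum_prod_type]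
  have e : ∀ (i : ι) (p : Fin r.n), ∑ kq : κ × Fin r.n,
      ((Matrix.of fun (ip : ι × Fin r.n) (kq : κ × Fin r.n) =>
        ctx.compress (r.entry ip.2) (r.entry kq.2) (b ip.1 kq.1)).map α) (i, p) kq (z kq)
      = adjoint (r.entry p : H →L[ℂ] K)
        (∑ k, (b.map β) i k (∑ q, (r.entry q : H →L[ℂ] K) (z (k, q)))) := by
    intro i p
    rw [Fintype.sum_prod_type, map_sum]
    refine Finset.sum_congr rfl fun k _ => ?_
    rw [map_sum, map_sum]
    refine Finset.sum_congr rfl fun q _ => ?_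
    rw [Matrix.map_apply, Matrix.of_apply, ctx.map_compress]
    rfl
  simp only [e]
  calc _ ≤ ∑ i, ‖∑ k, (b.map β) i k (∑ q, (r.entry q : H →L[ℂ] K) (z (k, q)))‖ ^ 2 :=
        Finset.sum_le_sum fun i _ => r.norm_col_le _
    _ ≤ matNorm (b.map β) ^ 2 * ∑ k, ‖∑ q, (r.entry q : H →L[ℂ] K) (z (k, q))‖ ^ 2 :=
        sum_norm_sq_le (b.map β) fun k => ∑ q, (r.entry q : H →L[ℂ] K) (z (k, q))
    _ ≤ _ := by
        refine mul_le_mul_of_nonneg_left ?_ (by positivity)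
        exact Finset.sum_le_sum fun k _ => r.norm_row_le fun q => z (k, q)

end DeltaContext

namespace ModuleFrame

variable {U : OMod.{u} A} {W : Type u} [NormedAddCommGroup W] [NormedSpace ℂ W]
  [OperatorSpace W] (fr : ModuleFrame α M U W)

/-- The operator `∑ L(mᵢ) V(mᵢ)` of a contractive row. -/
def proj (r : ContractiveRow M) : W →L[ℂ] W := ∑ p, fr.L (r.entry p) ∘L fr.V (r.entry p)

theorem proj_apply (r : ContractiveRow M) (x : W) :
    fr.proj r x = ∑ p, fr.L (r.entry p) (fr.V (r.entry p) x) := by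
  simp [proj]

theorem mnorm_proj_le (r : ContractiveRow M) {ι κ : Type} [Fintype ι] [Fintype κ]
    (x : Matrix ι κ W) : mnorm (x.map (fr.proj r)) ≤ mnorm x := by
  have e : x.map (fr.proj r) = Matrix.of fun i j => ∑ p, fr.L (r.entry p)
      ((Matrix.of fun (ip : ι × Fin r.n) j => fr.V (r.entry ip.2) (x ip.1 j)) (i, p) j) :=
    Matrix.ext fun i j => fr.proj_apply r (x i j)
  rw [e]
  exact (fr.mnorm_L_le r _).trans (fr.mnorm_V_le r x)

theorem norm_proj_le (r : ContractiveRow M) (x : W) : ‖fr.proj r x‖ ≤ 1 * ‖x‖ := by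
  refine norm_le_of_mnorm_unit ?_
  rw [one_mul]
  exact fr.mnorm_proj_le r (Matrix.of fun _ _ : Unit => x)

theorem proj_L (hM : IsTRO M) (r : ContractiveRow M) (m : M) (x : U.carrier) :
    fr.proj r (fr.L m x) = fr.L ⟨r.gram ∘L (m : H →L[ℂ] K), r.gram_comp_mem hM m.2⟩ x := by
  let k : Fin r.n → M := fun p => ⟨(r.entry p : H →L[ℂ] K) ∘L
    adjoint (r.entry p : H →L[ℂ] K) ∘L (m : H →L[ℂ] K), hM _ (r.entry p).2 _ (r.entry p).2 _ m.2⟩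
  have hk : (⟨r.gram ∘L (m : H →L[ℂ] K), r.gram_comp_mem hM m.2⟩ : M) = ∑ p, k p := by
    refine Subtype.ext ?_
    rw [AddSubmonoidClass.coe_finsetSum]
    exact r.gram_comp_eq_sum _
  rw [fr.proj_apply, hk, map_sum, sum_apply]
  refine Finset.sum_congr rfl fun p _ => ?_
  rw [fr.V_L, fr.L_comp (r.entry p) (r.entry p) m (k p) x rfl]

theorem tendsto_proj_L (hM : IsTRO M) {l : Filter (ContractiveRow M)}
    (hl : ∀ m ∈ M, Tendsto (fun r : ContractiveRow M => r.gram ∘L m) l (𝓝 m)) (m : M)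
    (x : U.carrier) : Tendsto (fun r => fr.proj r (fr.L m x)) l (𝓝 (fr.L m x)) := by
  simp only [fr.proj_L hM]
  rw [tendsto_iff_norm_sub_tendsto_zero]
  have h1 : Tendsto (fun r : ContractiveRow M => ‖r.gram ∘L (m : H →L[ℂ] K) - m‖ * ‖x‖) l
      (𝓝 0) := by
    have := ((tendsto_iff_norm_sub_tendsto_zero).1 (hl m m.2)).mul_const ‖x‖
    rwa [zero_mul] at this
  refine squeeze_zero (fun _ => norm_nonneg _) (fun r => ?_) h1
  have := fr.norm_L_le (⟨r.gram ∘L (m : H →L[ℂ] K), r.gram_comp_mem hM m.2⟩ - m) x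
  rwa [map_sub] at this

/-- The operators `∑ L(mᵢ) V(mᵢ)` converge strongly to the identity along the filter that makes
`∑ mᵢ mᵢ⋆` an approximate unit of `M`. -/
theorem tendsto_proj (hM : IsTRO M) {l : Filter (ContractiveRow M)}
    (hl : ∀ m ∈ M, Tendsto (fun r : ContractiveRow M => r.gram ∘L m) l (𝓝 m)) (x : W) :
    Tendsto (fun r => fr.proj r x) l (𝓝 x) := by
  refine tendsto_of_mem_closure_span (C := 1)
    (T := fun r : ContractiveRow M => (fr.proj r : W →ₗ[ℂ] W)) (S := LinearMap.id)
    (fr.norm_proj_le) (fun x => by simp) ?_ (fr.dense x)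
  rintro _ ⟨m, x, rfl⟩
  exact fr.tendsto_proj_L hM hl m x

end ModuleFrame

end FrameAction

end DeltaMorita

namespace DeltaMorita

open OperatorSpace Filter Topology
open ContinuousLinearMap (adjoint)

section FrameAction

variable {H₁ : Type w₁} [NormedAddCommGroup H₁] [InnerProductSpace ℂ H₁] [CompleteSpace H₁]
variable {H₂ : Type w₂} [NormedAddCommGroup H₂] [InnerProductSpace ℂ H₂] [CompleteSpace H₂]
variable {H : Type u} [NormedAddCommGroup H] [InnerProductSpace ℂ H] [CompleteSpace H]
variable {K : Type u} [NormedAddCommGroup K] [InnerProductSpace ℂ K] [CompleteSpace K]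
variable {A : NonUnitalSubalgebra ℂ (H₁ →L[ℂ] H₁)} {C : NonUnitalStarSubalgebra ℂ (H₁ →L[ℂ] H₁)}
variable {B : NonUnitalSubalgebra ℂ (H₂ →L[ℂ] H₂)} {D : NonUnitalStarSubalgebra ℂ (H₂ →L[ℂ] H₂)}
variable {α : RepHom A H} {β : RepHom B K} {M : Submodule ℂ (H →L[ℂ] K)}
variable (ctx : DeltaContext C D α β M)

namespace ModuleFrame

variable {U : OMod.{u} A} {W : Type u} [NormedAddCommGroup W] [NormedSpace ℂ W]
  [OperatorSpace W] (fr : ModuleFrame α M U W)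

/-- `b ↦ P b P x` for the operator `P = ∑ L(mᵢ) V(mᵢ)` of a contractive row: `m⋆ b n` being in
`A`, this makes sense before the action of `B` has been constructed. -/
def approxAct (r : ContractiveRow M) (x : W) : B →ₗ[ℂ] W :=
  ∑ p, ∑ q, (fr.L (r.entry p) : U.carrier →ₗ[ℂ] W) ∘ₗ U.act.flip (fr.V (r.entry q) x) ∘ₗ
    ctx.compress (r.entry p) (r.entry q)

theorem approxAct_apply (r : ContractiveRow M) (x : W) (b : B) :
    fr.approxAct ctx r x b = ∑ p, fr.L (r.entry p)
      (∑ q, U.act (ctx.compress (r.entry p) (r.entry q) b) (fr.V (r.entry q) x)) := by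
  simp [approxAct, map_sum]

theorem mnorm_approxAct_le (r : ContractiveRow M) {ι κ μ : Type} [Fintype ι] [Fintype κ]
    [Fintype μ] (b : Matrix ι κ B) (x : Matrix κ μ W) :
    mnorm (Matrix.of fun i j => ∑ k, fr.approxAct ctx r (x k j) (b i k)) ≤
      matNorm (b.map (fun b : B => (b : H₂ →L[ℂ] H₂))) * mnorm x := by
  let a : Matrix (ι × Fin r.n) (κ × Fin r.n) A :=
    Matrix.of fun ip kq => ctx.compress (r.entry ip.2) (r.entry kq.2) (b ip.1 kq.1)
  let y : Matrix (κ × Fin r.n) μ U.carrier :=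
    Matrix.of fun kq j => fr.V (r.entry kq.2) (x kq.1 j)
  let z : Matrix (ι × Fin r.n) μ U.carrier := Matrix.of fun ip j => ∑ kq, U.act (a ip kq) (y kq j)
  have e : (Matrix.of fun i j => ∑ k, fr.approxAct ctx r (x k j) (b i k))
      = Matrix.of fun i j => ∑ p, fr.L (r.entry p) (z (i, p) j) := by
    refine Matrix.ext fun i j => ?_
    rw [Matrix.of_apply, Matrix.of_apply]
    simp only [fr.approxAct_apply]
    rw [Finset.sum_comm]
    refine Finset.sum_congr rfl fun p _ => ?_
    rw [← map_sum]
    congr 1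
    exact (Fintype.sum_prod_type
      (fun kq : κ × Fin r.n => U.act (a (i, p) kq) (y kq j))).symm
  rw [e]
  refine (fr.mnorm_L_le r z).trans ((U.mnorm_act_le a y).trans ?_)
  exact mul_le_mul (ctx.matNorm_compress_le r b) (fr.mnorm_V_le r x) (mnorm_nonneg _)
    (matNorm_nonneg _)

theorem norm_approxAct_le (r : ContractiveRow M) (x : W) (b : B) :
    ‖fr.approxAct ctx r x b‖ ≤ ‖b‖ * ‖x‖ := by
  refine norm_le_of_mnorm_unit ?_
  have h := fr.mnorm_approxAct_le ctx r (Matrix.of fun _ _ : Unit => b)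
    (Matrix.of fun _ _ : Unit => x)
  have e2 : (Matrix.of fun _ _ : Unit => b).map (fun b : B => (b : H₂ →L[ℂ] H₂))
      = Matrix.of fun _ _ : Unit => (b : H₂ →L[ℂ] H₂) := rfl
  have e1 : (Matrix.of fun i j : Unit => ∑ k : Unit, fr.approxAct ctx r
      ((Matrix.of fun _ _ : Unit => x) k j) ((Matrix.of fun _ _ : Unit => b) i k))
      = Matrix.of fun _ _ : Unit => fr.approxAct ctx r x b := by
    ext; simp
  rw [e1, e2, matNorm_unit] at h
  exact h

include ctx in
/-- An element `p⋆ (m a n⋆) q` of `A` acts as the composition of `n⋆ q`, `a` and `p⋆ m`. -/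
theorem act_eq_of_map_eq {p m n q : M} {a a' : A}
    (h : α a' = adjoint (p : H →L[ℂ] K) ∘L ((m : H →L[ℂ] K) ∘L α a ∘L adjoint (n : H →L[ℂ] K))
      ∘L (q : H →L[ℂ] K)) (x : U.carrier) :
    U.act a' x = multAct α U (adjoint (p : H →L[ℂ] K) ∘L (m : H →L[ℂ] K))
      (U.act a (multAct α U (adjoint (n : H →L[ℂ] K) ∘L (q : H →L[ℂ] K)) x)) := by
  have h1 : α a' = (adjoint (p : H →L[ℂ] K) ∘L (m : H →L[ℂ] K)) ∘L
      (α a ∘L (adjoint (n : H →L[ℂ] K) ∘L (q : H →L[ℂ] K))) := h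
  have hpm := ctx.comp_mem_leftMult p.2 m.2
  have hnq := ctx.comp_mem_leftMult n.2 q.2
  have ha : α a ∈ leftMult α := map_mem_leftMult a
  have hanq : α a ∘L (adjoint (n : H →L[ℂ] K) ∘L (q : H →L[ℂ] K)) ∈ leftMult α := mul_mem ha hnq
  rw [← U.actL_apply, ← U.actL_apply, ← multAct_map U ctx.left ctx.isoLeft,
    ← multAct_map U ctx.left ctx.isoLeft, h1,
    multAct_mul U ctx.left ctx.isoLeft hpm hanq, multAct_mul U ctx.left ctx.isoLeft ha hnq]

include ctx in
theorem act_compress {p q m n : M} {b : B} {a : A} (hb : β b = (m : H →L[ℂ] K) ∘L α a ∘L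
    adjoint (n : H →L[ℂ] K)) (x : W) :
    U.act (ctx.compress p q b) (fr.V q x) =
      fr.V p (fr.L m (U.act a (fr.V n (fr.L q (fr.V q x))))) := by
  have h := ctx.map_compress p q b
  rw [hb] at h
  rw [fr.V_L, fr.V_L, act_eq_of_map_eq ctx h]

/-- On the generators `m a n⋆` of `B` the approximate action is `P L(m) a V(n) P`. -/
theorem approxAct_of_eq (r : ContractiveRow M) {m n : M} {b : B} {a : A}
    (hb : β b = (m : H →L[ℂ] K) ∘L α a ∘L adjoint (n : H →L[ℂ] K)) (x : W) :
    fr.approxAct ctx r x b = fr.proj r (fr.L m (U.act a (fr.V n (fr.proj r x)))) := by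
  rw [fr.approxAct_apply, fr.proj_apply]
  refine Finset.sum_congr rfl fun p _ => ?_
  congr 1
  rw [fr.proj_apply]
  simp only [map_sum]
  exact Finset.sum_congr rfl fun q _ => fr.act_compress ctx hb x

theorem tendsto_approxAct_of_eq {l : Filter (ContractiveRow M)}
    (hl : ∀ m ∈ M, Tendsto (fun r : ContractiveRow M => r.gram ∘L m) l (𝓝 m)) {m n : M} {b : B}
    {a : A} (hb : β b = (m : H →L[ℂ] K) ∘L α a ∘L adjoint (n : H →L[ℂ] K)) (x : W) :
    Tendsto (fun r => fr.approxAct ctx r x b) l (𝓝 (fr.L m (U.act a (fr.V n x)))) := by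
  let T : W →L[ℂ] W := fr.L m ∘L U.actL a ∘L fr.V n
  have h1 := fr.tendsto_proj ctx.equiv.isTRO hl (T x)
  have h2 : Tendsto (fun r => fr.proj r (T (fr.proj r x - x))) l (𝓝 0) := by
    have h3 : Tendsto (fun r => T (fr.proj r x - x)) l (𝓝 0) := by
      have h4 := (fr.tendsto_proj ctx.equiv.isTRO hl x).sub_const x
      rw [sub_self] at h4
      have h5 := (T.continuous.tendsto 0).comp h4
      rwa [map_zero] at h5
    rw [tendsto_zero_iff_norm_tendsto_zero] at h3 ⊢
    refine squeeze_zero (fun _ => norm_nonneg _) (fun r => ?_) h3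
    exact (fr.norm_proj_le r _).trans_eq (one_mul _)
  have h6 := h2.add h1
  rw [zero_add] at h6
  refine h6.congr fun r => ?_
  rw [fr.approxAct_of_eq ctx r hb x, ← map_add, map_sub, sub_add_cancel]
  rfl

/-- The action of `B` on `W` determined by `(m a n⋆) w = L(m) a V(n) w`. -/
def IsAction (β : RepHom B K) (fr : ModuleFrame α M U W)
    (ρ : B →ₗ[ℂ] W →ₗ[ℂ] W) : Prop :=
  ∀ (b : B) (m n : M) (a : A), β b = (m : H →L[ℂ] K) ∘L α a ∘L adjoint (n : H →L[ℂ] K) →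
    ∀ x, ρ b x = fr.L m (U.act a (fr.V n x))

theorem tendsto_approxAct {l : Filter (ContractiveRow M)}
    (hl : ∀ m ∈ M, Tendsto (fun r : ContractiveRow M => r.gram ∘L m) l (𝓝 m))
    {ρ : B →ₗ[ℂ] W →ₗ[ℂ] W} (hρ : fr.IsAction β ρ) (hb : ∀ b x, ‖ρ b x‖ ≤ ‖b‖ * ‖x‖)
    (b : B) (x : W) : Tendsto (fun r => fr.approxAct ctx r x b) l (𝓝 (ρ b x)) := by
  have h0 : ∀ b : B, ‖ρ.flip x b‖ ≤ ‖x‖ * ‖b‖ := fun b => by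
    rw [mul_comm]; exact hb b x
  have h1 : ∀ (r : ContractiveRow M) (b : B), ‖fr.approxAct ctx r x b‖ ≤ ‖x‖ * ‖b‖ :=
    fun r b => by
      rw [mul_comm]; exact fr.norm_approxAct_le ctx r x b
  refine tendsto_of_mem_closure_span (E := B) (F := W) (T := fun r => fr.approxAct ctx r x)
    (S := ρ.flip x) h1 h0 ?_ (ctx.dense_right b)
  rintro b ⟨m, n, a, h⟩
  rw [LinearMap.flip_apply, hρ b m n a h x]
  exact fr.tendsto_approxAct_of_eq ctx hl h x

include ctx in
/-- The prescription `m a n⋆ ↦ L(m) a V(n)` is contractive on linear combinations, as a limit of the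
approximate actions. -/
theorem norm_sum_le_of_isAction {σ : Type*} (s : Finset σ) (c : σ → ℂ) (b : σ → B) (m n : σ → M)
    (a : σ → A) (h : ∀ t, β (b t) = (m t : H →L[ℂ] K) ∘L α (a t) ∘L adjoint (n t : H →L[ℂ] K))
    (x : W) :
    ‖∑ t ∈ s, c t • fr.L (m t) (U.act (a t) (fr.V (n t) x))‖ ≤ ‖∑ t ∈ s, c t • b t‖ * ‖x‖ := by
  obtain ⟨l, hl, hlim⟩ := ctx.equiv.isTRO.exists_filter
  have h : Tendsto (fun r => fr.approxAct ctx r x (∑ t ∈ s, c t • b t)) l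
      (𝓝 (∑ t ∈ s, c t • fr.L (m t) (U.act (a t) (fr.V (n t) x)))) := by
    simp only [map_sum, map_smul]
    exact tendsto_finsetSum _ fun t _ =>
      (fr.tendsto_approxAct_of_eq ctx hlim (h t) x).const_smul _
  exact le_of_tendsto h.norm (Eventually.of_forall fun r => fr.norm_approxAct_le ctx r x _)

include ctx in
/-- The action of `B` exists: the contractive prescription `m a n⋆ ↦ L(m) a V(n)` extends from the
span of the elements `m a n⋆`, which is dense in `B`. -/
theorem exists_isAction [CompleteSpace W] :
    ∃ ρ : B →ₗ[ℂ] W →ₗ[ℂ] W, fr.IsAction β ρ ∧ ∀ b x, ‖ρ b x‖ ≤ ‖b‖ * ‖x‖ := by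
  let σ : Type _ := {t : B × M × M × A //
    β t.1 = (t.2.1 : H →L[ℂ] K) ∘L α t.2.2.2 ∘L adjoint (t.2.2.1 : H →L[ℂ] K)}
  let e : σ → B := fun t => t.1.1
  let f : σ → (W →L[ℂ] W) := fun t => fr.L t.1.2.1 ∘L U.actL t.1.2.2.2 ∘L fr.V t.1.2.2.1
  have hd : Dense (Submodule.span ℂ (Set.range e) : Set B) := by
    refine ctx.dense_right.mono (Submodule.span_mono ?_)
    rintro b ⟨m, n, a, h⟩
    exact ⟨⟨⟨b, m, n, a⟩, h⟩, rfl⟩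
  have key : ∀ c : σ →₀ ℂ, ‖c.sum fun t z => z • f t‖ ≤ 1 * ‖c.sum fun t z => z • e t‖ := by
    intro c
    rw [one_mul]
    refine ContinuousLinearMap.opNorm_le_bound _ (norm_nonneg _) fun x => ?_
    have h := fr.norm_sum_le_of_isAction ctx c.support c e (fun t => t.1.2.1)
      (fun t => t.1.2.2.1) (fun t => t.1.2.2.2) (fun t => t.2) x
    have h' : (c.sum fun t z => z • f t) x = ∑ t ∈ c.support, c t •
        fr.L t.1.2.1 (U.act t.1.2.2.2 (fr.V t.1.2.2.1 x)) := by
      rw [Finsupp.sum, sum_apply]; rfl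
    rw [h']
    exact h
  have : IsBoundedSMul ℂ B :=
    IsBoundedSMul.of_norm_smul_le fun c b => norm_smul_le c (b : H₂ →L[ℂ] H₂)
  obtain ⟨ρ, h1, h2⟩ := exists_clm_of_dense_span e f 1 hd key
  refine ⟨ContinuousLinearMap.coeLM ℂ ∘ₗ (ρ : B →ₗ[ℂ] (W →L[ℂ] W)), fun b m n a h x => ?_,
    fun b x => ?_⟩
  · exact DFunLike.congr_fun (h1 ⟨⟨b, m, n, a⟩, h⟩) x
  · refine ((ρ b).le_opNorm x).trans (mul_le_mul_of_nonneg_right ?_ (norm_nonneg x))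
    exact (h2 b).trans_eq (one_mul _)

end ModuleFrame

end FrameAction

end DeltaMorita

namespace DeltaMorita

open OperatorSpace Filter Topology
open ContinuousLinearMap (adjoint)

section Density

variable {E F : Type*} [SeminormedAddCommGroup E] [Module ℂ E] [NormedAddCommGroup F]
  [NormedSpace ℂ F]

theorem eq_of_mem_closure_span {T S : E →ₗ[ℂ] F} {C : ℝ} (hT : ∀ x, ‖T x‖ ≤ C * ‖x‖)
    (hS : ∀ x, ‖S x‖ ≤ C * ‖x‖) {D : Set E} (hD : ∀ d ∈ D, T d = S d) {x : E}
    (hx : x ∈ closure (Submodule.span ℂ D : Set E)) : T x = S x :=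
  tendsto_nhds_unique tendsto_const_nhds
    (tendsto_of_mem_closure_span (l := (atTop : Filter ℕ)) (T := fun _ => T) (fun _ => hT) hS
      (fun d hd => by rw [hD d hd]; exact tendsto_const_nhds) hx)

theorem map_mem_of_mem_closure_span {T : E →ₗ[ℂ] F} {C : ℝ} (hT : ∀ x, ‖T x‖ ≤ C * ‖x‖)
    {R : Submodule ℂ F} (hR : IsClosed (R : Set F)) {D : Set E} (hD : ∀ d ∈ D, T d ∈ R) {x : E}
    (hx : x ∈ closure (Submodule.span ℂ D : Set E)) : T x ∈ R := by
  have h1 : Submodule.span ℂ D ≤ R.comap T := Submodule.span_le.2 hD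
  have h2 : Continuous T := AddMonoidHomClass.continuous_of_bound T C hT
  exact closure_minimal (t := T ⁻¹' R) h1 (hR.preimage h2) hx

end Density

section FrameAction

variable {H₁ : Type w₁} [NormedAddCommGroup H₁] [InnerProductSpace ℂ H₁] [CompleteSpace H₁]
variable {H₂ : Type w₂} [NormedAddCommGroup H₂] [InnerProductSpace ℂ H₂] [CompleteSpace H₂]
variable {H : Type u} [NormedAddCommGroup H] [InnerProductSpace ℂ H] [CompleteSpace H]
variable {K : Type u} [NormedAddCommGroup K] [InnerProductSpace ℂ K] [CompleteSpace K]
variable {A : NonUnitalSubalgebra ℂ (H₁ →L[ℂ] H₁)} {C : NonUnitalStarSubalgebra ℂ (H₁ →L[ℂ] H₁)}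
variable {B : NonUnitalSubalgebra ℂ (H₂ →L[ℂ] H₂)} {D : NonUnitalStarSubalgebra ℂ (H₂ →L[ℂ] H₂)}
variable {α : RepHom A H} {β : RepHom B K} {M : Submodule ℂ (H →L[ℂ] K)}
variable (ctx : DeltaContext C D α β M)

namespace ModuleFrame

variable {U : OMod.{u} A} {W : Type u} [NormedAddCommGroup W] [NormedSpace ℂ W]
  [OperatorSpace W] {fr : ModuleFrame α M U W} {ρ : B →ₗ[ℂ] W →ₗ[ℂ] W}

include ctx

/-- The action is a limit of the approximate actions, so it is completely contractive. -/
theorem IsAction.mnorm_le (hρ : fr.IsAction β ρ) (hb : ∀ b x, ‖ρ b x‖ ≤ ‖b‖ * ‖x‖)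
    {ι κ μ : Type} [Fintype ι] [Fintype κ] [Fintype μ] (b : Matrix ι κ B) (x : Matrix κ μ W) :
    mnorm (Matrix.of fun i j => ∑ k, ρ (b i k) (x k j)) ≤
      matNorm (b.map (fun b : B => (b : H₂ →L[ℂ] H₂))) * mnorm x := by
  obtain ⟨l, hl, hlim⟩ := ctx.equiv.isTRO.exists_filter
  have h : Tendsto (fun r => mnorm (Matrix.of fun i j => ∑ k, fr.approxAct ctx r (x k j) (b i k)))
      l (𝓝 (mnorm (Matrix.of fun i j => ∑ k, ρ (b i k) (x k j)))) := by
    refine tendsto_mnorm fun i j => ?_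
    simp only [Matrix.of_apply]
    exact tendsto_finsetSum _ fun k _ => fr.tendsto_approxAct ctx hlim hρ hb (b i k) (x k j)
  exact le_of_tendsto h (Eventually.of_forall fun r => fr.mnorm_approxAct_le ctx r b x)

theorem IsAction.map_mul_of_eq (hρ : fr.IsAction β ρ) {b c : B} {m n m' n' : M} {a a' : A}
    (hb : β b = (m : H →L[ℂ] K) ∘L α a ∘L adjoint (n : H →L[ℂ] K))
    (hc : β c = (m' : H →L[ℂ] K) ∘L α a' ∘L adjoint (n' : H →L[ℂ] K)) (x : W) :
    ρ (b * c) x = ρ b (ρ c x) := by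
  have hT := ctx.comp_mem_leftMult n.2 m'.2
  obtain ⟨a₀, ha₀⟩ := hT a'
  have h : β (b * c) = (m : H →L[ℂ] K) ∘L α (a * a₀) ∘L adjoint (n' : H →L[ℂ] K) := by
    rw [map_mul, map_mul, hb, hc, ha₀]; rfl
  rw [hρ b m n a hb, hρ c m' n' a' hc, hρ (b * c) m n' _ h, U.act_mul, fr.V_L,
    multAct_act U ctx.left ctx.isoLeft hT ha₀]

/-- Multiplicativity holds for generators and extends to `B` by density in each variable. -/
theorem IsAction.map_mul (hρ : fr.IsAction β ρ) (hb : ∀ b x, ‖ρ b x‖ ≤ ‖b‖ * ‖x‖) (b c : B)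
    (x : W) : ρ (b * c) x = ρ b (ρ c x) := by
  have step : ∀ (c : B) (m' n' : M) (a' : A),
      β c = (m' : H →L[ℂ] K) ∘L α a' ∘L adjoint (n' : H →L[ℂ] K) →
      ∀ b, ρ (b * c) x = ρ b (ρ c x) := by
    intro c m' n' a' hc b
    let T : B →ₗ[ℂ] W :=
      { toFun := fun b => ρ (b * c) x
        map_add' := fun b b' => by rw [add_mul, map_add, LinearMap.add_apply]
        map_smul' := fun z b => by rw [smul_mul_assoc, map_smul]; rfl }
    refine eq_of_mem_closure_span (T := T) (S := ρ.flip (ρ c x)) (C := ‖c‖ * ‖x‖) (fun b => ?_)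
      (fun b => ?_) ?_ (ctx.dense_right b)
    · refine (hb (b * c) x).trans ?_
      calc _ ≤ ‖b‖ * ‖c‖ * ‖x‖ := mul_le_mul_of_nonneg_right (norm_mul_le b c) (norm_nonneg x)
        _ = _ := by ring
    · refine (hb b (ρ c x)).trans ?_
      calc _ ≤ ‖b‖ * (‖c‖ * ‖x‖) := mul_le_mul_of_nonneg_left (hb c x) (norm_nonneg b)
        _ = _ := by ring
    · rintro b ⟨m, n, a, h⟩
      exact hρ.map_mul_of_eq ctx h hc x
  let T : B →ₗ[ℂ] W :=
    { toFun := fun c => ρ (b * c) x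
      map_add' := fun c c' => by rw [mul_add, map_add, LinearMap.add_apply]
      map_smul' := fun z c => by rw [mul_smul_comm, map_smul]; rfl }
  let S : B →ₗ[ℂ] W := ρ b ∘ₗ ρ.flip x
  refine eq_of_mem_closure_span (T := T) (S := S) (C := ‖b‖ * ‖x‖) (fun c => ?_)
    (fun c => ?_) ?_ (ctx.dense_right c)
  · refine (hb (b * c) x).trans ?_
    calc _ ≤ ‖b‖ * ‖c‖ * ‖x‖ := mul_le_mul_of_nonneg_right (norm_mul_le b c) (norm_nonneg x)
      _ = _ := by ring
  · refine (hb b (ρ c x)).trans ?_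
    calc _ ≤ ‖b‖ * (‖c‖ * ‖x‖) := mul_le_mul_of_nonneg_left (hb c x) (norm_nonneg b)
      _ = _ := by ring
  · rintro c ⟨m, n, a, h⟩
    exact step c m n a h b

/-- A closed subspace containing the range of the action contains all `l ⊗ a x`: for
`a = k⋆ (m₁ a₁ n₁⋆) n` one has `l ⊗ a x = (l k⋆ m₁ a₁ n₁⋆) (n ⊗ x)`. -/
theorem IsAction.L_act_mem (hρ : fr.IsAction β ρ) {R : Submodule ℂ W}
    (hR : IsClosed (R : Set W)) (hmem : ∀ b x, ρ b x ∈ R) (l : M) (a : A) (x : U.carrier) :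
    fr.L l (U.act a x) ∈ R := by
  let T : A →ₗ[ℂ] W := (fr.L l : U.carrier →ₗ[ℂ] W) ∘ₗ U.act.flip x
  have hT : ∀ a, ‖T a‖ ≤ ‖(l : H →L[ℂ] K)‖ * ‖x‖ * ‖a‖ := by
    intro a
    refine (fr.norm_L_le l _).trans ?_
    calc _ ≤ ‖(l : H →L[ℂ] K)‖ * (‖a‖ * ‖x‖) :=
          mul_le_mul_of_nonneg_left (U.norm_act_le a x) (norm_nonneg _)
      _ = _ := by ring
  refine map_mem_of_mem_closure_span (T := T) hT hR ?_ (ctx.dense_left a)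
  rintro a ⟨k, n, b, hab⟩
  have ha : a = ctx.compress k n b :=
    CompletelyIsometric.injective ctx.isoLeft (by rw [hab, ctx.map_compress])
  rw [ha]
  let T' : B →ₗ[ℂ] W := T ∘ₗ ctx.compress k n
  have hT' : ∀ b, ‖T' b‖ ≤ ‖(l : H →L[ℂ] K)‖ * ‖x‖ *
      (‖adjoint (k : H →L[ℂ] K)‖ * ‖(n : H →L[ℂ] K)‖) * ‖b‖ := by
    intro b
    refine (hT _).trans ?_
    rw [mul_assoc (‖(l : H →L[ℂ] K)‖ * ‖x‖)]
    exact mul_le_mul_of_nonneg_left (ctx.norm_compress_le k n b) (by positivity)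
  refine map_mem_of_mem_closure_span (T := T') hT' hR ?_ (ctx.dense_right b)
  rintro b ⟨m₁, n₁, a₁, hb⟩
  have h1 := ctx.map_compress k n b
  rw [hb] at h1
  let m' : M := ⟨(l : H →L[ℂ] K) ∘L adjoint (k : H →L[ℂ] K) ∘L (m₁ : H →L[ℂ] K),
    ctx.equiv.isTRO _ l.2 _ k.2 _ m₁.2⟩
  obtain ⟨b', hb'⟩ := ctx.exists_right a₁ m'.2 n₁.2
  have h2 : T' b = ρ b' (fr.L n x) := by
    change fr.L l (U.act (ctx.compress k n b) x) = _
    rw [hρ b' m' n₁ a₁ hb', act_eq_of_map_eq ctx h1, fr.V_L, ← fr.L_comp l k m₁ m' _ rfl]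
  rw [h2]
  exact hmem _ _

theorem IsAction.essential (hρ : fr.IsAction β ρ) :
    Dense (Submodule.span ℂ {y | ∃ (b : B) (x : W), y = ρ b x} : Set W) := by
  set R : Submodule ℂ W := (Submodule.span ℂ {y | ∃ (b : B) (x : W), y = ρ b x}).topologicalClosure
    with hRdef
  have hR : IsClosed (R : Set W) := Submodule.isClosed_topologicalClosure _
  have hmem : ∀ b x, ρ b x ∈ R := fun b x =>
    Submodule.le_topologicalClosure _ (Submodule.subset_span ⟨b, x, rfl⟩)
  have hL : ∀ l x, fr.L l x ∈ R := fun l x => by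
    refine mem_of_mem_closure_span hR (fr.L l) ?_ (U.essential x)
    rintro _ ⟨a, x, rfl⟩
    exact hρ.L_act_mem ctx hR hmem l a x
  intro w
  refine mem_of_mem_closure_span hR (ContinuousLinearMap.id ℂ W) ?_ (fr.dense w)
  rintro _ ⟨l, x, rfl⟩
  exact hL l x

end ModuleFrame

end FrameAction

end DeltaMorita

namespace DeltaMorita

open OperatorSpace Filter Topology
open ContinuousLinearMap (adjoint)

/-! ### Functoriality and the existence of the tensor functor -/

section FrameMaps

variable {H₁ : Type w₁} [NormedAddCommGroup H₁] [InnerProductSpace ℂ H₁] [CompleteSpace H₁]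
variable {H₂ : Type w₂} [NormedAddCommGroup H₂] [InnerProductSpace ℂ H₂] [CompleteSpace H₂]
variable {H : Type u} [NormedAddCommGroup H] [InnerProductSpace ℂ H] [CompleteSpace H]
variable {K : Type u} [NormedAddCommGroup K] [InnerProductSpace ℂ K] [CompleteSpace K]
variable {A : NonUnitalSubalgebra ℂ (H₁ →L[ℂ] H₁)} {C : NonUnitalStarSubalgebra ℂ (H₁ →L[ℂ] H₁)}
variable {B : NonUnitalSubalgebra ℂ (H₂ →L[ℂ] H₂)} {D : NonUnitalStarSubalgebra ℂ (H₂ →L[ℂ] H₂)}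
variable {α : RepHom A H} {β : RepHom B K} {M : Submodule ℂ (H →L[ℂ] K)}

namespace ModuleFrame

variable {U V : OMod.{u} A} {W W' : Type u} [NormedAddCommGroup W] [NormedSpace ℂ W]
  [OperatorSpace W] [NormedAddCommGroup W'] [NormedSpace ℂ W'] [OperatorSpace W']
  (fr : ModuleFrame α M U W) (fr' : ModuleFrame α M V W') (f : U.carrier →L[ℂ] V.carrier)

/-- The operators `∑ L(mᵢ) f V(mᵢ)` approximating the map induced by `f`. -/
def approxMap (r : ContractiveRow M) : W →L[ℂ] W' :=
  ∑ p, fr'.L (r.entry p) ∘L f ∘L fr.V (r.entry p)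

theorem approxMap_apply (r : ContractiveRow M) (x : W) :
    fr.approxMap fr' f r x = ∑ p, fr'.L (r.entry p) (f (fr.V (r.entry p) x)) := by
  simp [approxMap]

theorem mnorm_approxMap_le {c : ℝ} (hc : 0 ≤ c) (hf : ∀ {ι κ : Type} [Fintype ι] [Fintype κ]
    (x : Matrix ι κ U.carrier), mnorm (x.map f) ≤ c * mnorm x) (r : ContractiveRow M)
    {ι κ : Type} [Fintype ι] [Fintype κ] (x : Matrix ι κ W) :
    mnorm (x.map (fr.approxMap fr' f r)) ≤ c * mnorm x := by
  let y : Matrix (ι × Fin r.n) κ U.carrier := Matrix.of fun ip j => fr.V (r.entry ip.2) (x ip.1 j)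
  have e : x.map (fr.approxMap fr' f r)
      = Matrix.of fun i j => ∑ p, fr'.L (r.entry p) ((y.map f) (i, p) j) :=
    Matrix.ext fun i j => fr.approxMap_apply fr' f r (x i j)
  rw [e]
  calc _ ≤ mnorm (y.map f) := fr'.mnorm_L_le r (y.map f)
    _ ≤ c * mnorm y := hf y
    _ ≤ c * mnorm x := mul_le_mul_of_nonneg_left (fr.mnorm_V_le r x) hc

theorem norm_approxMap_le {c : ℝ} (hc : 0 ≤ c) (hf : ∀ {ι κ : Type} [Fintype ι] [Fintype κ]
    (x : Matrix ι κ U.carrier), mnorm (x.map f) ≤ c * mnorm x) (r : ContractiveRow M) (x : W) :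
    ‖fr.approxMap fr' f r x‖ ≤ c * ‖x‖ :=
  norm_le_of_mnorm_unit (fr.mnorm_approxMap_le fr' f hc hf r (Matrix.of fun _ _ : Unit => x))

variable (ctx : DeltaContext C D α β M)
  (hact : ∀ (a : A) (x : U.carrier), f (U.act a x) = V.act a (f x))
include ctx hact

theorem map_V_L (n m : M) (x : U.carrier) : f (fr.V n (fr.L m x)) = fr'.V n (fr'.L m (f x)) := by
  rw [fr.V_L, fr'.V_L]
  exact map_multAct U ctx.left ctx.isoLeft f hact (ctx.comp_mem_leftMult n.2 m.2) x

theorem tendsto_approxMap_L {l : Filter (ContractiveRow M)}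
    (hl : ∀ m ∈ M, Tendsto (fun r : ContractiveRow M => r.gram ∘L m) l (𝓝 m)) (m : M)
    (x : U.carrier) :
    Tendsto (fun r => fr.approxMap fr' f r (fr.L m x)) l (𝓝 (fr'.L m (f x))) := by
  refine (fr'.tendsto_proj_L ctx.equiv.isTRO hl m (f x)).congr fun r => ?_
  rw [fr'.proj_apply, fr.approxMap_apply]
  exact Finset.sum_congr rfl fun p _ => by rw [fr.map_V_L fr' f ctx hact]

/-- A completely bounded module map `f` induces the map `m ⊗ u ↦ m ⊗ f u`. -/
theorem exists_map [CompleteSpace W'] {c : ℝ} (hc : 0 ≤ c)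
    (hf : ∀ {ι κ : Type} [Fintype ι] [Fintype κ]
      (x : Matrix ι κ U.carrier), mnorm (x.map f) ≤ c * mnorm x) :
    ∃ T : W →L[ℂ] W', (∀ m x, T (fr.L m x) = fr'.L m (f x)) ∧
      ∀ {ι κ : Type} [Fintype ι] [Fintype κ] (x : Matrix ι κ W),
        mnorm (x.map T) ≤ c * mnorm x := by
  obtain ⟨l, hl, hlim⟩ := ctx.equiv.isTRO.exists_filter
  have hlimL := fr.tendsto_approxMap_L fr' f ctx hact hlim
  let e : M × U.carrier → W := fun t => fr.L t.1 t.2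
  let g : M × U.carrier → W' := fun t => fr'.L t.1 (f t.2)
  have hd : Dense (Submodule.span ℂ (Set.range e) : Set W) := by
    refine fr.dense.mono (Submodule.span_mono ?_)
    rintro _ ⟨m, x, rfl⟩
    exact ⟨(m, x), rfl⟩
  have key : ∀ z : M × U.carrier →₀ ℂ,
      ‖z.sum fun t z => z • g t‖ ≤ c * ‖z.sum fun t z => z • e t‖ := by
    intro z
    have h : Tendsto (fun r => fr.approxMap fr' f r (z.sum fun t z => z • e t)) l
        (𝓝 (z.sum fun t z => z • g t)) := by
      simp only [Finsupp.sum, map_sum, map_smul]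
      exact tendsto_finsetSum _ fun t _ => (hlimL t.1 t.2).const_smul _
    exact le_of_tendsto h.norm
      (Eventually.of_forall fun r => fr.norm_approxMap_le fr' f hc hf r _)
  obtain ⟨T, hT, hT'⟩ := exists_clm_of_dense_span e g c hd key
  have hTL : ∀ m x, T (fr.L m x) = fr'.L m (f x) := fun m x => hT (m, x)
  refine ⟨T, hTL, fun {ι κ} _ _ x => ?_⟩
  have hlimT : ∀ w, Tendsto (fun r => fr.approxMap fr' f r w) l (𝓝 (T w)) := by
    intro w
    refine tendsto_of_mem_closure_span (C := c)
      (T := fun r : ContractiveRow M => (fr.approxMap fr' f r : W →ₗ[ℂ] W'))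
      (S := (T : W →ₗ[ℂ] W')) (fr.norm_approxMap_le fr' f hc hf) hT' ?_ (fr.dense w)
    rintro _ ⟨m, x, rfl⟩
    change Tendsto _ l (𝓝 (T (fr.L m x)))
    rw [hTL]
    exact hlimL m x
  have h : Tendsto (fun r => mnorm (x.map (fr.approxMap fr' f r))) l (𝓝 (mnorm (x.map T))) :=
    tendsto_mnorm fun i j => hlimT (x i j)
  exact le_of_tendsto h (Eventually.of_forall fun r => fr.mnorm_approxMap_le fr' f hc hf r x)

/-- The induced map intertwines the annihilation operators. -/
theorem map_V {T : W →L[ℂ] W'} (hT : ∀ m x, T (fr.L m x) = fr'.L m (f x)) (n : M) (x : W) :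
    f (fr.V n x) = fr'.V n (T x) := by
  have : f ∘L fr.V n = fr'.V n ∘L T := by
    refine clm_ext_of_dense_span fr.dense ?_
    rintro _ ⟨m, x, rfl⟩
    change f (fr.V n (fr.L m x)) = fr'.V n (T (fr.L m x))
    rw [hT, fr.map_V_L fr' f ctx hact]
  exact DFunLike.congr_fun this x

/-- The induced map is a `B`-module map. -/
theorem map_action {ρ : B →ₗ[ℂ] W →ₗ[ℂ] W} {ρ' : B →ₗ[ℂ] W' →ₗ[ℂ] W'} (hρ : fr.IsAction β ρ)
    (hρ' : fr'.IsAction β ρ') (hb : ∀ b x, ‖ρ b x‖ ≤ ‖b‖ * ‖x‖)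
    (hb' : ∀ b x, ‖ρ' b x‖ ≤ ‖b‖ * ‖x‖) {T : W →L[ℂ] W'}
    (hT : ∀ m x, T (fr.L m x) = fr'.L m (f x)) (b : B) (x : W) : T (ρ b x) = ρ' b (T x) := by
  let S : B →ₗ[ℂ] W' := (T : W →ₗ[ℂ] W') ∘ₗ ρ.flip x
  have h1 : ∀ b, ‖S b‖ ≤ ‖T‖ * ‖x‖ * ‖b‖ := by
    intro b
    refine (T.le_opNorm _).trans ?_
    calc _ ≤ ‖T‖ * (‖b‖ * ‖x‖) := mul_le_mul_of_nonneg_left (hb b x) (norm_nonneg _)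
      _ = _ := by ring
  have h2 : ∀ b, ‖ρ'.flip (T x) b‖ ≤ ‖T‖ * ‖x‖ * ‖b‖ := by
    intro b
    refine (hb' b (T x)).trans ?_
    calc _ ≤ ‖b‖ * (‖T‖ * ‖x‖) := mul_le_mul_of_nonneg_left (T.le_opNorm x) (norm_nonneg _)
      _ = _ := by ring
  refine eq_of_mem_closure_span (T := S) (S := ρ'.flip (T x)) h1 h2 ?_ (ctx.dense_right b)
  rintro b ⟨m, n, a, h⟩
  change T (ρ b x) = ρ' b (T x)
  rw [hρ b m n a h, hρ' b m n a h, hT, hact, fr.map_V fr' f ctx hact hT]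

end ModuleFrame

end FrameMaps

section Existence

variable {H₁ : Type w₁} [NormedAddCommGroup H₁] [InnerProductSpace ℂ H₁] [CompleteSpace H₁]
variable {H₂ : Type w₂} [NormedAddCommGroup H₂] [InnerProductSpace ℂ H₂] [CompleteSpace H₂]
variable {H : Type u} [NormedAddCommGroup H] [InnerProductSpace ℂ H] [CompleteSpace H]
variable {K : Type u} [NormedAddCommGroup K] [InnerProductSpace ℂ K] [CompleteSpace K]
variable {A : NonUnitalSubalgebra ℂ (H₁ →L[ℂ] H₁)} {C : NonUnitalStarSubalgebra ℂ (H₁ →L[ℂ] H₁)}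
variable {B : NonUnitalSubalgebra ℂ (H₂ →L[ℂ] H₂)} {D : NonUnitalStarSubalgebra ℂ (H₂ →L[ℂ] H₂)}
variable {α : RepHom A H} {β : RepHom B K} {M : Submodule ℂ (H →L[ℂ] K)}
/-- A completely bounded module map, as a bounded operator. -/
theorem OMod.Hom.exists_clm {U V : OMod.{u} A} (f : U ⟶ V) :
    ∃ (g : U.carrier →L[ℂ] V.carrier) (c : ℝ), 0 ≤ c ∧ (∀ x, g x = OMod.lin f x) ∧
      ∀ {ι κ : Type} [Fintype ι] [Fintype κ] (x : Matrix ι κ U.carrier),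
        mnorm (x.map g) ≤ c * mnorm x := by
  obtain ⟨c, hc, h⟩ := f.completelyBounded
  exact ⟨f.toLin.mkContinuous c fun x => norm_le_of_mnorm_unit (h (Matrix.of fun _ _ : Unit => x)),
    c, hc, fun x => rfl, h⟩

variable (ctx : DeltaContext C D α β M)
include ctx

/-- The balanced Haagerup tensor product as an operator module over `B`. -/
theorem exists_tensorModule (U : OMod.{u} A) :
    ∃ (N : OMod.{u} B) (τ : M ⊗[ℂ] U.carrier →ₗ[ℂ] N.carrier)
      (hτ : IsBalancedHaagerupTensor α M U N.carrier τ), (hτ.frame ctx U).IsAction β N.act := by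
  obtain ⟨W, i1, i2, i3, i4, τ, hτ⟩ := exists_isBalancedHaagerupTensor α M U
  obtain ⟨ρ, hρ, hb⟩ := (hτ.frame ctx U).exists_isAction ctx
  exact ⟨{  carrier := W
            act := ρ
            act_mul := hρ.map_mul ctx hb
            mnorm_act_le := hρ.mnorm_le ctx hb
            essential := hρ.essential ctx }, τ, hτ, hρ⟩

namespace DeltaContext

/-- A choice of the tensor product module. -/
def tensorModule (U : OMod.{u} A) : OMod.{u} B := (exists_tensorModule ctx U).choose

/-- The canonical map to the tensor product module. -/
def tensorMk (U : OMod.{u} A) : M ⊗[ℂ] U.carrier →ₗ[ℂ] (ctx.tensorModule U).carrier :=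
  (exists_tensorModule ctx U).choose_spec.choose

theorem isBalancedHaagerupTensor_tensorMk (U : OMod.{u} A) :
    IsBalancedHaagerupTensor α M U (ctx.tensorModule U).carrier (ctx.tensorMk U) :=
  (exists_tensorModule ctx U).choose_spec.choose_spec.choose

/-- The frame of the tensor product module. -/
def tensorFrame (U : OMod.{u} A) : ModuleFrame α M U (ctx.tensorModule U).carrier :=
  (ctx.isBalancedHaagerupTensor_tensorMk U).frame ctx U

theorem isAction_tensorFrame (U : OMod.{u} A) :
    (ctx.tensorFrame U).IsAction β (ctx.tensorModule U).act :=
  (exists_tensorModule ctx U).choose_spec.choose_spec.choose_spec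

theorem exists_tensorMap {U V : OMod.{u} A} (f : U ⟶ V) :
    ∃ F : ctx.tensorModule U ⟶ ctx.tensorModule V, ∀ l x,
      OMod.lin F (ctx.tensorMk U (l ⊗ₜ[ℂ] x)) = ctx.tensorMk V (l ⊗ₜ[ℂ] OMod.lin f x) := by
  obtain ⟨g, c, hc, hg, hcb⟩ := OMod.Hom.exists_clm f
  have hact : ∀ (a : A) (x : U.carrier), g (U.act a x) = V.act a (g x) := fun a x => by
    rw [hg, hg]; exact f.map_act a x
  obtain ⟨T, hT, hTc⟩ := (ctx.tensorFrame U).exists_map (ctx.tensorFrame V) g ctx hact hc hcb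
  refine ⟨⟨(T : (ctx.tensorModule U).carrier →ₗ[ℂ] (ctx.tensorModule V).carrier),
    ⟨c, hc, hTc⟩, ?_⟩, fun l x => ?_⟩
  · exact (ctx.tensorFrame U).map_action (ctx.tensorFrame V) g ctx hact
      (ctx.isAction_tensorFrame U) (ctx.isAction_tensorFrame V) (ctx.tensorModule U).norm_act_le
      (ctx.tensorModule V).norm_act_le hT
  · rw [← hg]
    exact hT l x

theorem tensorMap_ext {U : OMod.{u} A} {N : OMod.{u} B} {F G : ctx.tensorModule U ⟶ N}
    (h : ∀ l x, OMod.lin F (ctx.tensorMk U (l ⊗ₜ[ℂ] x)) = OMod.lin G (ctx.tensorMk U (l ⊗ₜ[ℂ] x))) :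
    F = G := by
  obtain ⟨F', -, -, hF, -⟩ := OMod.Hom.exists_clm F
  obtain ⟨G', -, -, hG, -⟩ := OMod.Hom.exists_clm G
  have e : F' = G' := by
    refine clm_ext_of_dense_span (ctx.tensorFrame U).dense ?_
    rintro _ ⟨l, x, rfl⟩
    rw [hF, hG]
    exact h l x
  refine OMod.Hom.ext (LinearMap.ext fun x => ?_)
  exact (hF x).symm.trans ((DFunLike.congr_fun e x).trans (hG x))

/-- The functor on objects and morphisms. -/
def tensorMap {U V : OMod.{u} A} (f : U ⟶ V) : ctx.tensorModule U ⟶ ctx.tensorModule V :=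
  (ctx.exists_tensorMap f).choose

theorem tensorMap_mk {U V : OMod.{u} A} (f : U ⟶ V) (l : M) (x : U.carrier) :
    OMod.lin (ctx.tensorMap f) (ctx.tensorMk U (l ⊗ₜ[ℂ] x)) =
      ctx.tensorMk V (l ⊗ₜ[ℂ] OMod.lin f x) :=
  (ctx.exists_tensorMap f).choose_spec l x

/-- The functor `U ↦ M ⊗ₑʰ U`. -/
def tensorFunctor : TensorFunctor α β M where
  functor :=
    { obj := ctx.tensorModule
      map := ctx.tensorMap
      map_id := fun U => ctx.tensorMap_ext fun l x => ctx.tensorMap_mk (𝟙 U) l x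
      map_comp := fun {U V W} f g => ctx.tensorMap_ext fun l x => by
        rw [ctx.tensorMap_mk]
        change _ = OMod.lin (ctx.tensorMap g)
          (OMod.lin (ctx.tensorMap f) (ctx.tensorMk U (l ⊗ₜ[ℂ] x)))
        rw [ctx.tensorMap_mk, ctx.tensorMap_mk]
        rfl }
  tens := ctx.tensorMk
  isTensor := ctx.isBalancedHaagerupTensor_tensorMk
  act_tens U b m n l a a' x hb ha' := by
    have h := ctx.isAction_tensorFrame U b m n a hb ((ctx.tensorFrame U).L l x)
    have hnl := ctx.comp_mem_leftMult n.2 l.2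
    rw [(ctx.tensorFrame U).V_L, ← U.actL_apply, ← multAct_map U ctx.left ctx.isoLeft,
      ← multAct_mul U ctx.left ctx.isoLeft (map_mem_leftMult a) hnl, ← ha',
      multAct_map U ctx.left ctx.isoLeft] at h
    exact h
  map_tens f l x := ctx.tensorMap_mk f l x

end DeltaContext

end Existence

end DeltaMorita

namespace DeltaMorita

open OperatorSpace Filter Topology
open ContinuousLinearMap (adjoint)

/-! ### Multipliers acting on Hilbert space representations -/

section ColumnVectors

variable {ι κ : Type} [Fintype ι] [Fintype κ]
variable {X : Type u} [NormedAddCommGroup X] [InnerProductSpace ℂ X]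

theorem sum_norm_sq_columnOp_le (x : Matrix ι κ X) (z : κ → ℂ) :
    ∑ i, ‖∑ j, z j • x i j‖ ^ 2 ≤ matNorm (columnOp x) ^ 2 * ∑ j, ‖z j‖ ^ 2 := by
  have h := sum_norm_sq_le (columnOp x) z
  simpa only [columnOp_apply] using h

theorem matNorm_columnOp_le (x : Matrix ι κ X) {c : ℝ} (hc : 0 ≤ c)
    (h : ∀ z : κ → ℂ, ∑ i, ‖∑ j, z j • x i j‖ ^ 2 ≤ c ^ 2 * ∑ j, ‖z j‖ ^ 2) :
    matNorm (columnOp x) ≤ c :=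
  matNorm_le hc fun z => by simpa only [columnOp_apply] using h z

/-- The norm of a column of vectors in the column operator space is its Hilbert space norm. -/
theorem matNorm_columnOp_vec (y : ι → X) :
    matNorm (columnOp (Matrix.of fun i (_ : Unit) => y i)) ^ 2 = ∑ i, ‖y i‖ ^ 2 := by
  apply le_antisymm
  · have h : matNorm (columnOp (Matrix.of fun i (_ : Unit) => y i)) ≤ √(∑ i, ‖y i‖ ^ 2) := by
      refine matNorm_columnOp_le _ (Real.sqrt_nonneg _) fun z => ?_
      rw [Real.sq_sqrt (by positivity), Finset.sum_mul]
      refine Finset.sum_le_sum fun i _ => ?_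
      simp [norm_smul, mul_pow, mul_comm]
    refine (pow_le_pow_left₀ (matNorm_nonneg _) h 2).trans_eq ?_
    rw [Real.sq_sqrt (by positivity)]
  · have h := sum_norm_sq_columnOp_le (Matrix.of fun i (_ : Unit) => y i) (fun _ => 1)
    simpa using h

end ColumnVectors

section HilbertMultipliers

variable {H₁ : Type w₁} [NormedAddCommGroup H₁] [InnerProductSpace ℂ H₁] [CompleteSpace H₁]
variable {H : Type u} [NormedAddCommGroup H] [InnerProductSpace ℂ H] [CompleteSpace H]
variable {A : NonUnitalSubalgebra ℂ (H₁ →L[ℂ] H₁)} {C : NonUnitalStarSubalgebra ℂ (H₁ →L[ℂ] H₁)}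
variable (α : RepHom A H) (X : HMod.{u} A)

/-- The operator by which a left multiplier of `α(A)` acts on a representation. -/
def hilbertMult (T : H →L[ℂ] H) : X.carrier →L[ℂ] X.carrier := multAct α X.column T

variable {α} (hAC : IsDeltaPair A C) (hα : CompletelyIsometric α)
include hAC hα

theorem hilbertMult_rep {T : H →L[ℂ] H} (hT : T ∈ leftMult α) {a a' : A} (h : α a' = T ∘L α a)
    (x : X.carrier) : hilbertMult α X T (X.rep a x) = X.rep a' x :=
  multAct_act X.column hAC hα hT h x

theorem hilbertMult_one : hilbertMult α X 1 = ContinuousLinearMap.id ℂ X.carrier :=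
  multAct_one X.column hAC hα

theorem hilbertMult_mul {S T : H →L[ℂ] H} (hS : S ∈ leftMult α) (hT : T ∈ leftMult α)
    (x : X.carrier) : hilbertMult α X (S ∘L T) x = hilbertMult α X S (hilbertMult α X T x) :=
  multAct_mul X.column hAC hα hS hT x

theorem hilbertMult_add {S T : H →L[ℂ] H} (hS : S ∈ leftMult α) (hT : T ∈ leftMult α) :
    hilbertMult α X (S + T) = hilbertMult α X S + hilbertMult α X T :=
  multAct_add X.column hAC hα hS hT

theorem hilbertMult_smul (z : ℂ) {T : H →L[ℂ] H} (hT : T ∈ leftMult α) :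
    hilbertMult α X (z • T) = z • hilbertMult α X T :=
  multAct_smul X.column hAC hα z hT

theorem norm_hilbertMult_le {T : H →L[ℂ] H} (hT : T ∈ leftMult α) (x : X.carrier) :
    ‖hilbertMult α X T x‖ ≤ ‖T‖ * ‖x‖ :=
  norm_multAct_le X.column hAC hα hT x

/-- Multipliers act completely contractively on columns of vectors. -/
theorem sum_norm_sq_hilbertMult_le {ι κ : Type} [Fintype ι] [Fintype κ]
    (T : Matrix ι κ (H →L[ℂ] H)) (hT : ∀ i k, T i k ∈ leftMult α) (y : κ → X.carrier) :
    ∑ i, ‖∑ k, hilbertMult α X (T i k) (y k)‖ ^ 2 ≤ matNorm T ^ 2 * ∑ k, ‖y k‖ ^ 2 := by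
  have h := mnorm_multAct_le X.column hAC hα T hT
    (Matrix.of fun (k : κ) (_ : Unit) => (y k : X.carrier))
  change matNorm (columnOp (Matrix.of fun (i : ι) (_ : Unit) =>
    ∑ k, hilbertMult α X (T i k) (y k))) ≤
    matNorm T * matNorm (columnOp (Matrix.of fun (k : κ) (_ : Unit) => y k)) at h
  rw [← matNorm_columnOp_vec, ← matNorm_columnOp_vec, ← mul_pow]
  exact pow_le_pow_left₀ (matNorm_nonneg _) h 2

/-- A self-adjoint multiplier acts as a symmetric operator. Contractivity of the action gives
`‖(1 + itT) x‖² ≤ (1 + t² ‖T‖²) ‖x‖²` for all real `t`, and the term of first order in `t` must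
vanish. -/
theorem inner_hilbertMult_self_of_selfAdjoint {T : H →L[ℂ] H} (hT : T ∈ leftMult α)
    (hsa : adjoint T = T) (x : X.carrier) : (⟪hilbertMult α X T x, x⟫_ℂ).im = 0 := by
  set S := hilbertMult α X T with hS
  have h1 : ∀ t : ℝ, 1 + ((t : ℂ) * Complex.I) • T ∈ leftMult α := fun t =>
    add_mem (one_mem _) ((leftMult α).smul_mem hT _)
  have h2 : ∀ t : ℝ, hilbertMult α X (1 + ((t : ℂ) * Complex.I) • T) x =
      x + ((t : ℂ) * Complex.I) • S x := by
    intro t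
    rw [hilbertMult_add X hAC hα (one_mem _) ((leftMult α).smul_mem hT _),
      hilbertMult_smul X hAC hα _ hT, hilbertMult_one X hAC hα]
    rfl
  have hTreal : ∀ y : H, (⟪y, T y⟫_ℂ).im = 0 := by
    intro y
    have h := inner_conj_symm (𝕜 := ℂ) y (T y)
    rw [← hsa, ContinuousLinearMap.adjoint_inner_left, hsa] at h
    exact Complex.conj_eq_iff_im.1 h
  have h3 : ∀ t : ℝ, ‖(1 + ((t : ℂ) * Complex.I) • T : H →L[ℂ] H)‖ ^ 2 ≤ 1 + t ^ 2 * ‖T‖ ^ 2 := by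
    intro t
    have h : ‖(1 + ((t : ℂ) * Complex.I) • T : H →L[ℂ] H)‖ ≤ √(1 + t ^ 2 * ‖T‖ ^ 2) := by
      refine ContinuousLinearMap.opNorm_le_bound _ (Real.sqrt_nonneg _) fun y => ?_
      refine le_of_sq_le_sq ?_ (by positivity)
      rw [mul_pow, Real.sq_sqrt (by positivity)]
      change ‖y + ((t : ℂ) * Complex.I) • T y‖ ^ 2 ≤ _
      rw [norm_add_sq (𝕜 := ℂ), inner_smul_right, norm_smul, mul_pow]
      have e1 : RCLike.re ((t : ℂ) * Complex.I * ⟪y, T y⟫_ℂ) = 0 := by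
        simp [hTreal y]
      have e2 : ‖(t : ℂ) * Complex.I‖ ^ 2 = t ^ 2 := by simp
      rw [e1, e2]
      have := pow_le_pow_left₀ (norm_nonneg _) (T.le_opNorm y) 2
      nlinarith [sq_nonneg t]
    refine (pow_le_pow_left₀ (norm_nonneg _) h 2).trans_eq ?_
    rw [Real.sq_sqrt (by positivity)]
  have h4 : ∀ t : ℝ, 2 * (t * (⟪S x, x⟫_ℂ).im) ≤ t ^ 2 * (‖T‖ ^ 2 * ‖x‖ ^ 2) := by
    intro t
    have h := pow_le_pow_left₀ (norm_nonneg _) (norm_hilbertMult_le X hAC hα (h1 t) x) 2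
    rw [h2, mul_pow, norm_add_sq (𝕜 := ℂ), inner_smul_right] at h
    have e1 : RCLike.re ((t : ℂ) * Complex.I * ⟪x, S x⟫_ℂ) = t * (⟪S x, x⟫_ℂ).im := by
      have e0 : (⟪x, S x⟫_ℂ).im = -(⟪S x, x⟫_ℂ).im := by
        rw [← inner_conj_symm x (S x), Complex.conj_im]
      simp [e0]
    rw [e1] at h
    have h5 := mul_le_mul_of_nonneg_right (h3 t) (sq_nonneg ‖x‖)
    nlinarith [sq_nonneg ‖((t : ℂ) * Complex.I) • S x‖]
  generalize (⟪S x, x⟫_ℂ).im = s at h4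
  generalize ‖T‖ ^ 2 * ‖x‖ ^ 2 = c at h4
  by_contra hs
  have hc : 0 ≤ c := by
    have p1 := h4 1
    have p2 := h4 (-1)
    linarith
  have h5 := h4 (s / (c + 1))
  have h6 : 2 * (s / (c + 1) * s) ≤ (s / (c + 1)) ^ 2 * (c + 1) :=
    h5.trans (mul_le_mul_of_nonneg_left (by linarith) (sq_nonneg _))
  have h7 : (s / (c + 1)) ^ 2 * (c + 1) = s / (c + 1) * s := by field_simp
  rw [h7] at h6
  have h8 : 0 < s / (c + 1) * s := by
    rw [div_mul_eq_mul_div]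
    have : 0 < s * s := mul_self_pos.2 hs
    positivity
  linarith

theorem adjoint_hilbertMult_of_selfAdjoint {T : H →L[ℂ] H} (hT : T ∈ leftMult α)
    (hsa : adjoint T = T) : adjoint (hilbertMult α X T) = hilbertMult α X T := by
  have h : ((hilbertMult α X T : X.carrier →L[ℂ] X.carrier) :
      X.carrier →ₗ[ℂ] X.carrier).IsSymmetric := by
    rw [LinearMap.isSymmetric_iff_inner_map_self_real]
    intro x
    exact Complex.conj_eq_iff_im.2 (inner_hilbertMult_self_of_selfAdjoint X hAC hα hT hsa x)
  exact (ContinuousLinearMap.eq_adjoint_iff _ _).2 (fun x y => h x y) |>.symm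

/-- Multipliers whose adjoints are multipliers act as a `⋆`-representation. -/
theorem adjoint_hilbertMult {T : H →L[ℂ] H} (hT : T ∈ leftMult α) (hT' : adjoint T ∈ leftMult α) :
    adjoint (hilbertMult α X T) = hilbertMult α X (adjoint T) := by
  set S : H →L[ℂ] H := T + adjoint T with hS
  set R : H →L[ℂ] H := Complex.I • T + (-Complex.I) • adjoint T with hR
  have mS : S ∈ leftMult α := add_mem hT hT'
  have mR : R ∈ leftMult α :=
    add_mem ((leftMult α).smul_mem hT _) ((leftMult α).smul_mem hT' _)
  have aS : adjoint S = S := by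
    rw [hS, map_add, ContinuousLinearMap.adjoint_adjoint, add_comm]
  have aR : adjoint R = R := by
    rw [hR, map_add, map_smulₛₗ, map_smulₛₗ, ContinuousLinearMap.adjoint_adjoint, add_comm]
    simp
  have e1 := hilbertMult_add X hAC hα hT hT'
  have e2 := hilbertMult_add X hAC hα ((leftMult α).smul_mem hT Complex.I)
    ((leftMult α).smul_mem hT' (-Complex.I))
  rw [hilbertMult_smul X hAC hα _ hT, hilbertMult_smul X hAC hα _ hT'] at e2
  have f1 := adjoint_hilbertMult_of_selfAdjoint X hAC hα mS aS
  have f2 := adjoint_hilbertMult_of_selfAdjoint X hAC hα mR aR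
  rw [e1, map_add] at f1
  rw [e2, map_add, map_smulₛₗ, map_smulₛₗ] at f2
  generalize hilbertMult α X T = P at f1 f2 ⊢
  generalize hilbertMult α X (adjoint T) = Q at f1 f2 ⊢
  have f3 : Complex.I • (adjoint P - adjoint Q) = Complex.I • (Q - P) := by
    simp only [Complex.conj_I, map_neg, neg_neg] at f2
    rw [← sub_eq_zero] at f2
    rw [← sub_eq_zero, ← neg_eq_zero, ← f2]
    module
  have f4 := smul_right_injective _ Complex.I_ne_zero f3
  have g : (2 : ℂ) • (adjoint P - Q) = 0 := by
    have f5 : adjoint P - adjoint Q = Q - P := f4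
    rw [← sub_eq_zero] at f1 f5
    have f6 := congrArg₂ (· + ·) f1 f5
    simp only [add_zero] at f6
    rw [← f6]
    module
  rw [smul_eq_zero, sub_eq_zero] at g
  exact g.resolve_left two_ne_zero

end HilbertMultipliers

end DeltaMorita

namespace DeltaMorita

open OperatorSpace Filter Topology
open ContinuousLinearMap (adjoint)

/-! ### The tensor product with a Hilbert space representation is a Hilbert space -/

section HilbertFrame

variable {H₁ : Type w₁} [NormedAddCommGroup H₁] [InnerProductSpace ℂ H₁] [CompleteSpace H₁]
variable {H₂ : Type w₂} [NormedAddCommGroup H₂] [InnerProductSpace ℂ H₂] [CompleteSpace H₂]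
variable {H : Type u} [NormedAddCommGroup H] [InnerProductSpace ℂ H] [CompleteSpace H]
variable {K : Type u} [NormedAddCommGroup K] [InnerProductSpace ℂ K] [CompleteSpace K]
variable {A : NonUnitalSubalgebra ℂ (H₁ →L[ℂ] H₁)} {C : NonUnitalStarSubalgebra ℂ (H₁ →L[ℂ] H₁)}
variable {B : NonUnitalSubalgebra ℂ (H₂ →L[ℂ] H₂)} {D : NonUnitalStarSubalgebra ℂ (H₂ →L[ℂ] H₂)}
variable {α : RepHom A H} {β : RepHom B K} {M : Submodule ℂ (H →L[ℂ] K)}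

namespace ModuleFrame

variable {X : HMod.{u} A}

section Norm

variable {W : Type u} [NormedAddCommGroup W] [NormedSpace ℂ W] [OperatorSpace W]
  (fr : ModuleFrame α M X.column W)

/-- The creation operators, on the Hilbert space underlying a column module. -/
def hilbertL : M →ₗ[ℂ] (X.carrier →L[ℂ] W) := fr.L

/-- The annihilation operators, on the Hilbert space underlying a column module. -/
def hilbertV (n : M) : W →L[ℂ] X.carrier := fr.V n

theorem hilbertV_L (n l : M) (x : X.carrier) : fr.hilbertV n (fr.hilbertL l x) =
    hilbertMult α X (adjoint (n : H →L[ℂ] K) ∘L (l : H →L[ℂ] K)) x :=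
  fr.V_L n l x

theorem proj_apply_hilbert (r : ContractiveRow M) (w : W) :
    fr.proj r w = ∑ p, fr.hilbertL (r.entry p) (fr.hilbertV (r.entry p) w) :=
  fr.proj_apply r w

/-- The matrix with entries `V(mₚ) wᵢⱼ` for a contractive row `m`. -/
def colV (r : ContractiveRow M) {ι κ : Type} (t : Matrix ι κ W) :
    Matrix (ι × Fin r.n) κ X.carrier :=
  Matrix.of fun ip j => fr.hilbertV (r.entry ip.2) (t ip.1 j)

theorem matNorm_colV_le (r : ContractiveRow M) {ι κ : Type} [Fintype ι] [Fintype κ]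
    (t : Matrix ι κ W) : matNorm (columnOp (fr.colV r t)) ≤ mnorm t :=
  fr.mnorm_V_le r t

theorem mnorm_proj_le_matNorm_colV (r : ContractiveRow M) {ι κ : Type} [Fintype ι] [Fintype κ]
    (t : Matrix ι κ W) : mnorm (t.map (fr.proj r)) ≤ matNorm (columnOp (fr.colV r t)) := by
  have e : t.map (fr.proj r) =
      Matrix.of fun i j => ∑ p, fr.L (r.entry p) (fr.colV r t (i, p) j) :=
    Matrix.ext fun i j => fr.proj_apply r (t i j)
  rw [e]
  exact fr.mnorm_L_le r (fr.colV r t)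

theorem matNorm_colV_unit (r : ContractiveRow M) (w : W) :
    matNorm (columnOp (fr.colV r (Matrix.of fun _ _ : Unit => w))) ^ 2 =
      ∑ p, ‖fr.hilbertV (r.entry p) w‖ ^ 2 := by
  have h := matNorm_columnOp_vec fun ip : Unit × Fin r.n => fr.hilbertV (r.entry ip.2) w
  rw [Fintype.sum_prod_type, Fintype.sum_unique] at h
  exact h

theorem sum_norm_sq_hilbertV_le (r : ContractiveRow M) (w : W) :
    ∑ p, ‖fr.hilbertV (r.entry p) w‖ ^ 2 ≤ ‖w‖ ^ 2 := by
  rw [← matNorm_colV_unit, ← mnorm_unit w]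
  exact pow_le_pow_left₀ (matNorm_nonneg _) (fr.matNorm_colV_le r _) 2

/-- Together with `sum_norm_sq_hilbertV_le` this squeezes the norm of `W` between Hilbert space
norms. -/
theorem norm_sq_proj_le (r : ContractiveRow M) (w : W) :
    ‖fr.proj r w‖ ^ 2 ≤ ∑ p, ‖fr.hilbertV (r.entry p) w‖ ^ 2 := by
  rw [← matNorm_colV_unit, ← mnorm_unit (fr.proj r w)]
  exact pow_le_pow_left₀ (mnorm_nonneg _) (fr.mnorm_proj_le_matNorm_colV r
    (Matrix.of fun _ _ : Unit => w)) 2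

variable (hM : IsTRO M)
include fr hM

theorem tendsto_sum_norm_sq_hilbertV {l : Filter (ContractiveRow M)}
    (hl : ∀ m ∈ M, Tendsto (fun r : ContractiveRow M => r.gram ∘L m) l (𝓝 m)) (w : W) :
    Tendsto (fun r : ContractiveRow M => ∑ p, ‖fr.hilbertV (r.entry p) w‖ ^ 2) l
      (𝓝 (‖w‖ ^ 2)) :=
  tendsto_of_tendsto_of_tendsto_of_le_of_le ((fr.tendsto_proj hM hl w).norm.pow 2)
    tendsto_const_nhds (fun r => fr.norm_sq_proj_le r w) (fun r => fr.sum_norm_sq_hilbertV_le r w)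

/-- The norm is a limit of Hilbert space norms, so it satisfies the parallelogram law. -/
theorem parallelogram (v w : W) :
    ‖v + w‖ * ‖v + w‖ + ‖v - w‖ * ‖v - w‖ = 2 * (‖v‖ * ‖v‖ + ‖w‖ * ‖w‖) := by
  obtain ⟨l, hl, hlim⟩ := hM.exists_filter
  simp only [← pow_two]
  refine tendsto_nhds_unique
    ((fr.tendsto_sum_norm_sq_hilbertV hM hlim (v + w)).add
      (fr.tendsto_sum_norm_sq_hilbertV hM hlim (v - w)))
    (((fr.tendsto_sum_norm_sq_hilbertV hM hlim v).add
      (fr.tendsto_sum_norm_sq_hilbertV hM hlim w)).const_mul 2 |>.congr fun r => ?_)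
  rw [← Finset.sum_add_distrib, ← Finset.sum_add_distrib, Finset.mul_sum]
  refine Finset.sum_congr rfl fun p _ => ?_
  rw [map_add, map_sub]
  have := parallelogram_law_with_norm ℂ (fr.hilbertV (r.entry p) v) (fr.hilbertV (r.entry p) w)
  nlinarith [this]

end Norm

section Inner

variable {W : Type u} [NormedAddCommGroup W] [InnerProductSpace ℂ W] [OperatorSpace W]
  (fr : ModuleFrame α M X.column W)

theorem matNorm_colV_le_columnOp (r : ContractiveRow M) {ι κ : Type} [Fintype ι] [Fintype κ]
    (t : Matrix ι κ W) : matNorm (columnOp (fr.colV r t)) ≤ matNorm (columnOp t) := by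
  refine matNorm_columnOp_le _ (matNorm_nonneg _) fun z => ?_
  refine le_trans ?_ (sum_norm_sq_columnOp_le t z)
  rw [Fintype.sum_prod_type]
  refine Finset.sum_le_sum fun i _ => ?_
  refine le_trans (le_of_eq ?_) (fr.sum_norm_sq_hilbertV_le r (∑ j, z j • t i j))
  refine Finset.sum_congr rfl fun p _ => ?_
  rw [map_sum]
  simp only [map_smul]
  rfl

variable (hM : IsTRO M)
include fr hM

/-- The matrix norms of `W` are those of the column operator space. -/
theorem mnorm_eq_column {ι κ : Type} [Fintype ι] [Fintype κ] (t : Matrix ι κ W) :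
    mnorm t = matNorm (columnOp t) := by
  obtain ⟨l, hl, hlim⟩ := hM.exists_filter
  apply le_antisymm
  · have h : Tendsto (fun r => mnorm (t.map (fr.proj r))) l (𝓝 (mnorm t)) :=
      tendsto_mnorm fun i j => fr.tendsto_proj hM hlim (t i j)
    exact le_of_tendsto h (Eventually.of_forall fun r =>
      (fr.mnorm_proj_le_matNorm_colV r t).trans (fr.matNorm_colV_le_columnOp r t))
  · refine matNorm_columnOp_le t (mnorm_nonneg t) fun z => ?_
    have h : Tendsto (fun r : ContractiveRow M =>
        ∑ i, ∑ p, ‖fr.hilbertV (r.entry p) (∑ j, z j • t i j)‖ ^ 2) l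
        (𝓝 (∑ i, ‖∑ j, z j • t i j‖ ^ 2)) :=
      tendsto_finsetSum _ fun i _ => fr.tendsto_sum_norm_sq_hilbertV hM hlim _
    refine le_of_tendsto h (Eventually.of_forall fun r => ?_)
    have h1 := sum_norm_sq_columnOp_le (fr.colV r t) z
    rw [Fintype.sum_prod_type] at h1
    have h2 : ∑ i, ∑ p, ‖fr.hilbertV (r.entry p) (∑ j, z j • t i j)‖ ^ 2 ≤
        matNorm (columnOp (fr.colV r t)) ^ 2 * ∑ j, ‖z j‖ ^ 2 := by
      refine le_trans (le_of_eq ?_) h1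
      refine Finset.sum_congr rfl fun i _ => Finset.sum_congr rfl fun p _ => ?_
      rw [map_sum]
      simp only [map_smul]
      rfl
    refine h2.trans (mul_le_mul_of_nonneg_right ?_ (by positivity))
    exact pow_le_pow_left₀ (matNorm_nonneg _) (fr.matNorm_colV_le r t) 2

theorem tendsto_sum_inner_hilbertV {l : Filter (ContractiveRow M)}
    (hl : ∀ m ∈ M, Tendsto (fun r : ContractiveRow M => r.gram ∘L m) l (𝓝 m)) (v w : W) :
    Tendsto (fun r : ContractiveRow M =>
      ∑ p, ⟪fr.hilbertV (r.entry p) v, fr.hilbertV (r.entry p) w⟫_ℂ) l (𝓝 ⟪v, w⟫_ℂ) := by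
  have key : ∀ u : W, Tendsto (fun r : ContractiveRow M =>
      ∑ p, (‖fr.hilbertV (r.entry p) u‖ : ℂ) ^ 2) l (𝓝 ((‖u‖ : ℂ) ^ 2)) := by
    intro u
    have h := (Complex.continuous_ofReal.tendsto _).comp
      (fr.tendsto_sum_norm_sq_hilbertV hM hl u)
    rw [Complex.ofReal_pow] at h
    refine h.congr fun r => ?_
    simp
  rw [inner_eq_sum_norm_sq_div_four (𝕜 := ℂ) v w]
  refine ((((key (v + w)).sub (key (v - w))).add
    (((key (v - (RCLike.I : ℂ) • w)).sub (key (v + (RCLike.I : ℂ) • w))).mul_const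
      (RCLike.I : ℂ))).div_const 4).congr fun r => ?_
  rw [← Finset.sum_sub_distrib, ← Finset.sum_sub_distrib, Finset.sum_mul,
    ← Finset.sum_add_distrib, Finset.sum_div]
  refine Finset.sum_congr rfl fun p _ => ?_
  rw [inner_eq_sum_norm_sq_div_four (𝕜 := ℂ) (fr.hilbertV (r.entry p) v), map_add, map_sub,
    map_sub, map_add, map_smul]
  rfl

variable [CompleteSpace W] (ctx : DeltaContext C D α β M)
include ctx

/-- The annihilation operators are the adjoints of the creation operators. The inner product on `W`
is the limit of `∑ ⟪V(mₚ) v, V(mₚ) w⟫`, and the multipliers `mₚ⋆ m` act by a `⋆`-representation. -/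
theorem adjoint_hilbertL (m : M) : adjoint (fr.hilbertL m) = fr.hilbertV m := by
  obtain ⟨l, hl, hlim⟩ := hM.exists_filter
  symm
  rw [ContinuousLinearMap.eq_adjoint_iff]
  intro w x
  have h1 := fr.tendsto_sum_inner_hilbertV hM hlim w (fr.hilbertL m x)
  have h2 : Tendsto (fun r => ⟪fr.hilbertV m (fr.proj r w), x⟫_ℂ) l
      (𝓝 ⟪fr.hilbertV m w, x⟫_ℂ) := by
    have hc : Continuous fun w => ⟪fr.hilbertV m w, x⟫_ℂ := by fun_prop
    exact (hc.tendsto w).comp (fr.tendsto_proj hM hlim w)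
  refine tendsto_nhds_unique h2 (h1.congr fun r => ?_)
  rw [fr.proj_apply_hilbert, map_sum, sum_inner]
  refine Finset.sum_congr rfl fun p _ => ?_
  have hT := ctx.comp_mem_leftMult (r.entry p).2 m.2
  have hT' := ctx.comp_mem_leftMult m.2 (r.entry p).2
  have ha : adjoint (adjoint (r.entry p : H →L[ℂ] K) ∘L (m : H →L[ℂ] K)) =
      adjoint (m : H →L[ℂ] K) ∘L (r.entry p : H →L[ℂ] K) := by
    rw [ContinuousLinearMap.adjoint_comp, ContinuousLinearMap.adjoint_adjoint]
  have h3 := adjoint_hilbertMult X ctx.left ctx.isoLeft hT (by rw [ha]; exact hT')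
  rw [ha] at h3
  rw [fr.hilbertV_L, fr.hilbertV_L, ← h3, ContinuousLinearMap.adjoint_inner_left]

end Inner

end ModuleFrame

end HilbertFrame

end DeltaMorita

namespace DeltaMorita

open OperatorSpace Filter Topology
open ContinuousLinearMap (adjoint)

/-! ### Representations of the ternary ring of operators -/

section Correspondences

variable {H₁ : Type w₁} [NormedAddCommGroup H₁] [InnerProductSpace ℂ H₁] [CompleteSpace H₁]
variable {H₂ : Type w₂} [NormedAddCommGroup H₂] [InnerProductSpace ℂ H₂] [CompleteSpace H₂]
variable {H : Type u} [NormedAddCommGroup H] [InnerProductSpace ℂ H] [CompleteSpace H]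
variable {K : Type u} [NormedAddCommGroup K] [InnerProductSpace ℂ K] [CompleteSpace K]
variable {A : NonUnitalSubalgebra ℂ (H₁ →L[ℂ] H₁)} {C : NonUnitalStarSubalgebra ℂ (H₁ →L[ℂ] H₁)}
variable {B : NonUnitalSubalgebra ℂ (H₂ →L[ℂ] H₂)} {D : NonUnitalStarSubalgebra ℂ (H₂ →L[ℂ] H₂)}

/-- A representation of `M` by operators from a representation `X` of `A` to a representation `Y`
of `B`, compatible with the products `m⋆ n`, `m n⋆`, `m a n⋆` and `m⋆ b n`; the operators `m⋆ n` and
`m n⋆` act on `X` and `Y` as left multipliers of `A` and `B`. The notion is symmetric under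
exchanging the two sides and replacing `M` by `M⋆`. -/
structure TRORep (α : RepHom A H) (β : RepHom B K) (M : Submodule ℂ (H →L[ℂ] K)) (X : HMod.{u} A)
    (Y : HMod.{u} B) where
  L : M →ₗ[ℂ] (X.carrier →L[ℂ] Y.carrier)
  gram : ∀ (m n : M) (x : X.carrier), adjoint (L m) (L n x) =
    hilbertMult α X (adjoint (m : H →L[ℂ] K) ∘L (n : H →L[ℂ] K)) x
  cogram : ∀ (m n : M) (y : Y.carrier), L m (adjoint (L n) y) =
    hilbertMult β Y ((m : H →L[ℂ] K) ∘L adjoint (n : H →L[ℂ] K)) y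
  act_left : ∀ (b : B) (m n : M) (a : A),
    β b = (m : H →L[ℂ] K) ∘L α a ∘L adjoint (n : H →L[ℂ] K) →
    ∀ y, Y.rep b y = L m (X.rep a (adjoint (L n) y))
  act_right : ∀ (a : A) (m n : M) (b : B),
    α a = adjoint (m : H →L[ℂ] K) ∘L β b ∘L (n : H →L[ℂ] K) →
    ∀ x, X.rep a x = adjoint (L m) (Y.rep b (L n x))
  dense : Dense (Submodule.span ℂ {y | ∃ (m : M) (x : X.carrier), y = L m x} : Set Y.carrier)
  codense : Dense (Submodule.span ℂ {x | ∃ (m : M) (y : Y.carrier), x = adjoint (L m) y} :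
    Set X.carrier)

variable {α : RepHom A H} {β : RepHom B K} {M : Submodule ℂ (H →L[ℂ] K)}

theorem norm_rep_le {X : HMod.{u} A} (a : A) (x : X.carrier) : ‖X.rep a x‖ ≤ ‖a‖ * ‖x‖ :=
  X.column.norm_act_le a x

/-- The action of an algebra on a vector, as a linear map. -/
def repFlip (X : HMod.{u} A) (x : X.carrier) : A →ₗ[ℂ] X.carrier where
  toFun a := X.rep a x
  map_add' a b := by rw [map_add]; rfl
  map_smul' c a := by rw [map_smul]; rfl

theorem norm_repFlip_le (X : HMod.{u} A) (x : X.carrier) (a : A) :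
    ‖repFlip X x a‖ ≤ ‖x‖ * ‖a‖ := by
  rw [mul_comm]; exact norm_rep_le a x

variable (ctx : DeltaContext C D α β M)
include ctx

theorem DeltaContext.comp_adjoint_mem_leftMult (m n : M) :
    (m : H →L[ℂ] K) ∘L adjoint (n : H →L[ℂ] K) ∈ leftMult β := by
  intro b
  exact ctx.exists_mul_right b m.2 n.2

variable {X : HMod.{u} A} {Y : HMod.{u} B} {L : M →ₗ[ℂ] (X.carrier →L[ℂ] Y.carrier)}

/-- The relation `L(m) L(n)⋆ = m n⋆` follows from the other relations: both sides agree on the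
vectors `b y`, by density on those with `b = k a n₀⋆`. -/
theorem cogram_of_act_left
    (gram : ∀ (m n : M) (x : X.carrier), adjoint (L m) (L n x) =
      hilbertMult α X (adjoint (m : H →L[ℂ] K) ∘L (n : H →L[ℂ] K)) x)
    (L_comp : ∀ (m n l k : M) (x : X.carrier),
      (k : H →L[ℂ] K) = (m : H →L[ℂ] K) ∘L adjoint (n : H →L[ℂ] K) ∘L (l : H →L[ℂ] K) →
      L k x = L m (hilbertMult α X (adjoint (n : H →L[ℂ] K) ∘L (l : H →L[ℂ] K)) x))
    (act_left : ∀ (b : B) (m n : M) (a : A),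
      β b = (m : H →L[ℂ] K) ∘L α a ∘L adjoint (n : H →L[ℂ] K) →
      ∀ y, Y.rep b y = L m (X.rep a (adjoint (L n) y)))
    (m n : M) (y : Y.carrier) : L m (adjoint (L n) y) =
      hilbertMult β Y ((m : H →L[ℂ] K) ∘L adjoint (n : H →L[ℂ] K)) y := by
  set T := hilbertMult β Y ((m : H →L[ℂ] K) ∘L adjoint (n : H →L[ℂ] K)) with hT
  have hmem := ctx.comp_adjoint_mem_leftMult m n
  have key : ∀ (b : B) (y : Y.carrier), (L m ∘L adjoint (L n)) (Y.rep b y) = T (Y.rep b y) := by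
    intro b y
    let S₁ : B →ₗ[ℂ] Y.carrier :=
      ((L m ∘L adjoint (L n) : Y.carrier →L[ℂ] Y.carrier) : Y.carrier →ₗ[ℂ] Y.carrier) ∘ₗ
        repFlip Y y
    let S₂ : B →ₗ[ℂ] Y.carrier := (T : Y.carrier →ₗ[ℂ] Y.carrier) ∘ₗ repFlip Y y
    have h1 : ∀ b, ‖S₁ b‖ ≤ max ‖L m ∘L adjoint (L n)‖ ‖T‖ * ‖y‖ * ‖b‖ := by
      intro b
      refine ((L m ∘L adjoint (L n)).le_opNorm _).trans ?_
      rw [mul_assoc]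
      exact mul_le_mul (le_max_left _ _) (norm_repFlip_le Y y b) (norm_nonneg _)
        (le_max_of_le_left (norm_nonneg _))
    have h2 : ∀ b, ‖S₂ b‖ ≤ max ‖L m ∘L adjoint (L n)‖ ‖T‖ * ‖y‖ * ‖b‖ := by
      intro b
      refine (T.le_opNorm _).trans ?_
      rw [mul_assoc]
      exact mul_le_mul (le_max_right _ _) (norm_repFlip_le Y y b) (norm_nonneg _)
        (le_max_of_le_left (norm_nonneg _))
    refine eq_of_mem_closure_span (T := S₁) (S := S₂) h1 h2 ?_ (ctx.dense_right b)
    rintro b ⟨k, n₀, a, hb⟩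
    let k' : M := ⟨(m : H →L[ℂ] K) ∘L adjoint (n : H →L[ℂ] K) ∘L (k : H →L[ℂ] K),
      ctx.equiv.isTRO _ m.2 _ n.2 _ k.2⟩
    obtain ⟨b', hb'⟩ := ctx.exists_right a k'.2 n₀.2
    have e : β b' = ((m : H →L[ℂ] K) ∘L adjoint (n : H →L[ℂ] K)) ∘L β b := by
      rw [hb', hb]; rfl
    change L m (adjoint (L n) (Y.rep b y)) = T (Y.rep b y)
    rw [hT, hilbertMult_rep Y ctx.right ctx.isoRight hmem e, act_left b' k' n₀ a hb',
      act_left b k n₀ a hb, gram, L_comp m n k k' _ rfl]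
  have : L m ∘L adjoint (L n) = T := by
    refine clm_ext_of_dense_span Y.nondegenerate ?_
    rintro _ ⟨b, y, rfl⟩
    exact key b y
  exact DFunLike.congr_fun this y

/-- The relation `m⋆ b n = L(m)⋆ b L(n)` holds for generators `b = k a n₀⋆` by the Gram relations,
and for all `b` by density. -/
theorem act_right_of_act_left
    (gram : ∀ (m n : M) (x : X.carrier), adjoint (L m) (L n x) =
      hilbertMult α X (adjoint (m : H →L[ℂ] K) ∘L (n : H →L[ℂ] K)) x)
    (act_left : ∀ (b : B) (m n : M) (a : A),
      β b = (m : H →L[ℂ] K) ∘L α a ∘L adjoint (n : H →L[ℂ] K) →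
      ∀ y, Y.rep b y = L m (X.rep a (adjoint (L n) y)))
    (a : A) (m n : M) (b : B) (h : α a = adjoint (m : H →L[ℂ] K) ∘L β b ∘L (n : H →L[ℂ] K))
    (x : X.carrier) : X.rep a x = adjoint (L m) (Y.rep b (L n x)) := by
  have ha : a = ctx.compress m n b :=
    CompletelyIsometric.injective ctx.isoLeft (by rw [h, ctx.map_compress])
  rw [ha]
  let S₁ : B →ₗ[ℂ] X.carrier := repFlip X x ∘ₗ ctx.compress m n
  let S₂ : B →ₗ[ℂ] X.carrier :=
    ((adjoint (L m) : Y.carrier →L[ℂ] X.carrier) : Y.carrier →ₗ[ℂ] X.carrier) ∘ₗ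
      repFlip Y (L n x)
  let c₁ : ℝ := ‖x‖ * (‖adjoint (m : H →L[ℂ] K)‖ * ‖(n : H →L[ℂ] K)‖)
  let c₂ : ℝ := ‖adjoint (L m)‖ * ‖L n x‖
  have h1 : ∀ b, ‖S₁ b‖ ≤ max c₁ c₂ * ‖b‖ := by
    intro b
    refine (norm_repFlip_le X x _).trans ?_
    refine (mul_le_mul_of_nonneg_left (ctx.norm_compress_le m n b) (norm_nonneg x)).trans ?_
    rw [← mul_assoc]
    exact mul_le_mul_of_nonneg_right (le_max_left c₁ c₂) (norm_nonneg b)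
  have h2 : ∀ b, ‖S₂ b‖ ≤ max c₁ c₂ * ‖b‖ := by
    intro b
    refine ((adjoint (L m)).le_opNorm _).trans ?_
    refine (mul_le_mul_of_nonneg_left (norm_repFlip_le Y (L n x) b) (norm_nonneg _)).trans ?_
    rw [← mul_assoc]
    exact mul_le_mul_of_nonneg_right (le_max_right c₁ c₂) (norm_nonneg b)
  refine eq_of_mem_closure_span (T := S₁) (S := S₂) h1 h2 ?_ (ctx.dense_right b)
  rintro b ⟨k, n₀, a', hb⟩
  have h3 := ctx.map_compress m n b
  rw [hb] at h3
  change X.rep (ctx.compress m n b) x = adjoint (L m) (Y.rep b (L n x))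
  rw [act_left b k n₀ a' hb, gram, gram]
  exact ModuleFrame.act_eq_of_map_eq (U := X.column) ctx h3 x

theorem codense_of_act_right
    (act_right : ∀ (a : A) (m n : M) (b : B),
      α a = adjoint (m : H →L[ℂ] K) ∘L β b ∘L (n : H →L[ℂ] K) →
      ∀ x, X.rep a x = adjoint (L m) (Y.rep b (L n x))) :
    Dense (Submodule.span ℂ {x | ∃ (m : M) (y : Y.carrier), x = adjoint (L m) y} :
      Set X.carrier) := by
  set R := (Submodule.span ℂ {x | ∃ (m : M) (y : Y.carrier), x = adjoint (L m) y} :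
    Submodule ℂ X.carrier).topologicalClosure with hRdef
  have hR : IsClosed (R : Set X.carrier) := Submodule.isClosed_topologicalClosure _
  intro x
  refine mem_of_mem_closure_span hR (ContinuousLinearMap.id ℂ X.carrier) ?_ (X.nondegenerate x)
  rintro _ ⟨a, x, rfl⟩
  refine map_mem_of_mem_closure_span (T := repFlip X x) (norm_repFlip_le X x) hR ?_
    (ctx.dense_left a)
  rintro a ⟨m, n, b, h⟩
  refine Submodule.le_topologicalClosure _ (Submodule.subset_span ⟨m, Y.rep b (L n x), ?_⟩)
  exact act_right a m n b h x

end Correspondences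

end DeltaMorita

namespace DeltaMorita

open OperatorSpace Filter Topology
open ContinuousLinearMap (adjoint)

/-! ### The representation on the tensor product -/

section HilbertModule

variable {H₁ : Type w₁} [NormedAddCommGroup H₁] [InnerProductSpace ℂ H₁] [CompleteSpace H₁]
variable {H₂ : Type w₂} [NormedAddCommGroup H₂] [InnerProductSpace ℂ H₂] [CompleteSpace H₂]
variable {H : Type u} [NormedAddCommGroup H] [InnerProductSpace ℂ H] [CompleteSpace H]
variable {K : Type u} [NormedAddCommGroup K] [InnerProductSpace ℂ K] [CompleteSpace K]
variable {A : NonUnitalSubalgebra ℂ (H₁ →L[ℂ] H₁)} {C : NonUnitalStarSubalgebra ℂ (H₁ →L[ℂ] H₁)}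
variable {B : NonUnitalSubalgebra ℂ (H₂ →L[ℂ] H₂)} {D : NonUnitalStarSubalgebra ℂ (H₂ →L[ℂ] H₂)}
variable {α : RepHom A H} {β : RepHom B K} {M : Submodule ℂ (H →L[ℂ] K)}

/-- An operator module whose matrix norms are those of a column Hilbert space comes from a
representation. -/
theorem exists_column_iso {W : Type u} [NormedAddCommGroup W] [InnerProductSpace ℂ W]
    [CompleteSpace W] [OperatorSpace W] (act : B →ₗ[ℂ] W →ₗ[ℂ] W)
    (act_mul : ∀ (a b : B) (x : W), act (a * b) x = act a (act b x))
    (mnorm_act_le : ∀ {ι κ μ : Type} [Fintype ι] [Fintype κ] [Fintype μ]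
      (a : Matrix ι κ B) (x : Matrix κ μ W),
      mnorm (Matrix.of fun i j => ∑ k, act (a i k) (x k j)) ≤
        matNorm (a.map (fun a : B => (a : H₂ →L[ℂ] H₂))) * mnorm x)
    (essential : Dense (Submodule.span ℂ {y | ∃ (a : B) (x : W), y = act a x} : Set W))
    (hcol : ∀ {ι κ : Type} [Fintype ι] [Fintype κ] (t : Matrix ι κ W),
      mnorm t = matNorm (columnOp t)) :
    ∃ (rep : RepHom B W) (h₁ : CompletelyContractive rep) (h₂ : Dense (Submodule.span ℂ
      {y | ∃ (a : B) (x : W), y = rep a x} : Set W))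
      (i : (HMod.mk W rep h₁ h₂).column ≅ OMod.mk W act act_mul mnorm_act_le essential),
      IsCompleteIsometry (OMod.lin i.hom) ∧ (∀ b x, rep b x = act b x) ∧
      ∀ x : W, OMod.lin i.hom x = x := by
  let N : OMod.{u} B := OMod.mk W act act_mul mnorm_act_le essential
  let rep : RepHom B W :=
    { toFun := fun b => N.actL b
      map_smul' := fun c b => ContinuousLinearMap.ext fun x => by
        change act (c • b) x = c • act b x
        rw [map_smul]; rfl
      map_zero' := ContinuousLinearMap.ext fun x => by
        change act 0 x = 0
        rw [map_zero]; rfl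
      map_add' := fun a b => ContinuousLinearMap.ext fun x => by
        change act (a + b) x = act a x + act b x
        rw [map_add]; rfl
      map_mul' := fun a b => ContinuousLinearMap.ext fun x => act_mul a b x }
  have h₁ : CompletelyContractive rep := by
    intro ι κ _ _ a
    refine matNorm_le (matNorm_nonneg _) fun x => ?_
    have h := mnorm_act_le a (Matrix.of fun (k : κ) (_ : Unit) => x k)
    rw [hcol, hcol] at h
    have h' := pow_le_pow_left₀ (matNorm_nonneg _) h 2
    rw [mul_pow, matNorm_columnOp_vec] at h'
    refine le_trans (le_of_eq ?_) h'
    exact (matNorm_columnOp_vec fun i => ∑ k, act (a i k) (x k)).symm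
  let i : (HMod.mk W rep h₁ essential).column ≅ N :=
    { hom :=
        { toLin := (LinearMap.id : W →ₗ[ℂ] W)
          completelyBounded := ⟨1, zero_le_one, fun x => by
            rw [one_mul]; exact (hcol x).le⟩
          map_act := fun a x => rfl }
      inv :=
        { toLin := (LinearMap.id : W →ₗ[ℂ] W)
          completelyBounded := ⟨1, zero_le_one, fun x => by
            rw [one_mul]; exact (hcol x).ge⟩
          map_act := fun a x => rfl }
      hom_inv_id := rfl
      inv_hom_id := rfl }
  exact ⟨rep, h₁, essential, i, fun x => hcol x, fun b x => rfl, fun x => rfl⟩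

variable (ctx : DeltaContext C D α β M) {X : HMod.{u} A}
include ctx

namespace ModuleFrame

/-- The creation operators represent `M` when the tensor product is a Hilbert space. -/
theorem exists_troRep_of_inner {W : Type u} [NormedAddCommGroup W] [InnerProductSpace ℂ W]
    [CompleteSpace W] [OperatorSpace W] (fr : ModuleFrame α M X.column W) (rep : RepHom B W)
    (h₁ : CompletelyContractive rep) (h₂ : Dense (Submodule.span ℂ
      {y | ∃ (a : B) (x : W), y = rep a x} : Set W))
    (hρ : ∀ (b : B) (m n : M) (a : A), β b = (m : H →L[ℂ] K) ∘L α a ∘L adjoint (n : H →L[ℂ] K) →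
      ∀ x, rep b x = fr.hilbertL m (X.rep a (fr.hilbertV n x))) :
    ∃ S : TRORep α β M X (HMod.mk W rep h₁ h₂), ∀ m x, S.L m x = fr.hilbertL m x := by
  have hM := ctx.equiv.isTRO
  let Y : HMod.{u} B := HMod.mk W rep h₁ h₂
  let L : M →ₗ[ℂ] (X.carrier →L[ℂ] Y.carrier) := fr.hilbertL
  have adj : ∀ m : M, adjoint (L m) = fr.hilbertV m := fr.adjoint_hilbertL hM ctx
  have gram : ∀ (m n : M) (x : X.carrier), adjoint (L m) (L n x) =
      hilbertMult α X (adjoint (m : H →L[ℂ] K) ∘L (n : H →L[ℂ] K)) x := by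
    intro m n x
    rw [adj]
    exact fr.hilbertV_L m n x
  have act_left : ∀ (b : B) (m n : M) (a : A),
      β b = (m : H →L[ℂ] K) ∘L α a ∘L adjoint (n : H →L[ℂ] K) →
      ∀ y, Y.rep b y = L m (X.rep a (adjoint (L n) y)) := by
    intro b m n a h y
    rw [adj]
    exact hρ b m n a h y
  have act_right := act_right_of_act_left ctx gram act_left
  exact ⟨{  L := L
            gram := gram
            cogram := cogram_of_act_left ctx gram fr.L_comp act_left
            act_left := act_left
            act_right := act_right
            dense := fr.dense
            codense := codense_of_act_right ctx act_right }, fun m x => rfl⟩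

/-- The tensor product of `M` with a representation of `A` is a representation of `B`. -/
theorem exists_hilbertModule {N : OMod.{u} B} (fr : ModuleFrame α M X.column N.carrier)
    (hρ : fr.IsAction β N.act) :
    ∃ (Y : HMod.{u} B) (i : Y.column ≅ N) (S : TRORep α β M X Y),
      IsCompleteIsometry (OMod.lin i.hom) ∧
      ∀ (m : M) (x : X.carrier), OMod.lin i.hom (S.L m x) = fr.hilbertL m x := by
  obtain ⟨W, act, act_mul, mnorm_act_le, essential⟩ := N
  let _ : InnerProductSpace ℂ W := InnerProductSpace.ofNorm (𝕜 := ℂ)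
    (fr.parallelogram ctx.equiv.isTRO)
  have hcol : ∀ {ι κ : Type} [Fintype ι] [Fintype κ] (t : Matrix ι κ W),
      mnorm t = matNorm (columnOp t) := fun t => mnorm_eq_column (W := W) fr ctx.equiv.isTRO t
  obtain ⟨rep, h₁, h₂, i, hi, hrep, hi'⟩ :=
    exists_column_iso act act_mul mnorm_act_le essential hcol
  obtain ⟨S, hS⟩ := exists_troRep_of_inner (W := W) ctx fr rep h₁ h₂ fun b m n a h x => by
    rw [hrep]
    exact hρ b m n a h x
  refine ⟨HMod.mk W rep h₁ h₂, i, S, hi, fun m x => ?_⟩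
  rw [hS]
  exact hi' _

end ModuleFrame

variable (F : TensorFunctor α β M)

/-- The frame of the tensor product module given by a tensor functor. -/
def TensorFunctor.frame (U : OMod.{u} A) :
    ModuleFrame α M U (F.functor.obj U).carrier :=
  (F.isTensor U).frame ctx U

/-- The action prescribed on elementary tensors is the one given by creation and annihilation
operators. -/
theorem TensorFunctor.isAction_frame (U : OMod.{u} A) :
    (F.frame ctx U).IsAction β (F.functor.obj U).act := by
  intro b m n a hb
  have e : (F.functor.obj U).actL b =
      (F.frame ctx U).L m ∘L U.actL a ∘L (F.frame ctx U).V n := by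
    refine clm_ext_of_dense_span (F.frame ctx U).dense ?_
    rintro _ ⟨l, x, rfl⟩
    obtain ⟨a', ha'⟩ := ctx.exists_mul_left a n.2 l.2
    have h := F.act_tens U b m n l a a' x hb ha'
    have hnl := ctx.comp_mem_leftMult n.2 l.2
    change (F.functor.obj U).act b (F.tens U (l ⊗ₜ[ℂ] x)) =
      (F.frame ctx U).L m (U.actL a ((F.frame ctx U).V n ((F.frame ctx U).L l x)))
    rw [h, (F.frame ctx U).V_L, ← multAct_map U ctx.left ctx.isoLeft,
      ← multAct_mul U ctx.left ctx.isoLeft (map_mem_leftMult a) hnl, ← ha',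
      multAct_map U ctx.left ctx.isoLeft]
    rfl
  intro x
  exact DFunLike.congr_fun e x

end HilbertModule

end DeltaMorita

namespace DeltaMorita

open OperatorSpace Filter Topology
open ContinuousLinearMap (adjoint)

/-! ### Intertwiners between representations of a ternary ring of operators -/

section Intertwiners

variable {H₁ : Type w₁} [NormedAddCommGroup H₁] [InnerProductSpace ℂ H₁] [CompleteSpace H₁]
variable {H₂ : Type w₂} [NormedAddCommGroup H₂] [InnerProductSpace ℂ H₂] [CompleteSpace H₂]
variable {H : Type u} [NormedAddCommGroup H] [InnerProductSpace ℂ H] [CompleteSpace H]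
variable {K : Type u} [NormedAddCommGroup K] [InnerProductSpace ℂ K] [CompleteSpace K]
variable {A : NonUnitalSubalgebra ℂ (H₁ →L[ℂ] H₁)} {C : NonUnitalStarSubalgebra ℂ (H₁ →L[ℂ] H₁)}
variable {B : NonUnitalSubalgebra ℂ (H₂ →L[ℂ] H₂)} {D : NonUnitalStarSubalgebra ℂ (H₂ →L[ℂ] H₂)}
variable {α : RepHom A H} {β : RepHom B K} {M : Submodule ℂ (H →L[ℂ] K)}

theorem ContractiveRow.matNorm_adjoint_comp_le (r : ContractiveRow M) :
    matNorm (Matrix.of fun p q => adjoint (r.entry p : H →L[ℂ] K) ∘L (r.entry q : H →L[ℂ] K)) ≤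
      1 := by
  refine matNorm_le zero_le_one fun x => ?_
  rw [one_pow, one_mul]
  refine le_trans (le_of_eq ?_) ((r.norm_col_le (∑ q, (r.entry q : H →L[ℂ] K) (x q))).trans
    (r.norm_row_le x))
  refine Finset.sum_congr rfl fun p _ => ?_
  rw [map_sum]
  rfl

namespace TRORep

variable {X : HMod.{u} A} {Y : HMod.{u} B} (S : TRORep α β M X Y)

section Flip

variable {N : Submodule ℂ (K →L[ℂ] H)} (h : ∀ n ∈ N, adjoint n ∈ M)

/-- The adjoints of the operators representing `M`, as a linear map on a subspace of `M⋆`. -/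
def flipL : N →ₗ[ℂ] (Y.carrier →L[ℂ] X.carrier) where
  toFun p := adjoint (S.L ⟨adjoint (p : K →L[ℂ] H), h p p.2⟩)
  map_add' p q := by
    rw [← map_add, ← map_add]
    congr 2
    exact Subtype.ext (map_add adjoint (p : K →L[ℂ] H) (q : K →L[ℂ] H))
  map_smul' c p := by
    have e : (⟨adjoint ((c • p : N) : K →L[ℂ] H), h _ (c • p).2⟩ : M) =
        (starRingEnd ℂ c) • ⟨adjoint (p : K →L[ℂ] H), h p p.2⟩ :=
      Subtype.ext (map_smulₛₗ adjoint c (p : K →L[ℂ] H))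
    rw [e, map_smul, map_smulₛₗ, Complex.conj_conj]
    rfl

theorem flipL_apply (p : N) :
    S.flipL h p = adjoint (S.L ⟨adjoint (p : K →L[ℂ] H), h p p.2⟩) := rfl

theorem adjoint_flipL (p : N) :
    adjoint (S.flipL h p) = S.L ⟨adjoint (p : K →L[ℂ] H), h p p.2⟩ :=
  ContinuousLinearMap.adjoint_adjoint _

variable (h' : ∀ m ∈ M, adjoint m ∈ N)

theorem flipL_adjoint (m : M) :
    S.flipL h ⟨adjoint (m : H →L[ℂ] K), h' m m.2⟩ = adjoint (S.L m) := by
  have e : (⟨adjoint (adjoint (m : H →L[ℂ] K)), h _ (h' m m.2)⟩ : M) = m :=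
    Subtype.ext (ContinuousLinearMap.adjoint_adjoint _)
  rw [flipL_apply, e]

/-- The adjoints of a representation of `M` form a representation of `M⋆`. -/
def flip : TRORep β α N Y X where
  L := S.flipL h
  gram p q y := by
    have e := S.cogram ⟨adjoint (p : K →L[ℂ] H), h p p.2⟩ ⟨adjoint (q : K →L[ℂ] H), h q q.2⟩ y
    rw [ContinuousLinearMap.adjoint_adjoint] at e
    rw [adjoint_flipL, flipL_apply, e]
  cogram p q x := by
    have e := S.gram ⟨adjoint (p : K →L[ℂ] H), h p p.2⟩ ⟨adjoint (q : K →L[ℂ] H), h q q.2⟩ x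
    rw [ContinuousLinearMap.adjoint_adjoint] at e
    rw [adjoint_flipL, flipL_apply, e]
  act_left a p q b hb x := by
    rw [adjoint_flipL, flipL_apply]
    refine S.act_right a _ _ b ?_ x
    rw [ContinuousLinearMap.adjoint_adjoint]
    exact hb
  act_right b p q a ha y := by
    rw [adjoint_flipL, flipL_apply]
    refine S.act_left b _ _ a ?_ y
    rw [ContinuousLinearMap.adjoint_adjoint]
    exact ha
  dense := by
    refine S.codense.mono (Submodule.span_mono ?_)
    rintro _ ⟨m, y, rfl⟩
    exact ⟨⟨adjoint (m : H →L[ℂ] K), h' m m.2⟩, y, by rw [flipL_adjoint S h h']⟩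
  codense := by
    refine S.dense.mono (Submodule.span_mono ?_)
    rintro _ ⟨m, x, rfl⟩
    refine ⟨⟨adjoint (m : H →L[ℂ] K), h' m m.2⟩, x, ?_⟩
    rw [flipL_adjoint S h h', ContinuousLinearMap.adjoint_adjoint]

end Flip

include S in
/-- The ranges of the operators representing `M` span a dense subspace of `Y`, so the intersection
of the kernels of their adjoints is zero. -/
theorem eq_of_adjoint_eq {y y' : Y.carrier} (h : ∀ p, adjoint (S.L p) y = adjoint (S.L p) y') :
    y = y' := by
  refine S.dense.eq_of_inner_left (𝕜 := ℂ) fun v hv => ?_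
  induction hv using Submodule.span_induction with
  | mem v hv =>
    obtain ⟨m, x, rfl⟩ := hv
    rw [← ContinuousLinearMap.adjoint_inner_left, h, ContinuousLinearMap.adjoint_inner_left]
  | zero => rw [inner_zero_right, inner_zero_right]
  | add v w _ _ hv hw => rw [inner_add_right, inner_add_right, hv, hw]
  | smul c v _ hv => rw [inner_smul_right, inner_smul_right, hv]

include S in
theorem hom_ext {Z : HMod.{u} B} {g g' : Y ⟶ Z}
    (h : ∀ (m : M) (x : X.carrier),
      HMod.Hom.toCLM g (S.L m x) = HMod.Hom.toCLM g' (S.L m x)) : g = g' := by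
  refine HMod.Hom.ext (clm_ext_of_dense_span S.dense ?_)
  rintro _ ⟨m, x, rfl⟩
  exact h m x

include S in
/-- The ranges of the operators representing `M⋆` span a dense subspace, so intertwiners into `X`
are determined by their compositions with the operators representing `M`. -/
theorem hom_ext_right {Z : HMod.{u} A} {f f' : Z ⟶ X}
    (h : ∀ (m : M) (x : Z.carrier),
      S.L m (HMod.Hom.toCLM f x) = S.L m (HMod.Hom.toCLM f' x)) : f = f' := by
  refine HMod.Hom.ext (ContinuousLinearMap.ext fun x => ?_)
  have h₁ : ∀ n ∈ adjointSpace M, adjoint n ∈ M := fun n hn => hn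
  have h₂ : ∀ m ∈ M, adjoint m ∈ adjointSpace M := fun m hm => adjoint_mem_adjointSpace hm
  refine (S.flip h₁ h₂).eq_of_adjoint_eq fun p => ?_
  change adjoint (S.flipL h₁ p) _ = adjoint (S.flipL h₁ p) _
  rw [adjoint_flipL]
  exact h _ x

variable (ctx : DeltaContext C D α β M)
include ctx

/-- The relation `m (n⋆ l) = L(m) (n⋆ l)`; both sides have the same images under the `L(p)⋆`. -/
theorem L_comp (m n l k : M) (x : X.carrier)
    (hk : (k : H →L[ℂ] K) = (m : H →L[ℂ] K) ∘L adjoint (n : H →L[ℂ] K) ∘L (l : H →L[ℂ] K)) :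
    S.L k x = S.L m (hilbertMult α X (adjoint (n : H →L[ℂ] K) ∘L (l : H →L[ℂ] K)) x) := by
  refine S.eq_of_adjoint_eq fun p => ?_
  rw [S.gram, S.gram, ← hilbertMult_mul X ctx.left ctx.isoLeft
    (ctx.comp_mem_leftMult p.2 m.2) (ctx.comp_mem_leftMult n.2 l.2), hk]
  rfl

theorem norm_L_le (m : M) (x : X.carrier) : ‖S.L m x‖ ≤ ‖(m : H →L[ℂ] K)‖ * ‖x‖ := by
  refine le_of_sq_le_sq ?_ (by positivity)
  have h1 : ‖S.L m x‖ ^ 2 = RCLike.re ⟪hilbertMult α X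
      (adjoint (m : H →L[ℂ] K) ∘L (m : H →L[ℂ] K)) x, x⟫_ℂ := by
    rw [← S.gram, ContinuousLinearMap.adjoint_inner_left, ← norm_sq_eq_re_inner]
  have h2 := norm_hilbertMult_le X ctx.left ctx.isoLeft (ctx.comp_mem_leftMult m.2 m.2) x
  rw [ContinuousLinearMap.norm_adjoint_comp_self] at h2
  rw [h1]
  calc _ ≤ _ := re_inner_le_norm _ _
    _ ≤ ‖(m : H →L[ℂ] K)‖ * ‖(m : H →L[ℂ] K)‖ * ‖x‖ * ‖x‖ :=
      mul_le_mul_of_nonneg_right h2 (norm_nonneg x)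
    _ = _ := by ring

/-- The Gram matrix of a contractive row acts as a contraction, so the row itself does. -/
theorem norm_sq_sum_L_le (r : ContractiveRow M) (x : Fin r.n → X.carrier) :
    ‖∑ p, S.L (r.entry p) (x p)‖ ^ 2 ≤ ∑ p, ‖x p‖ ^ 2 := by
  let g : Fin r.n → X.carrier := fun p => ∑ q, hilbertMult α X
    (adjoint (r.entry p : H →L[ℂ] K) ∘L (r.entry q : H →L[ℂ] K)) (x q)
  have h1 : ‖∑ p, S.L (r.entry p) (x p)‖ ^ 2 = ∑ p, RCLike.re ⟪x p, g p⟫_ℂ := by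
    rw [norm_sq_eq_re_inner (𝕜 := ℂ), sum_inner, map_sum]
    refine Finset.sum_congr rfl fun p _ => ?_
    rw [← ContinuousLinearMap.adjoint_inner_right, map_sum]
    simp only [S.gram]
    rfl
  have h2 : ∑ p, ‖g p‖ ^ 2 ≤ ∑ p, ‖x p‖ ^ 2 := by
    refine (sum_norm_sq_hilbertMult_le X ctx.left ctx.isoLeft
      (Matrix.of fun p q => adjoint (r.entry p : H →L[ℂ] K) ∘L (r.entry q : H →L[ℂ] K))
      (fun p q => ctx.comp_mem_leftMult (r.entry p).2 (r.entry q).2) x).trans ?_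
    exact mul_le_of_le_one_left (by positivity)
      (pow_le_one₀ (matNorm_nonneg _) r.matNorm_adjoint_comp_le)
  have h3 : ∑ p, RCLike.re ⟪x p, g p⟫_ℂ ≤ ∑ p, (‖x p‖ ^ 2 + ‖g p‖ ^ 2) / 2 := by
    refine Finset.sum_le_sum fun p _ => (re_inner_le_norm _ _).trans ?_
    nlinarith [sq_nonneg (‖x p‖ - ‖g p‖)]
  rw [← Finset.sum_div, Finset.sum_add_distrib] at h3
  rw [h1]
  linarith

/-- The adjoint column of a contractive row acts as a contraction. -/
theorem sum_norm_sq_adjoint_L_le (r : ContractiveRow M) (y : Y.carrier) :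
    ∑ p, ‖adjoint (S.L (r.entry p)) y‖ ^ 2 ≤ ‖y‖ ^ 2 := by
  have h1 := S.norm_sq_sum_L_le ctx r fun p => adjoint (S.L (r.entry p)) y
  have h2 : ∑ p, ‖adjoint (S.L (r.entry p)) y‖ ^ 2 =
      RCLike.re ⟪∑ p, S.L (r.entry p) (adjoint (S.L (r.entry p)) y), y⟫_ℂ := by
    rw [sum_inner, map_sum]
    refine Finset.sum_congr rfl fun p _ => ?_
    rw [← ContinuousLinearMap.adjoint_inner_right, ← norm_sq_eq_re_inner]
  have h3 := re_inner_le_norm (𝕜 := ℂ)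
    (∑ p, S.L (r.entry p) (adjoint (S.L (r.entry p)) y)) y
  rw [← h2] at h3
  nlinarith [sq_nonneg (‖∑ p, S.L (r.entry p) (adjoint (S.L (r.entry p)) y)‖ - ‖y‖)]

/-- A representation of `M` exhibits `Y` as the tensor product of `M` and `X`. -/
def frame : ModuleFrame α M X.column Y.column.carrier where
  L := S.L
  V n := (adjoint (S.L n) : Y.carrier →L[ℂ] X.carrier)
  V_L := S.gram
  L_comp := fun m n l k x h => S.L_comp ctx m n l k x h
  norm_L_le := S.norm_L_le ctx
  mnorm_L_le r {ι κ} _ _ y := by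
    let y' : Matrix (ι × Fin r.n) κ X.carrier := y
    refine matNorm_columnOp_le
      (Matrix.of fun i j => ∑ p, S.L (r.entry p) (y' (i, p) j) : Matrix ι κ Y.carrier)
      (matNorm_nonneg (columnOp y')) fun z => ?_
    refine le_trans (Finset.sum_le_sum fun i _ => ?_)
      ((Fintype.sum_prod_type _).symm.le.trans (sum_norm_sq_columnOp_le y' z))
    refine le_trans (le_of_eq ?_) (S.norm_sq_sum_L_le ctx r fun p => ∑ j, z j • y' (i, p) j)
    simp only [Matrix.of_apply, Finset.smul_sum, map_sum, map_smul]
    rw [Finset.sum_comm]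
  mnorm_V_le r {ι κ} _ _ t := by
    let t' : Matrix ι κ Y.carrier := t
    refine matNorm_columnOp_le (Matrix.of fun (ip : ι × Fin r.n) j =>
      adjoint (S.L (r.entry ip.2)) (t' ip.1 j) : Matrix (ι × Fin r.n) κ X.carrier)
      (matNorm_nonneg (columnOp t')) fun z => ?_
    rw [Fintype.sum_prod_type]
    refine le_trans (Finset.sum_le_sum fun i _ => ?_) (sum_norm_sq_columnOp_le t' z)
    refine le_trans (le_of_eq ?_) (S.sum_norm_sq_adjoint_L_le ctx r (∑ j, z j • t' i j))
    simp only [Matrix.of_apply, map_sum, map_smul]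
  dense := S.dense

variable {X' : HMod.{u} A} {Y' : HMod.{u} B} (S' : TRORep α β M X' Y')

/-- An intertwiner of `A` induces an intertwiner of `B`. -/
theorem exists_map (f : X ⟶ X') : ∃ g : Y ⟶ Y', ∀ (m : M) (x : X.carrier),
    HMod.Hom.toCLM g (S.L m x) = S'.L m (HMod.Hom.toCLM f x) := by
  let f' : X.column.carrier →L[ℂ] X'.column.carrier := HMod.Hom.toCLM f
  have hact : ∀ (a : A) (x : X.column.carrier), f' (X.column.act a x) = X'.column.act a (f' x) :=
    HMod.Hom.map_rep f
  obtain ⟨T, hT, -⟩ := (S.frame ctx).exists_map (S'.frame ctx) f' ctx hact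
    (norm_nonneg (HMod.Hom.toCLM f)) (fun x => columnNorm_map_le (HMod.Hom.toCLM f) x)
  have hρ : (S.frame ctx).IsAction β Y.column.act := S.act_left
  have hρ' : (S'.frame ctx).IsAction β Y'.column.act := S'.act_left
  exact ⟨⟨T, (S.frame ctx).map_action (S'.frame ctx) f' ctx hact hρ hρ'
    Y.column.norm_act_le Y'.column.norm_act_le hT⟩, hT⟩

/-- If `f` and `g` intertwine the adjoints `L(m)⋆`, then they intertwine the operators `L(m)`. -/
theorem map_adjoint {f : X.carrier →L[ℂ] X'.carrier}
    (hf : ∀ (a : A) (x : X.carrier), f (X.rep a x) = X'.rep a (f x))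
    {g : Y.carrier →L[ℂ] Y'.carrier}
    (h : ∀ (m : M) (y : Y.carrier), f (adjoint (S.L m) y) = adjoint (S'.L m) (g y))
    (m : M) (x : X.carrier) : g (S.L m x) = S'.L m (f x) := by
  refine S'.eq_of_adjoint_eq fun p => ?_
  rw [← h, S.gram, S'.gram]
  exact map_multAct X.column ctx.left ctx.isoLeft (V := X'.column) f hf
    (ctx.comp_mem_leftMult p.2 m.2) x

/-- Every intertwiner of `B` is induced by an intertwiner of `A`. -/
theorem exists_map_of_map (g : Y ⟶ Y') : ∃ f : X ⟶ X', ∀ (m : M) (x : X.carrier),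
    HMod.Hom.toCLM g (S.L m x) = S'.L m (HMod.Hom.toCLM f x) := by
  have h : ∀ n ∈ adjointSpace M, adjoint n ∈ M := fun n hn => hn
  have h' : ∀ m ∈ M, adjoint m ∈ adjointSpace M := fun m hm => adjoint_mem_adjointSpace hm
  obtain ⟨f, hf⟩ := (S.flip h h').exists_map ctx.symm (S'.flip h h') g
  refine ⟨f, S.map_adjoint ctx S' (HMod.Hom.map_rep f) fun m y => ?_⟩
  have e := hf ⟨adjoint (m : H →L[ℂ] K), h' m m.2⟩ y
  change HMod.Hom.toCLM f (S.flipL h ⟨adjoint (m : H →L[ℂ] K), h' m m.2⟩ y) =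
    S'.flipL h ⟨adjoint (m : H →L[ℂ] K), h' m m.2⟩ (HMod.Hom.toCLM g y) at e
  rwa [S.flipL_adjoint h h', S'.flipL_adjoint h h'] at e

include S in
/-- The representation of `B` on the tensor product is determined up to isomorphism. -/
theorem nonempty_iso {Y₁ : HMod.{u} B} (S₁ : TRORep α β M X Y₁) : Nonempty (Y ≅ Y₁) := by
  obtain ⟨g, hg⟩ := S.exists_map ctx S₁ (𝟙 X)
  obtain ⟨g', hg'⟩ := S₁.exists_map ctx S (𝟙 X)
  refine ⟨⟨g, g', S.hom_ext fun m x => ?_, S₁.hom_ext fun m x => ?_⟩⟩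
  · change HMod.Hom.toCLM g' (HMod.Hom.toCLM g (S.L m x)) = S.L m x
    rw [hg]
    exact hg' m x
  · change HMod.Hom.toCLM g (HMod.Hom.toCLM g' (S₁.L m x)) = S₁.L m x
    rw [hg']
    exact hg m x

end TRORep

end Intertwiners

end DeltaMorita

namespace DeltaMorita

open OperatorSpace Filter Topology
open ContinuousLinearMap (adjoint)

/-! ### Completely isometric representations -/

section Isometric

variable {H₁ : Type w₁} [NormedAddCommGroup H₁] [InnerProductSpace ℂ H₁] [CompleteSpace H₁]
variable {H₂ : Type w₂} [NormedAddCommGroup H₂] [InnerProductSpace ℂ H₂] [CompleteSpace H₂]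
variable {H : Type u} [NormedAddCommGroup H] [InnerProductSpace ℂ H] [CompleteSpace H]
variable {K : Type u} [NormedAddCommGroup K] [InnerProductSpace ℂ K] [CompleteSpace K]
variable {A : NonUnitalSubalgebra ℂ (H₁ →L[ℂ] H₁)} {C : NonUnitalStarSubalgebra ℂ (H₁ →L[ℂ] H₁)}
variable {B : NonUnitalSubalgebra ℂ (H₂ →L[ℂ] H₂)} {D : NonUnitalStarSubalgebra ℂ (H₂ →L[ℂ] H₂)}
variable {α : RepHom A H} {β : RepHom B K} {M : Submodule ℂ (H →L[ℂ] K)}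

theorem ContractiveRow.norm_sq_gram_le (r : ContractiveRow M) (y : K) :
    ‖r.gram y‖ ^ 2 ≤ ∑ p, ‖adjoint (r.entry p : H →L[ℂ] K) y‖ ^ 2 := by
  rw [r.gram_apply]
  exact r.norm_row_le _

variable (ctx : DeltaContext C D α β M) {X : HMod.{u} A} {Y : HMod.{u} B}
  (S : TRORep α β M X Y) {ι κ : Type} [Fintype ι] [Fintype κ]
include ctx

/-- The matrix over `A` with entries `rₚ⋆ bᵢₖ s_q`. -/
def DeltaContext.compressMatrix (r s : ContractiveRow M) (b : Matrix ι κ B) :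
    Matrix (ι × Fin r.n) (κ × Fin s.n) A :=
  Matrix.of fun ip kq => ctx.compress (r.entry ip.2) (s.entry kq.2) (b ip.1 kq.1)

include S in
/-- Compressing between two contractive rows does not increase the norm in the representations. -/
theorem TRORep.matNorm_compressMatrix_le (r s : ContractiveRow M) (b : Matrix ι κ B) :
    matNorm ((ctx.compressMatrix r s b).map X.rep) ≤ matNorm (b.map Y.rep) := by
  refine matNorm_le (matNorm_nonneg _) fun x => ?_
  let y : κ → Y.carrier := fun k => ∑ q, S.L (s.entry q) (x (k, q))
  have h1 : ∀ (i : ι) (p : Fin r.n),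
      ∑ kq, (ctx.compressMatrix r s b).map X.rep (i, p) kq (x kq) =
        adjoint (S.L (r.entry p)) (∑ k, Y.rep (b i k) (y k)) := by
    intro i p
    rw [Fintype.sum_prod_type, map_sum]
    refine Finset.sum_congr rfl fun k _ => ?_
    simp only [y, map_sum]
    refine Finset.sum_congr rfl fun q _ => ?_
    exact S.act_right _ _ _ (b i k) (ctx.map_compress _ _ _) _
  calc _ = ∑ i, ∑ p, ‖adjoint (S.L (r.entry p)) (∑ k, Y.rep (b i k) (y k))‖ ^ 2 := by
        rw [Fintype.sum_prod_type]
        simp only [h1]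
    _ ≤ ∑ i, ‖∑ k, Y.rep (b i k) (y k)‖ ^ 2 :=
        Finset.sum_le_sum fun i _ => S.sum_norm_sq_adjoint_L_le ctx r _
    _ ≤ matNorm (b.map Y.rep) ^ 2 * ∑ k, ‖y k‖ ^ 2 := sum_norm_sq_le (b.map Y.rep) y
    _ ≤ _ := by
        refine mul_le_mul_of_nonneg_left ?_ (by positivity)
        rw [Fintype.sum_prod_type]
        exact Finset.sum_le_sum fun k _ => S.norm_sq_sum_L_le ctx s fun q => x (k, q)

/-- With `R` and `R'` the row operators of `r` and `s`, `R R⋆ b R' R'⋆` is bounded by the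
compression
`R⋆ b R'`. -/
theorem sum_norm_sq_gram_comp_gram_le (r s : ContractiveRow M) (b : Matrix ι κ B) (z : κ → K) :
    ∑ i, ‖r.gram (∑ k, β (b i k) (s.gram (z k)))‖ ^ 2 ≤
      matNorm ((ctx.compressMatrix r s b).map α) ^ 2 * ∑ k, ‖z k‖ ^ 2 := by
  let x : κ × Fin s.n → H := fun kq => adjoint (s.entry kq.2 : H →L[ℂ] K) (z kq.1)
  have h1 : ∀ (i : ι) (p : Fin r.n),
      adjoint (r.entry p : H →L[ℂ] K) (∑ k, β (b i k) (s.gram (z k))) =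
        ∑ kq, (ctx.compressMatrix r s b).map α (i, p) kq (x kq) := by
    intro i p
    rw [Fintype.sum_prod_type, map_sum]
    refine Finset.sum_congr rfl fun k _ => ?_
    rw [s.gram_apply, map_sum, map_sum]
    refine Finset.sum_congr rfl fun q _ => ?_
    have e := ctx.map_compress (r.entry p) (s.entry q) (b i k)
    exact (DFunLike.congr_fun e (x (k, q))).symm
  calc _ ≤ ∑ i, ∑ p, ‖adjoint (r.entry p : H →L[ℂ] K) (∑ k, β (b i k) (s.gram (z k)))‖ ^ 2 :=
        Finset.sum_le_sum fun i _ => r.norm_sq_gram_le _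
    _ = ∑ ip, ‖∑ kq, (ctx.compressMatrix r s b).map α ip kq (x kq)‖ ^ 2 := by
        rw [Fintype.sum_prod_type]
        simp only [h1]
    _ ≤ matNorm ((ctx.compressMatrix r s b).map α) ^ 2 * ∑ kq, ‖x kq‖ ^ 2 := sum_norm_sq_le _ x
    _ ≤ _ := by
        refine mul_le_mul_of_nonneg_left ?_ (by positivity)
        rw [Fintype.sum_prod_type]
        exact Finset.sum_le_sum fun k _ => s.norm_col_le (z k)

/-- The matrix norms of `B` are determined by the compressions to `A`. -/
theorem matNorm_map_le_of_compress (b : Matrix ι κ B) {c : ℝ} (hc : 0 ≤ c)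
    (h : ∀ r s : ContractiveRow M, matNorm ((ctx.compressMatrix r s b).map α) ≤ c) :
    matNorm (b.map β) ≤ c := by
  obtain ⟨l, hl, hlim⟩ := ctx.equiv.isTRO.exists_filter
  refine matNorm_le hc fun z => ?_
  have key : ∀ r s : ContractiveRow M,
      ∑ i, ‖r.gram (∑ k, β (b i k) (s.gram (z k)))‖ ^ 2 ≤ c ^ 2 * ∑ k, ‖z k‖ ^ 2 := fun r s =>
    (sum_norm_sq_gram_comp_gram_le ctx r s b z).trans (mul_le_mul_of_nonneg_right
      (pow_le_pow_left₀ (matNorm_nonneg _) (h r s) 2) (by positivity))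
  have ev : ∀ (k : K), Continuous fun T : K →L[ℂ] K => T k := fun k => by fun_prop
  have key' : ∀ s : ContractiveRow M,
      ∑ i, ‖∑ k, β (b i k) (s.gram (z k))‖ ^ 2 ≤ c ^ 2 * ∑ k, ‖z k‖ ^ 2 := by
    intro s
    have ht : Tendsto (fun r : ContractiveRow M =>
        ∑ i, ‖∑ k, (r.gram ∘L β (b i k)) (s.gram (z k))‖ ^ 2) l
        (𝓝 (∑ i, ‖∑ k, β (b i k) (s.gram (z k))‖ ^ 2)) :=
      tendsto_finsetSum _ fun i _ => (tendsto_finsetSum _ fun k _ =>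
        ((ev _).tendsto _).comp (ctx.tendsto_gram_comp hlim (b i k))).norm.pow 2
    refine le_of_tendsto ht (Eventually.of_forall fun r => le_trans (le_of_eq ?_) (key r s))
    refine Finset.sum_congr rfl fun i _ => ?_
    rw [map_sum]
    rfl
  have ht : Tendsto (fun s : ContractiveRow M =>
      ∑ i, ‖∑ k, (β (b i k) ∘L s.gram) (z k)‖ ^ 2) l
      (𝓝 (∑ i, ‖∑ k, β (b i k) (z k)‖ ^ 2)) :=
    tendsto_finsetSum _ fun i _ => (tendsto_finsetSum _ fun k _ =>
      ((ev _).tendsto _).comp (ctx.tendsto_comp_gram hlim (b i k))).norm.pow 2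
  exact le_of_tendsto ht (Eventually.of_forall key')

include S in
/-- The norm of a matrix over `B` is the supremum of the norms of its compressions, which are
matrices over `A` whose norms are computed in `X`. -/
theorem TRORep.completelyIsometric (hX : CompletelyIsometric X.rep) :
    CompletelyIsometric Y.rep := by
  intro ι κ _ _ b
  refine le_antisymm (Y.completelyContractive b) ?_
  rw [← ctx.isoRight b]
  refine matNorm_map_le_of_compress ctx b (matNorm_nonneg _) fun r s => ?_
  rw [ctx.isoLeft (ctx.compressMatrix r s b), ← hX (ctx.compressMatrix r s b)]
  exact S.matNorm_compressMatrix_le ctx r s b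

end Isometric

/-! ### The equivalence of categories -/

section Equivalence

variable {H₁ : Type w₁} [NormedAddCommGroup H₁] [InnerProductSpace ℂ H₁] [CompleteSpace H₁]
variable {H₂ : Type w₂} [NormedAddCommGroup H₂] [InnerProductSpace ℂ H₂] [CompleteSpace H₂]
variable {H : Type u} [NormedAddCommGroup H] [InnerProductSpace ℂ H] [CompleteSpace H]
variable {K : Type u} [NormedAddCommGroup K] [InnerProductSpace ℂ K] [CompleteSpace K]
variable {A : NonUnitalSubalgebra ℂ (H₁ →L[ℂ] H₁)} {C : NonUnitalStarSubalgebra ℂ (H₁ →L[ℂ] H₁)}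
variable {B : NonUnitalSubalgebra ℂ (H₂ →L[ℂ] H₂)} {D : NonUnitalStarSubalgebra ℂ (H₂ →L[ℂ] H₂)}
variable {α : RepHom A H} {β : RepHom B K} {M : Submodule ℂ (H →L[ℂ] K)}
variable (ctx : DeltaContext C D α β M)
include ctx

/-- Every representation of `B` is the tensor product of `M` with a representation of `A`, namely
with its own tensor product with `M⋆`. -/
theorem DeltaContext.exists_troRep (Y : HMod.{u} B) :
    ∃ X : HMod.{u} A, Nonempty (TRORep α β M X Y) := by
  obtain ⟨X, -, S, -, -⟩ := (ctx.symm.tensorFrame Y.column).exists_hilbertModule ctx.symm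
    (ctx.symm.isAction_tensorFrame Y.column)
  exact ⟨X, ⟨S.flip (fun m hm => adjoint_mem_adjointSpace hm) fun n hn => hn⟩⟩

namespace TensorFunctor

variable (F : TensorFunctor α β M)

/-- The representation of `B` on the tensor product of `M` with a representation of `A`. -/
def hilbertObj (X : HMod.{u} A) : HMod.{u} B :=
  ((F.frame ctx X.column).exists_hilbertModule ctx (F.isAction_frame ctx X.column)).choose

/-- The identification of the column space of `hilbertObj` with the tensor product. -/
def hilbertIso (X : HMod.{u} A) : (F.hilbertObj ctx X).column ≅ F.functor.obj X.column :=
  ((F.frame ctx X.column).exists_hilbertModule ctx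
    (F.isAction_frame ctx X.column)).choose_spec.choose

/-- The representation of `M` by the creation operators `x ↦ m ⊗ x`. -/
def troRep (X : HMod.{u} A) : TRORep α β M X (F.hilbertObj ctx X) :=
  ((F.frame ctx X.column).exists_hilbertModule ctx
    (F.isAction_frame ctx X.column)).choose_spec.choose_spec.choose

theorem isCompleteIsometry_hilbertIso (X : HMod.{u} A) :
    IsCompleteIsometry (OMod.lin (F.hilbertIso ctx X).hom) :=
  ((F.frame ctx X.column).exists_hilbertModule ctx
    (F.isAction_frame ctx X.column)).choose_spec.choose_spec.choose_spec.1

theorem hilbertIso_L (X : HMod.{u} A) (m : M) (x : X.carrier) :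
    OMod.lin (F.hilbertIso ctx X).hom ((F.troRep ctx X).L m x) =
      (F.frame ctx X.column).hilbertL m x :=
  ((F.frame ctx X.column).exists_hilbertModule ctx
    (F.isAction_frame ctx X.column)).choose_spec.choose_spec.choose_spec.2 m x

/-- The map on intertwiners, determined by `m ⊗ x ↦ m ⊗ f x`. -/
def hilbertMap {X X' : HMod.{u} A} (f : X ⟶ X') : F.hilbertObj ctx X ⟶ F.hilbertObj ctx X' :=
  ((F.troRep ctx X).exists_map ctx (F.troRep ctx X') f).choose

theorem hilbertMap_L {X X' : HMod.{u} A} (f : X ⟶ X') (m : M) (x : X.carrier) :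
    HMod.Hom.toCLM (F.hilbertMap ctx f) ((F.troRep ctx X).L m x) =
      (F.troRep ctx X').L m (HMod.Hom.toCLM f x) :=
  ((F.troRep ctx X).exists_map ctx (F.troRep ctx X') f).choose_spec m x

/-- The restriction of the tensor functor to Hilbert space representations. -/
def hilbertFunctor : HMod.{u} A ⥤ HMod.{u} B where
  obj := F.hilbertObj ctx
  map f := F.hilbertMap ctx f
  map_id X := (F.troRep ctx X).hom_ext fun m x => F.hilbertMap_L ctx (𝟙 X) m x
  map_comp {X X' X''} f g := (F.troRep ctx X).hom_ext fun m x => by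
    change _ = HMod.Hom.toCLM (F.hilbertMap ctx g)
      (HMod.Hom.toCLM (F.hilbertMap ctx f) ((F.troRep ctx X).L m x))
    rw [hilbertMap_L, hilbertMap_L, hilbertMap_L]
    rfl

theorem hilbertIso_naturality {X X' : HMod.{u} A} (f : X ⟶ X') :
    (columnFunctor B).map (F.hilbertMap ctx f) ≫ (F.hilbertIso ctx X').hom =
      (F.hilbertIso ctx X).hom ≫ F.functor.map ((columnFunctor A).map f) := by
  set G₁ := (columnFunctor B).map (F.hilbertMap ctx f) ≫ (F.hilbertIso ctx X').hom with h₁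
  set G₂ := (F.hilbertIso ctx X).hom ≫ F.functor.map ((columnFunctor A).map f) with h₂
  obtain ⟨g₁, -, -, hg₁, -⟩ := OMod.Hom.exists_clm G₁
  obtain ⟨g₂, -, -, hg₂, -⟩ := OMod.Hom.exists_clm G₂
  have e : g₁ = g₂ := by
    refine clm_ext_of_dense_span (F.troRep ctx X).dense ?_
    rintro _ ⟨m, x, rfl⟩
    refine (hg₁ _).trans (Eq.trans ?_ (hg₂ _).symm)
    have e1 : OMod.lin G₁ ((F.troRep ctx X).L m x) = OMod.lin (F.hilbertIso ctx X').hom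
        (HMod.Hom.toCLM (F.hilbertMap ctx f) ((F.troRep ctx X).L m x)) := rfl
    have e2 : OMod.lin G₂ ((F.troRep ctx X).L m x) =
        OMod.lin (F.functor.map ((columnFunctor A).map f))
          (OMod.lin (F.hilbertIso ctx X).hom ((F.troRep ctx X).L m x)) := rfl
    refine e1.trans (Eq.trans ?_ e2.symm)
    rw [hilbertMap_L, hilbertIso_L, hilbertIso_L]
    exact (F.map_tens ((columnFunctor A).map f) m x).symm
  refine OMod.Hom.ext (LinearMap.ext fun x => ?_)
  exact (hg₁ x).symm.trans ((DFunLike.congr_fun e x).trans (hg₂ x))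

/-- On Hilbert space representations the tensor functor is given by `hilbertFunctor`. -/
def hilbertFunctorIso :
    F.hilbertFunctor ctx ⋙ columnFunctor B ≅ columnFunctor A ⋙ F.functor :=
  NatIso.ofComponents (fun X => F.hilbertIso ctx X) fun f => F.hilbertIso_naturality ctx f

/-- Faithfulness, fullness and essential surjectivity each come from the symmetry of `TRORep` under
exchanging `A` and `B`. -/
theorem isEquivalence_hilbertFunctor : (F.hilbertFunctor ctx).IsEquivalence where
  faithful :=
    { map_injective := fun {X X'} f f' h => by
        refine (F.troRep ctx X').hom_ext_right fun m x => ?_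
        have h' : F.hilbertMap ctx f = F.hilbertMap ctx f' := h
        rw [← hilbertMap_L, ← hilbertMap_L, h'] }
  full :=
    { map_surjective := fun {X X'} g => by
        obtain ⟨f, hf⟩ := (F.troRep ctx X).exists_map_of_map ctx (F.troRep ctx X') g
        refine ⟨f, (F.troRep ctx X).hom_ext fun m x => ?_⟩
        exact (F.hilbertMap_L ctx f m x).trans (hf m x).symm }
  essSurj :=
    { mem_essImage := fun Y => by
        obtain ⟨X, ⟨S⟩⟩ := ctx.exists_troRep Y
        exact ⟨X, (F.troRep ctx X).nonempty_iso ctx S⟩ }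

end TensorFunctor

end Equivalence

end DeltaMorita

end

theorem mainTheorem9
    {H₁ : Type w₁} [NormedAddCommGroup H₁] [InnerProductSpace ℂ H₁] [CompleteSpace H₁]
    {H₂ : Type w₂} [NormedAddCommGroup H₂] [InnerProductSpace ℂ H₂] [CompleteSpace H₂]
    {A : NonUnitalSubalgebra ℂ (H₁ →L[ℂ] H₁)} {C : NonUnitalStarSubalgebra ℂ (H₁ →L[ℂ] H₁)}
    {B : NonUnitalSubalgebra ℂ (H₂ →L[ℂ] H₂)} {D : NonUnitalStarSubalgebra ℂ (H₂ →L[ℂ] H₂)}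
    (hAC : DeltaMorita.IsDeltaPair A C) (hBD : DeltaMorita.IsDeltaPair B D)
    {H : Type u} [NormedAddCommGroup H] [InnerProductSpace ℂ H] [CompleteSpace H]
    {K : Type u} [NormedAddCommGroup K] [InnerProductSpace ℂ K] [CompleteSpace K]
    (α : A →ₙₐ[ℂ] (H →L[ℂ] H)) (β : B →ₙₐ[ℂ] (K →L[ℂ] K)) (M : Submodule ℂ (H →L[ℂ] K))
    (hM : DeltaMorita.ImplementsDeltaEquivalence C D α β M) :
    Nonempty (DeltaMorita.TensorFunctor α β M) ∧
    ∀ F : DeltaMorita.TensorFunctor α β M,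
      ∃ (Φ : DeltaMorita.HMod.{u} A ⥤ DeltaMorita.HMod.{u} B)
        (e : Φ ⋙ DeltaMorita.columnFunctor B ≅ DeltaMorita.columnFunctor A ⋙ F.functor),
        (∀ X : DeltaMorita.HMod.{u} A,
          DeltaMorita.IsCompleteIsometry (DeltaMorita.OMod.lin (e.hom.app X))) ∧
        Φ.IsEquivalence ∧
        ∀ X : DeltaMorita.HMod.{u} A,
          DeltaMorita.CompletelyIsometric X.rep →
            DeltaMorita.CompletelyIsometric (Φ.obj X).rep := by
  have ctx : DeltaMorita.DeltaContext C D α β M := ⟨hAC, hBD, hM⟩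
  refine ⟨⟨ctx.tensorFunctor⟩, fun F => ?_⟩
  exact ⟨F.hilbertFunctor ctx, F.hilbertFunctorIso ctx, F.isCompleteIsometry_hilbertIso ctx,
    F.isEquivalence_hilbertFunctor ctx, fun X hX => (F.troRep ctx X).completelyIsometric ctx hX⟩
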